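/- Let $(\xi_k)_{k\in\mathbb Z}$ be a (strictly) stationary Markov chain on a probability space $(\Omega,\mathcal F,\mathbb P)$ with values in a measurable space $(S,\mathcal A)$, and let $\pi_0$ be the law of $\xi_0$. Let $f:S\to\mathbb R$ be measurable with $\int f^2\,d\pi_0<\infty$ and $\int f\,d\pi_0=0$, and put $S_n=\sum_{i=1}^n f(\xi_i)$. Suppose that $$\sup_{n\ge 1}\frac{E(S_n^2)}{n}<\infty$$ and that the chain is absolutely regular, that is, $$\beta_n=E\Big(\sup_{A\in\sigma(\xi_k,\,k\ge n)}\big|\mathbb P(A\mid \sigma(\xi_k,\,k\le 0))-\mathbb P(A)\big|\Big)\longrightarrow 0\qquad(n\to\infty),$$ where the supremum is the essential supremum of the family of random variables (it is the pointwise supremum for a regular version of the conditional probability when $S$ is, for instance, a separable Banach space with its Borel $\sigma$-algebra). Then the limit $$\sigma^2=\lim_{n\to\infty}\frac{\pi\,(E|S_n|)^2}{2n}$$ (where $\pi=3.14159\ldots$) exists in $[0,\infty)$, and $S_n/\sqrt n$ converges in distribution to $N(0,\sigma^2)$, where $N(0,0)$ is the point mass at $0$. -/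

import Mathlib

open MeasureTheory ProbabilityTheory Filter Topology
open scoped ENNReal NNReal

namespace MarkovCLT

section Processes

variable {Ω S : Type*} [mΩ : MeasurableSpace Ω] [MeasurableSpace S]

/-- The past `σ(ξ k, k ≤ n)` of a process indexed by `ℤ`. -/
def past (ξ : ℤ → Ω → S) (n : ℤ) : MeasurableSpace Ω :=
  ⨆ k : {k : ℤ // k ≤ n}, MeasurableSpace.comap (ξ k.1) inferInstance

/-- The future `σ(ξ k, k ≥ n)` of a process indexed by `ℤ`. -/
def future (ξ : ℤ → Ω → S) (n : ℤ) : MeasurableSpace Ω :=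
  ⨆ k : {k : ℤ // n ≤ k}, MeasurableSpace.comap (ξ k.1) inferInstance

/-- `ξ` is a (strictly) stationary Markov chain indexed by `ℤ` with values in `S`: the law of the
whole sequence is invariant under the time shift, and the conditional law of `ξ (n + 1)` given the
past up to time `n` is the conditional law given `ξ n`. -/
structure IsStationaryMarkovChain (μ : Measure Ω) (ξ : ℤ → Ω → S) : Prop where
  measurable : ∀ k, Measurable (ξ k)
  stationary : μ.map (fun ω (k : ℤ) => ξ (k + 1) ω) = μ.map (fun ω (k : ℤ) => ξ k ω)
  markov : ∀ (n : ℤ) (A : Set S), MeasurableSet A →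
    μ⟦ξ (n + 1) ⁻¹' A | past ξ n⟧ =ᵐ[μ]
      μ⟦ξ (n + 1) ⁻¹' A | MeasurableSpace.comap (ξ n) inferInstance⟧

/-- The coefficient of absolute regularity `E (sup_{B ∈ ℬ} |P(B | 𝒜) - P(B)|)` of two σ-algebras.
As each `P(B | 𝒜)` is a random variable defined up to null sets, the supremum over the
(uncountable) family `ℬ` is the essential supremum, the a.e. smallest random variable that
dominates every member of the family a.e.; its expectation is the smallest expectation
of a dominating random variable. When a regular version of `P(· | 𝒜)` on a countably generated
`ℬ` exists, this is the expectation of the pointwise supremum for that version. -/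
noncomputable def betaCoeff (μ : Measure Ω) (𝒜 ℬ : MeasurableSpace Ω) : ℝ≥0∞ :=
  ⨅ (g : Ω → ℝ≥0∞) (_ : Measurable[mΩ] g)
    (_ : ∀ B : Set Ω, MeasurableSet[ℬ] B →
      ∀ᵐ ω ∂μ, ENNReal.ofReal |(μ⟦B | 𝒜⟧) ω - μ.real B| ≤ g ω),
    ∫⁻ ω, g ω ∂μ

/-- The process `ξ` is absolutely regular: `β_n = β(σ(ξ k, k ≤ 0), σ(ξ k, k ≥ n))` tends to `0`. -/
def IsAbsolutelyRegular (μ : Measure Ω) (ξ : ℤ → Ω → S) : Prop :=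
  Tendsto (fun n : ℕ => betaCoeff μ (past ξ 0) (future ξ n)) atTop (𝓝 0)

/-- The additive functional `S_n = f(ξ_1) + ⋯ + f(ξ_n)`. -/
def partialSum (ξ : ℤ → Ω → S) (f : S → ℝ) (n : ℕ) (ω : Ω) : ℝ :=
  ∑ i ∈ Finset.Icc 1 n, f (ξ (i : ℤ) ω)

end Processes

end MarkovCLT

namespace MarkovCLT

/-! ### Conditional centring, tested on events. -/

section Orthogonality

variable {Ω : Type*} {m m₁ m₂ mΩ : MeasurableSpace Ω} {μ : Measure Ω} [IsProbabilityMeasure μ]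

/-! Put D_n = S_n - E(S_n | ξ_0, ξ_n) and a_n = E D_n². Cut the time up to n into N = n / m blocks
of length m, and let d_j be the j-th block sum minus its conditional expectation given the two ends
of that block. The two-sided Markov property (`condExp_past_sup_future_eq_zero`) makes d_j centred
given everything before and after its block. So the d_j are stationary martingale differences,
mutually orthogonal, and orthogonal to every part of D_n except the sum over their own block.
Expanding the square gives E(D_n - ∑ d_j)² = a_n - N a_m; `integral_sq_blockDiff_sub_sum` is the
version of this that allows truncated blocks. As a_n ≤ E S_n² ≤ C n, the number v = sup a_n / n is
finite, and an m with a_m / m close to v makes the right side a small multiple of n for large n.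
Near-extremality does the work that convergence of a_n / n would otherwise do.

The discarded term E(S_n | ξ_0, ξ_n) is o(√n) in L¹ (`eventually_integral_abs_endpoint_le`), and
this is where absolute regularity is essential. It gives a single finite measure ν of small mass
that bounds the dependence between past and future, event by event (`exists_mixesWith`). An event in
σ(ξ_0, ξ_N) is nearly a finite union of pieces {ξ_0 in a slice} ∩ {ξ_N in a set depending on the
slice}; the errors on the disjoint slices add up to at most a multiple of the mass of ν, however
fine the slicing (`MixesWith.abs_setIntegral_window_le`). Truncation at a multiple of √N together
with the variance bound takes care of unbounded sums.

With truncated blocks (`exists_bounded_isCentering`) the differences are bounded and mixing yields a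
law of large numbers for their squares, so an elementary martingale central limit theorem applies to
the block sums. Letting the approximation error tend to 0 gives S_n / √n → N(0, v)
(`exists_tendsto_integral_exp_segSum`).

The approximation of S_n holds only in L¹, so it does not identify v as a limit of second moments.
Bounded second moments do suffice for E|S_n| / √n to converge to E|N(0, v)| = √(2v/π), and solving
for v gives the formula for σ². -/

lemma integral_mul_eq_zero_of_condExp_eq_zero (hm : m ≤ mΩ) {U Y : Ω → ℝ}
    (hUi : Integrable U μ) (hU : μ[U|m] =ᵐ[μ] 0) (hY : StronglyMeasurable[m] Y)
    (hYU : Integrable (Y * U) μ) : ∫ ω, Y ω * U ω ∂μ = 0 := by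
  have h1 : ∫ ω, (μ[Y * U|m]) ω ∂μ = ∫ ω, (Y * U) ω ∂μ := integral_condExp hm
  have h2 : μ[Y * U|m] =ᵐ[μ] 0 := by
    filter_upwards [condExp_mul_of_stronglyMeasurable_left hY hYU hUi, hU] with ω h h'
    rw [h, Pi.mul_apply, h']; simp
  rw [integral_congr_ae h2] at h1
  simpa using h1.symm

lemma condExp_eq_zero_of_setIntegral (hm : m ≤ mΩ) {U : Ω → ℝ}
    (hUi : Integrable U μ) (h : ∀ E, MeasurableSet[m] E → ∫ ω in E, U ω ∂μ = 0) :
    μ[U|m] =ᵐ[μ] 0 := by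
  symm
  refine ae_eq_condExp_of_forall_setIntegral_eq hm hUi (fun s _ _ => integrable_zero _ _ _)
    (fun s hs _ => ?_) aestronglyMeasurable_zero
  simp [h s hs]

lemma setIntegral_eq_zero_of_condExp (hm : m ≤ mΩ) {U : Ω → ℝ}
    (hUi : Integrable U μ) (h : μ[U|m] =ᵐ[μ] 0) {E : Set Ω} (hE : MeasurableSet[m] E) :
    ∫ ω in E, U ω ∂μ = 0 := by
  rw [← setIntegral_condExp hm hUi hE, setIntegral_congr_ae (g := fun _ => 0) (hm _ hE)]
  · simp
  · filter_upwards [h] with ω hω _ using hω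

lemma condExp_eq_zero_mono (h12 : m₁ ≤ m₂) (h2 : m₂ ≤ mΩ) {U : Ω → ℝ}
    (hUi : Integrable U μ) (h : μ[U|m₂] =ᵐ[μ] 0) : μ[U|m₁] =ᵐ[μ] 0 :=
  condExp_eq_zero_of_setIntegral (h12.trans h2) hUi fun _ hE =>
    setIntegral_eq_zero_of_condExp h2 hUi h (h12 _ hE)

omit [IsProbabilityMeasure μ] in
lemma setIntegral_eq_zero_of_isPiSystem (hm : m ≤ mΩ) {C : Set (Set Ω)} (hC : IsPiSystem C)
    (hgen : m = MeasurableSpace.generateFrom C) {U : Ω → ℝ} (hUi : Integrable U μ)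
    (huniv : ∫ ω, U ω ∂μ = 0) (h : ∀ E ∈ C, ∫ ω in E, U ω ∂μ = 0)
    {E : Set Ω} (hE : MeasurableSet[m] E) : ∫ ω in E, U ω ∂μ = 0 := by
  induction E, hE using MeasurableSpace.induction_on_inter hgen hC with
  | empty => simp
  | basic t ht => exact h t ht
  | compl t ht ih =>
    have := integral_add_compl (hm _ ht) hUi
    rw [ih, huniv] at this
    simpa using this
  | iUnion F hd hF ih =>
    rw [integral_iUnion (fun i => hm _ (hF i)) hd hUi.integrableOn]
    simp [ih]

/-- Intersections `B ∩ C` form a π-system generating the join, so a Dynkin argument reduces centring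
to them. -/
lemma condExp_sup_eq_zero (h1 : m₁ ≤ mΩ) (h2 : m₂ ≤ mΩ) {U : Ω → ℝ} (hUi : Integrable U μ)
    (h : ∀ B C, MeasurableSet[m₁] B → MeasurableSet[m₂] C → ∫ ω in B ∩ C, U ω ∂μ = 0) :
    μ[U|m₁ ⊔ m₂] =ᵐ[μ] 0 := by
  refine condExp_eq_zero_of_setIntegral (sup_le h1 h2) hUi fun E hE => ?_
  refine setIntegral_eq_zero_of_isPiSystem (m := m₁ ⊔ m₂) (sup_le h1 h2)
    (C := Set.image2 (· ∩ ·) {s | MeasurableSet[m₁] s} {s | MeasurableSet[m₂] s}) ?_ ?_ hUi ?_ ?_ hE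
  · rintro _ ⟨a, ha, b, hb, rfl⟩ _ ⟨c, hc, d, hd, rfl⟩ _
    exact ⟨a ∩ c, MeasurableSet.inter ha hc, b ∩ d, MeasurableSet.inter hb hd,
      Set.inter_inter_inter_comm _ _ _ _⟩
  · apply le_antisymm
    · refine sup_le (fun s hs => ?_) (fun s hs => ?_)
      · exact MeasurableSpace.measurableSet_generateFrom
          ⟨s, hs, Set.univ, MeasurableSet.univ, Set.inter_univ s⟩
      · exact MeasurableSpace.measurableSet_generateFrom
          ⟨Set.univ, MeasurableSet.univ, s, hs, Set.univ_inter s⟩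
    · refine MeasurableSpace.generateFrom_le ?_
      rintro _ ⟨a, ha, b, hb, rfl⟩
      exact MeasurableSet.inter ((le_sup_left : m₁ ≤ m₁ ⊔ m₂) _ ha)
        ((le_sup_right : m₂ ≤ m₁ ⊔ m₂) _ hb)
  · simpa using h Set.univ Set.univ MeasurableSet.univ MeasurableSet.univ
  · rintro _ ⟨a, ha, b, hb, rfl⟩
    exact h a b ha hb

lemma condExp_iSup_eq_zero {M : ℕ → MeasurableSpace Ω} (hM : ∀ n, M n ≤ mΩ) (hmono : Monotone M)
    {U : Ω → ℝ} (hUi : Integrable U μ) (h : ∀ n, μ[U|M n] =ᵐ[μ] 0) :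
    μ[U|⨆ n, M n] =ᵐ[μ] 0 := by
  have hs : ∀ n E, MeasurableSet[M n] E → ∫ ω in E, U ω ∂μ = 0 := fun n E hE =>
    setIntegral_eq_zero_of_condExp (hM n) hUi (h n) hE
  refine condExp_eq_zero_of_setIntegral (iSup_le hM) hUi fun E hE => ?_
  refine setIntegral_eq_zero_of_isPiSystem (m := ⨆ n, M n) (iSup_le hM)
    (C := {s | ∃ n, MeasurableSet[M n] s}) ?_ ?_ hUi ?_ ?_ hE
  · rintro s ⟨i, hi⟩ t ⟨j, hj⟩ _
    exact ⟨max i j, MeasurableSet.inter (hmono (le_max_left i j) _ hi)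
      (hmono (le_max_right i j) _ hj)⟩
  · exact (MeasurableSpace.generateFrom_iUnion_measurableSet M).symm.trans (by
      congr 1; ext s; simp)
  · simpa using hs 0 Set.univ MeasurableSet.univ
  · rintro s ⟨n, hn⟩
    exact hs n s hn

omit [IsProbabilityMeasure μ] in
lemma integral_abs_eq_two_mul {U : Ω → ℝ} (hU : Integrable U μ) (h0 : ∫ ω, U ω ∂μ = 0)
    (hE : MeasurableSet {ω | 0 < U ω}) : ∫ ω, |U ω| ∂μ = 2 * ∫ ω in {ω | 0 < U ω}, U ω ∂μ := by
  have h1 : ∀ ω, |U ω| = 2 * Set.indicator {ω | 0 < U ω} U ω - U ω := by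
    intro ω
    by_cases h : 0 < U ω
    · rw [Set.indicator_of_mem (by exact h), abs_of_pos h]; ring
    · rw [Set.indicator_of_notMem (by exact h), abs_of_nonpos (not_lt.mp h)]; ring
  simp_rw [h1]
  rw [integral_sub ((hU.indicator hE).const_mul 2) hU, integral_const_mul, integral_indicator hE, h0,
    sub_zero]

/-- The factor 2 comes from using the bound on two events, where the conditional expectation is
nonnegative and where it is negative. -/
lemma integral_abs_condExp_le_of_setIntegral (hm : m ≤ mΩ) {U : Ω → ℝ} (hUi : Integrable U μ)
    {c : ℝ} (h : ∀ B, MeasurableSet[m] B → |∫ ω in B, U ω ∂μ| ≤ c) :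
    ∫ ω, |(μ[U|m]) ω| ∂μ ≤ 2 * c := by
  set V := μ[U|m]
  have hV : StronglyMeasurable[m] V := stronglyMeasurable_condExp
  have hVi : Integrable V μ := integrable_condExp
  have hB : MeasurableSet[m] {ω | 0 ≤ V ω} :=
    hV.measurable measurableSet_Ici
  have e1 : ∫ ω, |V ω| ∂μ = (∫ ω in {ω | 0 ≤ V ω}, V ω ∂μ) - ∫ ω in {ω | 0 ≤ V ω}ᶜ, V ω ∂μ := by
    rw [← integral_add_compl (hm _ hB) hVi.abs, sub_eq_add_neg, ← integral_neg]
    congr 1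
    · exact setIntegral_congr_fun (hm _ hB) fun ω hω => abs_of_nonneg hω
    · exact setIntegral_congr_fun (hm _ hB).compl fun ω hω => abs_of_neg (not_le.mp hω)
  rw [e1, setIntegral_condExp hm hUi hB, setIntegral_condExp hm hUi hB.compl]
  have a := abs_le.mp (h _ hB)
  have b := abs_le.mp (h _ hB.compl)
  linarith

/-- Pairing with an `m`-measurable ψ sees only `μ[U|m]`. This carries mixing bounds from events to
bounded functions. -/
lemma abs_integral_mul_le_of_setIntegral (hm : m ≤ mΩ) {U ψ : Ω → ℝ} (hUi : Integrable U μ)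
    {c K : ℝ} (hK : 0 ≤ K) (h : ∀ B, MeasurableSet[m] B → |∫ ω in B, U ω ∂μ| ≤ c)
    (hψ : StronglyMeasurable[m] ψ) (hψK : ∀ ω, |ψ ω| ≤ K) :
    |∫ ω, ψ ω * U ω ∂μ| ≤ 2 * K * c := by
  have hi : Integrable (ψ * U) μ :=
    hUi.bdd_mul (hψ.mono hm).aestronglyMeasurable (Eventually.of_forall hψK)
  have h1 : ∫ ω, ψ ω * U ω ∂μ = ∫ ω, ψ ω * (μ[U|m]) ω ∂μ := by
    change ∫ ω, (ψ * U) ω ∂μ = _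
    rw [← integral_condExp hm]
    exact integral_congr_ae (condExp_mul_of_stronglyMeasurable_left hψ hi hUi)
  rw [h1]
  have hVi : Integrable (μ[U|m]) μ := integrable_condExp
  calc |∫ ω, ψ ω * (μ[U|m]) ω ∂μ| ≤ ∫ ω, |ψ ω * (μ[U|m]) ω| ∂μ := abs_integral_le_integral_abs
    _ ≤ ∫ ω, K * |(μ[U|m]) ω| ∂μ := by
        refine integral_mono_of_nonneg (Eventually.of_forall fun _ => abs_nonneg _)
          (hVi.abs.const_mul K) (Eventually.of_forall fun ω => ?_)
        simp only [abs_mul]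
        exact mul_le_mul_of_nonneg_right (hψK ω) (abs_nonneg _)
    _ ≤ 2 * K * c := by
        rw [integral_const_mul]
        nlinarith [integral_abs_condExp_le_of_setIntegral hm hUi h]

end Orthogonality

/-! ### Central limit theorem for bounded martingale differences. -/

section MartingaleCLT

variable {Ω : Type*} {m mΩ : MeasurableSpace Ω} {μ : Measure Ω} [IsProbabilityMeasure μ]

lemma integral_complex_mul_eq_zero_of_condExp_eq_zero (hm : m ≤ mΩ) {U : Ω → ℝ} {Y : Ω → ℂ}
    (hUi : Integrable U μ) (hU : μ[U|m] =ᵐ[μ] 0) (hY : StronglyMeasurable[m] Y) {K : ℝ}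
    (hYK : ∀ ω, ‖Y ω‖ ≤ K) : ∫ ω, Y ω * (U ω : ℂ) ∂μ = 0 := by
  have hi : Integrable (fun ω => Y ω * (U ω : ℂ)) μ :=
    hUi.ofReal.bdd_mul (hY.mono hm).aestronglyMeasurable (Eventually.of_forall hYK)
  have hre : StronglyMeasurable[m] fun ω => (Y ω).re :=
    Complex.continuous_re.comp_stronglyMeasurable hY
  have him : StronglyMeasurable[m] fun ω => (Y ω).im :=
    Complex.continuous_im.comp_stronglyMeasurable hY
  apply Complex.ext
  · have := Complex.reCLM.integral_comp_comm hi
    simp only [Complex.reCLM_apply, Complex.mul_re, Complex.ofReal_re, Complex.ofReal_im, mul_zero,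
      sub_zero] at this
    rw [← this, Complex.zero_re]
    exact integral_mul_eq_zero_of_condExp_eq_zero hm hUi hU hre
      (hUi.bdd_mul (hre.mono hm).aestronglyMeasurable
        (Eventually.of_forall fun ω => (Complex.abs_re_le_norm _).trans (hYK ω)))
  · have := Complex.imCLM.integral_comp_comm hi
    simp only [Complex.imCLM_apply, Complex.mul_im, Complex.ofReal_re, Complex.ofReal_im, mul_zero,
      zero_add] at this
    rw [← this, Complex.zero_im]
    exact integral_mul_eq_zero_of_condExp_eq_zero hm hUi hU him
      (hUi.bdd_mul (him.mono hm).aestronglyMeasurable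
        (Eventually.of_forall fun ω => (Complex.abs_im_le_norm _).trans (hYK ω)))

/-- The term x²/2 cancels the quadratic term (ix)²/2 of the exponential, leaving a cubic error. -/
lemma norm_exp_I_mul_add_sq_sub_le {x : ℝ} (hx : |x| ≤ 1 / 2) :
    ‖Complex.exp (Complex.I * x + (x : ℂ) ^ 2 / 2) - 1 - Complex.I * x‖ ≤ 5 * |x| ^ 3 := by
  set z : ℂ := Complex.I * x + (x : ℂ) ^ 2 / 2 with hz
  have hx0 := abs_nonneg x
  have hzn : ‖z‖ ≤ |x| + |x| ^ 2 / 2 := by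
    refine (norm_add_le _ _).trans (le_of_eq ?_)
    simp
  have hz2 : ‖z‖ ≤ 5 / 4 * |x| := by nlinarith
  have hz1 : ‖z‖ ≤ 1 := by linarith
  have h1 : ‖Complex.exp z - 1 - z - z ^ 2 / 2‖ ≤ ‖z‖ ^ 3 := by
    have := Complex.exp_bound hz1 (n := 3) (by norm_num)
    simp only [Finset.sum_range_succ, Finset.sum_range_zero] at this
    norm_num at this
    refine le_trans (le_of_eq ?_) (this.trans ?_)
    · congr 1; ring
    · nlinarith [pow_nonneg (norm_nonneg z) 3]
  have e : Complex.exp z - 1 - Complex.I * x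
      = (Complex.exp z - 1 - z - z ^ 2 / 2) + (Complex.I * (x : ℂ) ^ 3 / 2 + (x : ℂ) ^ 4 / 8) := by
    rw [hz]
    linear_combination ((x : ℂ) ^ 2 / 2) * Complex.I_sq
  rw [e]
  have h2 : ‖Complex.I * (x : ℂ) ^ 3 / 2 + (x : ℂ) ^ 4 / 8‖ ≤ |x| ^ 3 / 2 + |x| ^ 4 / 8 := by
    refine (norm_add_le _ _).trans (le_of_eq ?_)
    simp
  have h3 : ‖z‖ ^ 3 ≤ (5 / 4 * |x|) ^ 3 := pow_le_pow_left₀ (norm_nonneg _) hz2 3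
  have h4 : |x| ^ 4 ≤ |x| ^ 3 * (1 / 2) := by
    rw [pow_succ]; exact mul_le_mul_of_nonneg_left hx (by positivity)
  have h5 : (0 : ℝ) ≤ |x| ^ 3 := by positivity
  refine (norm_add_le _ _).trans ?_
  nlinarith

variable {𝓕 : ℕ → MeasurableSpace Ω} {D : ℕ → Ω → ℝ} {K : ℝ}

/-- With X_j = a D_j, the products M_k = exp ∑ (i X_j + X_j²/2) are almost a martingale: in
E(M_{k+1} - M_k) the term linear in X_k vanishes by conditional centring, the quadratic one cancels,
and only a cubic error times a bound for |M_k| is left. The compensator uses the squares themselves,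
not conditional variances. -/
lemma norm_integral_exp_telescope_le (h𝓕 : ∀ j, 𝓕 j ≤ mΩ)
    (hDm : ∀ i j, i < j → StronglyMeasurable[𝓕 j] (D i))
    (hD0 : ∀ j, μ[D j|𝓕 j] =ᵐ[μ] 0) (hK : ∀ j ω, |D j ω| ≤ K) {a : ℝ} (ha : |a| * K ≤ 1 / 2)
    (N : ℕ) :
    ‖∫ ω, Complex.exp (∑ j ∈ Finset.range N,
        (Complex.I * (a * D j ω : ℝ) + ((a * D j ω : ℝ) : ℂ) ^ 2 / 2)) ∂μ - 1‖
      ≤ N * (Real.exp (N * (|a| * K) ^ 2 / 2) * (5 * (|a| * K) ^ 3)) := by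
  obtain ⟨ω₀⟩ : Nonempty Ω := μ.nonempty_of_neZero
  have hK0 : 0 ≤ K := (abs_nonneg _).trans (hK 0 ω₀)
  set z : ℕ → Ω → ℂ := fun j ω => Complex.I * (a * D j ω : ℝ) + ((a * D j ω : ℝ) : ℂ) ^ 2 / 2
    with hz
  set M : ℕ → Ω → ℂ := fun k ω => Complex.exp (∑ j ∈ Finset.range k, z j ω) with hM
  have hX : ∀ j ω, |a * D j ω| ≤ |a| * K := fun j ω => by
    rw [abs_mul]; exact mul_le_mul_of_nonneg_left (hK j ω) (abs_nonneg a)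
  have hzm : ∀ i j, i < j → StronglyMeasurable[𝓕 j] (z i) := fun i j hij => by
    have hc : Continuous fun x : ℝ => Complex.I * (a * x : ℝ) + ((a * x : ℝ) : ℂ) ^ 2 / 2 := by
      fun_prop
    exact hc.comp_stronglyMeasurable (hDm i j hij)
  have hMm : ∀ k, StronglyMeasurable[𝓕 k] (M k) := fun k =>
    Complex.continuous_exp.comp_stronglyMeasurable
      (Finset.stronglyMeasurable_fun_sum _ fun j hj => hzm j k (Finset.mem_range.mp hj))
  have hMb : ∀ k, k ≤ N → ∀ ω, ‖M k ω‖ ≤ Real.exp (N * (|a| * K) ^ 2 / 2) := by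
    intro k hk ω
    rw [hM, Complex.norm_exp, Real.exp_le_exp, Complex.re_sum]
    have : ∀ j ∈ Finset.range k, (z j ω).re ≤ (|a| * K) ^ 2 / 2 := by
      intro j _
      have e : (z j ω).re = (a * D j ω) ^ 2 / 2 := by
        have : z j ω = ((((a * D j ω) ^ 2 / 2 : ℝ)) : ℂ) + ((a * D j ω : ℝ)) * Complex.I := by
          simp only [hz]; push_cast; ring
        rw [this, Complex.add_re, Complex.ofReal_re, Complex.re_ofReal_mul, Complex.I_re, mul_zero,
          add_zero]
      rw [e, ← sq_abs]
      have := pow_le_pow_left₀ (abs_nonneg _) (hX j ω) 2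
      linarith
    refine (Finset.sum_le_sum this).trans ?_
    rw [Finset.sum_const, Finset.card_range, nsmul_eq_mul]
    have : (k : ℝ) ≤ N := by exact_mod_cast hk
    nlinarith [sq_nonneg (|a| * K)]
  have hMi : ∀ k, k ≤ N → Integrable (M k) μ := fun k hk =>
    Integrable.of_bound ((hMm k).mono (h𝓕 k)).aestronglyMeasurable _
      (Eventually.of_forall (hMb k hk))
  have step : ∀ k, k < N → ‖∫ ω, M (k + 1) ω ∂μ - ∫ ω, M k ω ∂μ‖
      ≤ Real.exp (N * (|a| * K) ^ 2 / 2) * (5 * (|a| * K) ^ 3) := by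
    intro k hk
    have hDi : Integrable (D k) μ := Integrable.of_bound
      ((hDm k (k + 1) (Nat.lt_succ_self k)).mono (h𝓕 _)).aestronglyMeasurable K
      (Eventually.of_forall (hK k))
    have h0 := integral_complex_mul_eq_zero_of_condExp_eq_zero (h𝓕 k) hDi (hD0 k) (hMm k)
      (hMb k hk.le)
    have hI : Integrable (fun ω => Complex.I * a * (M k ω * (D k ω : ℂ))) μ :=
      (hDi.ofReal.bdd_mul ((hMm k).mono (h𝓕 k)).aestronglyMeasurable
        (Eventually.of_forall (hMb k hk.le))).const_mul _
    have e : ∫ ω, M (k + 1) ω ∂μ - ∫ ω, M k ω ∂μ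
        = ∫ ω, M k ω * (Complex.exp (z k ω) - 1 - Complex.I * (a * D k ω : ℝ)) ∂μ := by
      have : ∫ ω, Complex.I * a * (M k ω * (D k ω : ℂ)) ∂μ = 0 := by
        rw [integral_const_mul, h0, mul_zero]
      rw [← sub_zero (∫ ω, M (k + 1) ω ∂μ - ∫ ω, M k ω ∂μ), ← this,
        ← integral_sub (hMi _ hk) (hMi _ hk.le), ← integral_sub (f := fun ω => M (k + 1) ω - M k ω) ((hMi _ hk).sub (hMi _ hk.le)) hI]
      refine integral_congr_ae (Eventually.of_forall fun ω => ?_)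
      simp only [hM, Finset.sum_range_succ, Complex.exp_add]
      push_cast; ring
    rw [e]
    refine (norm_integral_le_of_norm_le_const (Eventually.of_forall fun ω => ?_)).trans
      (le_of_eq (by rw [probReal_univ, mul_one]))
    rw [norm_mul]
    refine mul_le_mul (hMb k hk.le ω) ?_ (norm_nonneg _) (Real.exp_nonneg _)
    refine (norm_exp_I_mul_add_sq_sub_le ((hX k ω).trans ha)).trans ?_
    have := pow_le_pow_left₀ (abs_nonneg _) (hX k ω) 3
    linarith
  have key : ∀ k, k ≤ N → ‖∫ ω, M k ω ∂μ - 1‖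
      ≤ k * (Real.exp (N * (|a| * K) ^ 2 / 2) * (5 * (|a| * K) ^ 3)) := by
    intro k
    induction k with
    | zero => intro _; simp [hM]
    | succ k ih =>
      intro hk
      have h1 := ih (Nat.le_of_succ_le hk)
      have h2 := step k hk
      have h3 := norm_add_le (∫ ω, M (k + 1) ω ∂μ - ∫ ω, M k ω ∂μ) (∫ ω, M k ω ∂μ - 1)
      rw [sub_add_sub_cancel] at h3
      push_cast
      linarith
  exact key N le_rfl

lemma abs_one_sub_exp_le (u : ℝ) : |1 - Real.exp u| ≤ |u| * Real.exp |u| := by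
  rcases le_total 0 u with h | h
  · rw [abs_of_nonneg h, abs_of_nonpos (by linarith [Real.one_le_exp h])]
    have : Real.exp (-u) ≥ 1 - u := by linarith [Real.add_one_le_exp (-u)]
    have h2 : Real.exp u * Real.exp (-u) = 1 := by rw [← Real.exp_add]; simp
    nlinarith [Real.exp_pos u]
  · rw [abs_of_nonpos h, abs_of_nonneg (by linarith [Real.exp_le_one_iff.mpr h])]
    have h1 := Real.add_one_le_exp u
    have h2 : 1 ≤ Real.exp (-u) := Real.one_le_exp (by linarith)
    nlinarith

/-- A central limit theorem for bounded martingale differences, with the law of large numbers for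
the squares as a hypothesis. -/
lemma tendsto_integral_exp_of_bounded_martingale_differences (h𝓕 : ∀ j, 𝓕 j ≤ mΩ)
    (hDm : ∀ i j, i < j → StronglyMeasurable[𝓕 j] (D i))
    (hD0 : ∀ j, μ[D j|𝓕 j] =ᵐ[μ] 0) (hK : ∀ j ω, |D j ω| ≤ K) {v : ℝ}
    (hv : Tendsto (fun N : ℕ => ∫ ω, |(∑ j ∈ Finset.range N, D j ω ^ 2) / N - v| ∂μ) atTop (𝓝 0))
    (t : ℝ) :
    Tendsto (fun N : ℕ => ∫ ω, Complex.exp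
        ((t * ((∑ j ∈ Finset.range N, D j ω) / √N) : ℝ) * Complex.I) ∂μ) atTop
      (𝓝 (Complex.exp (-(t ^ 2 * v / 2 : ℝ)))) := by
  obtain ⟨ω₀⟩ : Nonempty Ω := μ.nonempty_of_neZero
  have hK0 : 0 ≤ K := (abs_nonneg _).trans (hK 0 ω₀)
  set B : ℝ := t ^ 2 / 2 * (K ^ 2 + |v|) with hB
  have hDM : ∀ j, Measurable (D j) := fun j =>
    ((hDm j (j + 1) (Nat.lt_succ_self j)).mono (h𝓕 _)).measurable
  have hDsq : ∀ j ω, D j ω ^ 2 ≤ K ^ 2 := fun j ω => by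
    rw [← sq_abs]; exact pow_le_pow_left₀ (abs_nonneg _) (hK j ω) 2
  set A : ℕ → Ω → ℝ := fun N ω => (∑ j ∈ Finset.range N, D j ω ^ 2) / N with hA
  have hAm : ∀ N, Measurable (A N) := fun N =>
    (Finset.measurable_fun_sum _ fun j _ => (hDM j).pow_const 2).div_const _
  have hA0 : ∀ N ω, 0 ≤ A N ω := fun N ω => by positivity
  have hA1 : ∀ N ω, A N ω ≤ K ^ 2 := fun N ω => by
    rcases Nat.eq_zero_or_pos N with rfl | hN
    · simp only [hA, Nat.cast_zero, div_zero]; positivity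
    rw [hA, div_le_iff₀ (by exact_mod_cast hN)]
    refine (Finset.sum_le_sum fun j _ => hDsq j ω).trans (le_of_eq ?_)
    rw [Finset.sum_const, Finset.card_range, nsmul_eq_mul, mul_comm]
  have hAi : ∀ N, Integrable (fun ω => |A N ω - v|) μ := fun N =>
    (Integrable.of_bound ((hAm N).sub_const v).aestronglyMeasurable (K ^ 2 + |v|)
      (Eventually.of_forall fun ω => (norm_sub_le _ _).trans (by
        rw [Real.norm_eq_abs, Real.norm_eq_abs, abs_of_nonneg (hA0 N ω)]
        linarith [hA1 N ω]))).abs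
  -- the bound on the distance to the limit
  set R : ℕ → ℝ := fun N => t ^ 2 / 2 * Real.exp B * ∫ ω, |A N ω - v| ∂μ
    + Real.exp (-(t ^ 2 * v / 2)) *
      (5 * Real.exp (t ^ 2 * K ^ 2 / 2) * (|t| * K) ^ 3 * (√N)⁻¹) with hR
  have hR0 : Tendsto R atTop (𝓝 0) := by
    have h2 : Tendsto (fun N : ℕ => (√(N : ℝ))⁻¹) atTop (𝓝 0) :=
      tendsto_inv_atTop_zero.comp (Real.tendsto_sqrt_atTop.comp tendsto_natCast_atTop_atTop)
    have := (hv.const_mul (t ^ 2 / 2 * Real.exp B)).add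
      ((h2.const_mul (5 * Real.exp (t ^ 2 * K ^ 2 / 2) * (|t| * K) ^ 3)).const_mul
        (Real.exp (-(t ^ 2 * v / 2))))
    simpa [hR] using this
  rw [tendsto_iff_norm_sub_tendsto_zero]
  refine squeeze_zero' (Eventually.of_forall fun _ => norm_nonneg _) ?_ hR0
  have hsm : ∀ᶠ N : ℕ in atTop, |t| * K * (√(N : ℝ))⁻¹ < 1 / 2 := by
    have h2 : Tendsto (fun N : ℕ => |t| * K * (√(N : ℝ))⁻¹) atTop (𝓝 (|t| * K * 0)) :=
      (tendsto_inv_atTop_zero.comp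
        (Real.tendsto_sqrt_atTop.comp tendsto_natCast_atTop_atTop)).const_mul _
    rw [mul_zero] at h2
    exact h2.eventually (gt_mem_nhds (by norm_num))
  filter_upwards [hsm, eventually_gt_atTop 0] with N hN hN0
  -- With a = t / √N the quantity N a² equals t², so the exponential bound is constant in N, while
  -- the N cubic errors total O(1 / √N).
  have hNr : (0 : ℝ) < N := by exact_mod_cast hN0
  have hsN : 0 < √(N : ℝ) := Real.sqrt_pos.mpr hNr
  have hsq : √(N : ℝ) ^ 2 = N := Real.sq_sqrt hNr.le
  set a : ℝ := t / √N with ha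
  have habs : |a| * K = |t| * K * (√(N : ℝ))⁻¹ := by
    rw [ha, abs_div, abs_of_pos hsN]; field_simp
  have htel := norm_integral_exp_telescope_le h𝓕 hDm hD0 hK (a := a) (by rw [habs]; exact hN.le) N
  set z : Ω → ℂ := fun ω => ∑ j ∈ Finset.range N,
        (Complex.I * (a * D j ω : ℝ) + ((a * D j ω : ℝ) : ℂ) ^ 2 / 2) with hz
  set x : Ω → ℝ := fun ω => t * ((∑ j ∈ Finset.range N, D j ω) / √N) with hx
  have hzx : ∀ ω, z ω = x ω * Complex.I + ((t ^ 2 / 2 * A N ω : ℝ) : ℂ) := by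
    intro ω
    have e1 : x ω = ∑ j ∈ Finset.range N, a * D j ω := by
      rw [← Finset.mul_sum, hx, ha]; ring
    have e2 : t ^ 2 / 2 * A N ω = ∑ j ∈ Finset.range N, (a * D j ω) ^ 2 / 2 := by
      simp only [hA, ha, mul_pow, div_pow, hsq, Finset.sum_div, Finset.mul_sum]
      exact Finset.sum_congr rfl fun j _ => by ring
    rw [e1, e2, hz]
    push_cast
    rw [Finset.sum_add_distrib, Finset.sum_mul]
    congr 1
    exact Finset.sum_congr rfl fun j _ => by ring
  have hxm : Measurable x :=
    ((Finset.measurable_fun_sum _ fun j _ => hDM j).div_const _).const_mul _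
  have hei : Integrable (fun ω => Complex.exp ((x ω : ℝ) * Complex.I)) μ :=
    Integrable.of_bound (by fun_prop) 1 (Eventually.of_forall fun ω => by
      rw [Complex.norm_exp_ofReal_mul_I])
  have hezi : Integrable (fun ω => Complex.exp (z ω)) μ := by
    refine Integrable.of_bound (C := Real.exp (t ^ 2 / 2 * K ^ 2)) ?_
      (Eventually.of_forall fun ω => ?_)
    · simp_rw [hzx]
      exact (Complex.measurable_exp.comp (((Complex.measurable_ofReal.comp hxm).mul_const _).add
        (Complex.measurable_ofReal.comp ((hAm N).const_mul _)))).aestronglyMeasurable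
    · rw [hzx, Complex.exp_add, norm_mul, Complex.norm_exp_ofReal_mul_I, one_mul,
        ← Complex.ofReal_exp, Complex.norm_real, Real.norm_of_nonneg (Real.exp_nonneg _),
        Real.exp_le_exp]
      exact mul_le_mul_of_nonneg_left (hA1 N ω) (by positivity)
  set c : ℝ := Real.exp (-(t ^ 2 * v / 2)) with hc
  have e3 : Complex.exp (-(t ^ 2 * v / 2 : ℝ)) = (c : ℂ) := by rw [hc, Complex.ofReal_exp]; simp
  rw [e3]
  -- Here exp z = exp(ix) exp(t² A_N / 2), with A_N the average of the squares. The first term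
  -- measures the distance from A_N to v and is small by the law of large numbers; the second is the
  -- telescoping error.
  have e4 : ∫ ω, Complex.exp ((x ω : ℝ) * Complex.I) ∂μ - c
      = ∫ ω, (Complex.exp ((x ω : ℝ) * Complex.I) - c * Complex.exp (z ω)) ∂μ
        + c * (∫ ω, Complex.exp (z ω) ∂μ - 1) := by
    rw [integral_sub hei (hezi.const_mul _), integral_const_mul]; ring
  rw [e4]
  refine (norm_add_le _ _).trans (add_le_add ?_ ?_)
  · rw [← integral_const_mul]
    refine (norm_integral_le_of_norm_le ((hAi N).const_mul _) (Eventually.of_forall fun ω => ?_))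
    set u : ℝ := t ^ 2 / 2 * (A N ω - v) with hu
    have e5 : Complex.exp ((x ω : ℝ) * Complex.I) - c * Complex.exp (z ω)
        = Complex.exp ((x ω : ℝ) * Complex.I) * ((1 - Real.exp u : ℝ) : ℂ) := by
      have : Real.exp u = c * Real.exp (t ^ 2 / 2 * A N ω) := by
        rw [hc, ← Real.exp_add]; congr 1; rw [hu]; ring
      rw [this, hzx, Complex.exp_add]
      push_cast; ring
    rw [e5, norm_mul, Complex.norm_exp_ofReal_mul_I, one_mul, Complex.norm_real, Real.norm_eq_abs]
    refine (abs_one_sub_exp_le u).trans ?_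
    have hu1 : |u| = t ^ 2 / 2 * |A N ω - v| := by
      rw [hu, abs_mul, abs_of_nonneg (by positivity)]
    have hu2 : |u| ≤ B := by
      rw [hu1, hB]
      refine mul_le_mul_of_nonneg_left ?_ (by positivity)
      refine (abs_sub _ _).trans ?_
      rw [abs_of_nonneg (hA0 N ω)]
      linarith [hA1 N ω]
    have := mul_le_mul_of_nonneg_left (Real.exp_le_exp.mpr hu2) (abs_nonneg u)
    rw [hu1] at this ⊢
    linarith
  · rw [norm_mul, Complex.norm_real, Real.norm_of_nonneg (Real.exp_nonneg _)]
    refine mul_le_mul_of_nonneg_left (htel.trans (le_of_eq ?_)) (Real.exp_nonneg _)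
    have h1 : (N : ℝ) * (|a| * K) ^ 2 / 2 = t ^ 2 * K ^ 2 / 2 := by
      rw [habs, mul_pow, mul_pow, inv_pow, hsq, sq_abs]; field_simp
    rw [h1, habs, mul_pow _ (√(N : ℝ))⁻¹]
    have h2 : (N : ℝ) * (√(N : ℝ))⁻¹ ^ 3 = (√(N : ℝ))⁻¹ := by
      nth_rw 1 [← hsq]; field_simp
    linear_combination (5 * Real.exp (t ^ 2 * K ^ 2 / 2) * (|t| * K) ^ 3) * h2

end MartingaleCLT

/-! ### Approximating events of a join by sliced events. -/

section Rectangles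

variable {Ω : Type*} {mΩ : MeasurableSpace Ω} {μ : Measure Ω} [IsProbabilityMeasure μ]

/-- Finite unions of rectangles `A ∩ B` with `A` in the first and `B` in the second σ-algebra,
sliced along a finite partition from the first one. -/
def IsSliced (m₁ m₂ : MeasurableSpace Ω) (E : Set Ω) : Prop :=
  ∃ (ι : Type) (_ : Fintype ι) (s : Ω → ι) (F : ι → Set Ω),
    (∀ i, MeasurableSet[m₁] (s ⁻¹' {i})) ∧ (∀ i, MeasurableSet[m₂] (F i)) ∧ E = {ω | ω ∈ F (s ω)}

/-- Slices are disjoint, so complements are taken slice by slice, and unions after refining to a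
common partition. -/
lemma isSetAlgebra_isSliced (m₁ m₂ : MeasurableSpace Ω) :
    IsSetAlgebra {E | IsSliced m₁ m₂ E} where
  empty_mem := ⟨Unit, inferInstance, fun _ => (), fun _ => ∅, fun i => by simp,
    fun _ => MeasurableSet.empty, by simp⟩
  compl_mem := by
    rintro _ ⟨ι, _, s, F, hs, hF, rfl⟩
    exact ⟨ι, inferInstance, s, fun i => (F i)ᶜ, hs, fun i => (hF i).compl, rfl⟩
  union_mem := by
    rintro _ _ ⟨ι, _, s, F, hs, hF, rfl⟩ ⟨ι', _, s', F', hs', hF', rfl⟩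
    refine ⟨ι × ι', inferInstance, fun ω => (s ω, s' ω), fun p => F p.1 ∪ F' p.2, fun p => ?_,
      fun p => (hF _).union (hF' _), rfl⟩
    have : (fun ω => (s ω, s' ω)) ⁻¹' {p} = s ⁻¹' {p.1} ∩ s' ⁻¹' {p.2} := by
      ext ω; simp [Prod.ext_iff]
    rw [this]
    exact (hs _).inter (hs' _)

lemma generateFrom_isSliced (m₁ m₂ : MeasurableSpace Ω) :
    m₁ ⊔ m₂ = MeasurableSpace.generateFrom {E | IsSliced m₁ m₂ E} := by
  classical
  apply le_antisymm
  · refine sup_le (fun A hA => ?_) (fun B hB => ?_)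
    · refine MeasurableSpace.measurableSet_generateFrom ⟨Bool, inferInstance,
        fun ω => decide (ω ∈ A), fun b => if b then Set.univ else ∅, fun b => ?_, fun b => ?_, ?_⟩
      · cases b
        · convert MeasurableSet.compl hA using 1; ext ω; simp
        · convert hA using 1; ext ω; simp
      · cases b <;> simp
      · ext ω; by_cases h : ω ∈ A <;> simp [h]
    · exact MeasurableSpace.measurableSet_generateFrom ⟨Unit, inferInstance, fun _ => (),
        fun _ => B, fun i => by simp, fun _ => hB, rfl⟩
  · refine MeasurableSpace.generateFrom_le ?_
    rintro _ ⟨ι, _, s, F, hs, hF, rfl⟩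
    have : {ω | ω ∈ F (s ω)} = ⋃ i, s ⁻¹' {i} ∩ F i := by
      ext ω; simp
    rw [this]
    exact MeasurableSet.iUnion fun i => MeasurableSet.inter
      ((le_sup_left : m₁ ≤ m₁ ⊔ m₂) _ (hs i)) ((le_sup_right : m₂ ≤ m₁ ⊔ m₂) _ (hF i))

/-- A generating algebra is dense in measure, and for bounded W a small symmetric difference changes
the integral little. -/
lemma abs_setIntegral_le_of_isSliced {m₁ m₂ : MeasurableSpace Ω} (h₁ : m₁ ≤ mΩ) (h₂ : m₂ ≤ mΩ)
    {W : Ω → ℝ} (hW : Integrable W μ) {K c : ℝ} (hK : ∀ ω, |W ω| ≤ K)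
    (h : ∀ E, IsSliced m₁ m₂ E → |∫ ω in E, W ω ∂μ| ≤ c) {E : Set Ω}
    (hE : MeasurableSet[m₁ ⊔ m₂] E) : |∫ ω in E, W ω ∂μ| ≤ c := by
  have hm : m₁ ⊔ m₂ ≤ mΩ := sup_le h₁ h₂
  obtain ⟨ω₀⟩ : Nonempty Ω := μ.nonempty_of_neZero
  have hK0 : 0 ≤ K := (abs_nonneg _).trans (hK ω₀)
  refine le_of_forall_pos_le_add fun ε hε => ?_
  have hd := @Measure.MeasureDense.of_generateFrom_isSetAlgebra_finite Ω (m₁ ⊔ m₂)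
    (μ.trim hm) _ (isFiniteMeasure_trim hm) (isSetAlgebra_isSliced m₁ m₂) (generateFrom_isSliced m₁ m₂)
  obtain ⟨T, hT, hTE⟩ := @Measure.MeasureDense.approx Ω (m₁ ⊔ m₂) _ _ hd E hE
    (@measure_ne_top _ (m₁ ⊔ m₂) (μ.trim hm) (isFiniteMeasure_trim hm) E) (ε / (K + 1)) (by positivity)
  have hTm : MeasurableSet[m₁ ⊔ m₂] T := @Measure.MeasureDense.measurable Ω (m₁ ⊔ m₂) _ _ hd T hT
  rw [trim_measurableSet_eq hm (MeasurableSet.symmDiff hE hTm)] at hTE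
  have hsd : μ.real (symmDiff E T) ≤ ε / (K + 1) :=
    ENNReal.toReal_le_of_le_ofReal (by positivity) hTE.le
  have hE' := hm _ hE
  have hT' := hm _ hTm
  have h1 : ∫ ω in E, W ω ∂μ - ∫ ω in T, W ω ∂μ
      = ∫ ω in symmDiff E T, (E.indicator W ω - T.indicator W ω) ∂μ := by
    rw [← integral_indicator hE', ← integral_indicator hT',
      ← integral_sub (hW.indicator hE') (hW.indicator hT')]
    symm
    refine setIntegral_eq_integral_of_forall_compl_eq_zero fun ω hω => ?_
    simp only [Set.mem_symmDiff, not_or, not_and, not_not] at hω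
    by_cases hωE : ω ∈ E
    · simp [hωE, hω.1 hωE]
    · have : ω ∉ T := fun h => hωE (hω.2 h)
      simp [hωE, this]
  have h2 : |∫ ω in E, W ω ∂μ - ∫ ω in T, W ω ∂μ| ≤ K * μ.real (symmDiff E T) := by
    rw [h1, ← Real.norm_eq_abs]
    refine norm_setIntegral_le_of_norm_le_const (measure_lt_top _ _) fun ω hω => ?_
    rw [Real.norm_eq_abs]
    rcases hω with ⟨a, b⟩ | ⟨a, b⟩
    · simpa [a, b] using hK ω
    · simpa [a, b] using hK ω
  have h3 : K * μ.real (symmDiff E T) ≤ ε := by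
    refine (mul_le_mul_of_nonneg_left hsd hK0).trans ?_
    rw [mul_div_assoc', div_le_iff₀ (by positivity)]
    nlinarith
  have h4 := h T hT
  have h5 := abs_add_le (∫ ω in E, W ω ∂μ - ∫ ω in T, W ω ∂μ) (∫ ω in T, W ω ∂μ)
  rw [sub_add_cancel] at h5
  linarith

end Rectangles

/-! ### One-sided and two-sided Markov properties. -/

section Markov

variable {Ω S : Type*} {m mΩ : MeasurableSpace Ω} [mS : MeasurableSpace S] {μ : Measure Ω}
  [IsProbabilityMeasure μ] {ξ : ℤ → Ω → S}

/-- The σ-algebra `σ(ξ k, a ≤ k ≤ b)`. -/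
@[reducible] def window (ξ : ℤ → Ω → S) (a b : ℤ) : MeasurableSpace Ω :=
  ⨆ k : {k : ℤ // a ≤ k ∧ k ≤ b}, MeasurableSpace.comap (ξ k.1) inferInstance

lemma window_le (h : ∀ k, Measurable (ξ k)) (a b : ℤ) : window ξ a b ≤ mΩ :=
  iSup_le fun k => (h k).comap_le

lemma past_le (h : ∀ k, Measurable (ξ k)) (n : ℤ) : past ξ n ≤ mΩ :=
  iSup_le fun k => (h k).comap_le

lemma future_le (h : ∀ k, Measurable (ξ k)) (n : ℤ) : future ξ n ≤ mΩ :=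
  iSup_le fun k => (h k).comap_le

lemma comap_le_window {a b k : ℤ} (h1 : a ≤ k) (h2 : k ≤ b) :
    MeasurableSpace.comap (ξ k) mS ≤ window ξ a b :=
  le_iSup (fun k : {k : ℤ // a ≤ k ∧ k ≤ b} => MeasurableSpace.comap (ξ k.1) mS) ⟨k, h1, h2⟩

lemma comap_le_past {n k : ℤ} (h : k ≤ n) : MeasurableSpace.comap (ξ k) mS ≤ past ξ n :=
  le_iSup (fun k : {k : ℤ // k ≤ n} => MeasurableSpace.comap (ξ k.1) mS) ⟨k, h⟩

lemma comap_le_future {n k : ℤ} (h : n ≤ k) : MeasurableSpace.comap (ξ k) mS ≤ future ξ n :=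
  le_iSup (fun k : {k : ℤ // n ≤ k} => MeasurableSpace.comap (ξ k.1) mS) ⟨k, h⟩

lemma window_le_past {a b n : ℤ} (h : b ≤ n) : window ξ a b ≤ past ξ n :=
  iSup_le fun k => comap_le_past (k.2.2.trans h)

lemma window_le_future {a b n : ℤ} (h : n ≤ a) : window ξ a b ≤ future ξ n :=
  iSup_le fun k => comap_le_future (h.trans k.2.1)

lemma past_mono {a b : ℤ} (h : a ≤ b) : past ξ a ≤ past ξ b :=
  iSup_le fun k => comap_le_past (k.2.trans h)

lemma window_mono {a b c d : ℤ} (h1 : c ≤ a) (h2 : b ≤ d) : window ξ a b ≤ window ξ c d :=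
  iSup_le fun k => comap_le_window (h1.trans k.2.1) (k.2.2.trans h2)

lemma window_succ_le (a b : ℤ) :
    window ξ a (b + 1) ≤ window ξ a b ⊔ MeasurableSpace.comap (ξ (b + 1)) mS := by
  refine iSup_le fun k => ?_
  rcases eq_or_lt_of_le k.2.2 with h | h
  · rw [h]; exact le_sup_right
  · exact (comap_le_window k.2.1 (Int.lt_add_one_iff.mp h)).trans le_sup_left

lemma future_le_iSup_window (n : ℤ) : future ξ n ≤ ⨆ r : ℕ, window ξ n (n + r) := by
  refine iSup_le fun k => ?_
  refine le_trans ?_ (le_iSup _ (k.1 - n).toNat)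
  refine comap_le_window k.2 ?_
  rw [Int.toNat_of_nonneg (sub_nonneg.mpr k.2)]; linarith

lemma integrable_indicator_one {A : Set Ω} (hA : MeasurableSet A) :
    Integrable (A.indicator (fun _ => (1 : ℝ))) μ :=
  (integrable_const (1 : ℝ)).indicator hA

omit [IsProbabilityMeasure μ] in
lemma condExp_indicator_abs_le (m : MeasurableSpace Ω) (A : Set Ω) :
    ∀ᵐ ω ∂μ, |(μ⟦A|m⟧) ω| ≤ 1 :=
  ae_bdd_abs_condExp_of_ae_bdd_abs (Eventually.of_forall fun ω => by
    by_cases h : ω ∈ A <;> simp [h])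

omit [IsProbabilityMeasure μ] in
lemma integral_mul_indicator (V : Ω → ℝ) {A : Set Ω} (hA : MeasurableSet A) :
    ∫ ω, A.indicator (fun _ => (1 : ℝ)) ω * V ω ∂μ = ∫ ω in A, V ω ∂μ := by
  rw [← integral_indicator hA]
  congr 1; ext ω
  by_cases h : ω ∈ A <;> simp [h]

/-- Pulling out with an indicator: `∫_A V = ∫ P(A | m) V` for `m`-measurable `V`. -/
lemma setIntegral_eq_integral_condExp_mul (hm : m ≤ mΩ) {V : Ω → ℝ}
    (hV : StronglyMeasurable[m] V) (hVi : Integrable V μ) {A : Set Ω} (hA : MeasurableSet A) :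
    ∫ ω in A, V ω ∂μ = ∫ ω, V ω * (μ⟦A|m⟧) ω ∂μ := by
  rw [← integral_mul_indicator V hA]
  have hi : Integrable (V * A.indicator (fun _ => (1 : ℝ))) μ := by
    rw [mul_comm]
    exact hVi.bdd_mul (c := 1) (integrable_indicator_one hA).aestronglyMeasurable
      (Eventually.of_forall fun ω => by by_cases h : ω ∈ A <;> simp [h])
  have h := condExp_mul_of_stronglyMeasurable_left hV hi (integrable_indicator_one hA)
  refine Eq.trans ?_ (integral_congr_ae h)
  rw [integral_condExp hm]
  exact integral_congr_ae (Eventually.of_forall fun ω => mul_comm _ _)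

/-- The reversed form of the Markov property: given `ξ n`, the past does not depend on a window
of the future. -/
lemma condExp_sub_window_eq_zero (hξ : IsStationaryMarkovChain μ ξ) {n : ℤ} {A : Set Ω}
    (hA : MeasurableSet[past ξ n] A) (r : ℕ) :
    μ[A.indicator (fun _ => (1 : ℝ)) - μ⟦A|MeasurableSpace.comap (ξ n) mS⟧|window ξ n (n + r)]
      =ᵐ[μ] 0 := by
  have hA' : MeasurableSet A := past_le hξ.measurable n _ hA
  have hn : MeasurableSpace.comap (ξ n) mS ≤ mΩ := (hξ.measurable n).comap_le
  have hUi : Integrable (A.indicator (fun _ => (1 : ℝ)) - μ⟦A|MeasurableSpace.comap (ξ n) mS⟧) μ :=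
    (integrable_indicator_one hA').sub integrable_condExp
  set U := A.indicator (fun _ => (1 : ℝ)) - μ⟦A|MeasurableSpace.comap (ξ n) mS⟧ with hU
  have hUm : StronglyMeasurable[past ξ n] U :=
    (stronglyMeasurable_one.indicator hA).sub
      (stronglyMeasurable_condExp.mono (comap_le_past le_rfl))
  induction r with
  | zero =>
    have hw : window ξ n (n + (0 : ℕ)) ≤ MeasurableSpace.comap (ξ n) mS := by
      refine iSup_le fun k => ?_
      have h1 := k.2.1
      have h2 := k.2.2
      have : k.1 = n := by push_cast at h2; omega
      rw [this]
    refine condExp_eq_zero_mono hw hn hUi ?_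
    refine (condExp_sub (integrable_indicator_one hA') integrable_condExp _).trans ?_
    filter_upwards [condExp_condExp_of_le (f := A.indicator (fun _ => (1 : ℝ))) (μ := μ)
      (le_refl (MeasurableSpace.comap (ξ n) mS)) hn] with ω hω
    rw [Pi.sub_apply, hω, sub_self, Pi.zero_apply]
  | succ r ih =>
    have hwr := window_le hξ.measurable n (n + r)
    have e : n + ((r + 1 : ℕ) : ℤ) = n + r + 1 := by push_cast; ring
    rw [e]
    refine condExp_eq_zero_mono (window_succ_le n (n + r))
      (sup_le hwr (hξ.measurable _).comap_le) hUi ?_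
    refine condExp_sup_eq_zero hwr (hξ.measurable _).comap_le hUi fun B C hB hC => ?_
    obtain ⟨C', hC', rfl⟩ := hC
    have hB' := hwr _ hB
    have hC'' : MeasurableSet (ξ (n + r + 1) ⁻¹' C') := hξ.measurable _ hC'
    have hp : past ξ (n + r) ≤ mΩ := past_le hξ.measurable _
    have hBU : StronglyMeasurable[past ξ (n + r)] (B.indicator U) :=
      (hUm.mono (past_mono (by omega))).indicator (window_le_past le_rfl _ hB)
    -- The function `B.indicator U` belongs to the past of n + r, so the event at time n + r + 1 may
    -- be replaced by its conditional probability. By the Markov property that is a function of ξ (n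
    -- + r), hence lies in the shorter window, where the induction hypothesis applies.
    rw [Set.inter_comm, ← setIntegral_indicator hB',
      setIntegral_eq_integral_condExp_mul hp hBU (hUi.indicator hB') hC'',
      integral_congr_ae (g := fun ω => B.indicator
        (μ⟦ξ (n + r + 1) ⁻¹' C'|MeasurableSpace.comap (ξ (n + r)) mS⟧) ω * U ω)]
    · have hc : StronglyMeasurable[window ξ n (n + r)] (B.indicator
          (μ⟦ξ (n + r + 1) ⁻¹' C'|MeasurableSpace.comap (ξ (n + r)) mS⟧)) :=
        (stronglyMeasurable_condExp.mono (comap_le_window (by omega) le_rfl)).indicator hB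
      refine integral_mul_eq_zero_of_condExp_eq_zero hwr hUi ih hc ?_
      refine hUi.bdd_mul (c := 1) (hc.mono hwr).aestronglyMeasurable ?_
      filter_upwards [condExp_indicator_abs_le (μ := μ) (MeasurableSpace.comap (ξ (n + r)) mS)
        (ξ (n + r + 1) ⁻¹' C')] with ω hω
      by_cases h : ω ∈ B
      · simpa [h] using hω
      · simp [h]
    · filter_upwards [hξ.markov (n + r) C' hC'] with ω hω
      rw [hω]
      by_cases h : ω ∈ B
      · simp [h, mul_comm]
      · simp [h]

lemma condExp_sub_future_eq_zero (hξ : IsStationaryMarkovChain μ ξ) {n : ℤ} {A : Set Ω}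
    (hA : MeasurableSet[past ξ n] A) :
    μ[A.indicator (fun _ => (1 : ℝ)) - μ⟦A|MeasurableSpace.comap (ξ n) mS⟧|future ξ n]
      =ᵐ[μ] 0 := by
  have hUi : Integrable (A.indicator (fun _ => (1 : ℝ)) - μ⟦A|MeasurableSpace.comap (ξ n) mS⟧) μ :=
    (integrable_indicator_one (past_le hξ.measurable n _ hA)).sub integrable_condExp
  have hw : ∀ r : ℕ, window ξ n (n + r) ≤ mΩ := fun r => window_le hξ.measurable _ _
  refine condExp_eq_zero_mono (future_le_iSup_window n) (iSup_le hw) hUi ?_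
  exact condExp_iSup_eq_zero hw (fun r s h => window_mono le_rfl (by gcongr)) hUi
    (condExp_sub_window_eq_zero hξ hA)

/-- The Markov property for functionals of the future: integrating over an event of the past. -/
lemma setIntegral_past_eq (hξ : IsStationaryMarkovChain μ ξ) {n : ℤ} {A : Set Ω}
    (hA : MeasurableSet[past ξ n] A) {V : Ω → ℝ} (hV : StronglyMeasurable[future ξ n] V)
    (hVi : Integrable V μ) :
    ∫ ω in A, V ω ∂μ = ∫ ω, (μ⟦A|MeasurableSpace.comap (ξ n) mS⟧) ω * V ω ∂μ := by
  have hA' : MeasurableSet A := past_le hξ.measurable n _ hA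
  have hi1 : Integrable (A.indicator (fun _ => (1 : ℝ)) * V) μ :=
    hVi.bdd_mul (c := 1) (integrable_indicator_one hA').aestronglyMeasurable
      (Eventually.of_forall fun ω => by by_cases h : ω ∈ A <;> simp [h])
  have hi2 : Integrable (μ⟦A|MeasurableSpace.comap (ξ n) mS⟧ * V) μ :=
    hVi.bdd_mul (c := 1) integrable_condExp.aestronglyMeasurable (condExp_indicator_abs_le _ _)
  have e : V * (A.indicator (fun _ => (1 : ℝ)) - μ⟦A|MeasurableSpace.comap (ξ n) mS⟧)
      = A.indicator (fun _ => (1 : ℝ)) * V - μ⟦A|MeasurableSpace.comap (ξ n) mS⟧ * V := by ring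
  have h := integral_mul_eq_zero_of_condExp_eq_zero (future_le hξ.measurable n)
    ((integrable_indicator_one hA').sub integrable_condExp) (condExp_sub_future_eq_zero hξ hA) hV
    (by rw [e]; exact hi1.sub hi2)
  rw [← integral_mul_indicator V hA']
  have h' : ∫ ω, (A.indicator (fun _ => (1 : ℝ)) * V) ω
      - (μ⟦A|MeasurableSpace.comap (ξ n) mS⟧ * V) ω ∂μ = 0 := by
    rw [← h]; congr 1; ext ω; exact (congrFun e ω).symm
  rw [integral_sub hi1 hi2] at h'
  exact sub_eq_zero.mp h'

/-- The two-sided Markov property: a functional of `ξ a, …, ξ b` that is centred given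
`(ξ a, ξ b)` is centred given the past of `a` and the future of `b`. -/
lemma condExp_past_sup_future_eq_zero (hξ : IsStationaryMarkovChain μ ξ) {a b : ℤ} (hab : a ≤ b)
    {V : Ω → ℝ} (hV : StronglyMeasurable[window ξ a b] V) (hVi : Integrable V μ)
    (h0 : μ[V|MeasurableSpace.comap (ξ a) mS ⊔ MeasurableSpace.comap (ξ b) mS] =ᵐ[μ] 0) :
    μ[V|past ξ a ⊔ future ξ b] =ᵐ[μ] 0 := by
  have hpa := past_le hξ.measurable a
  have hpb := past_le hξ.measurable b
  have hfa := future_le hξ.measurable a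
  have hfb := future_le hξ.measurable b
  have hca : MeasurableSpace.comap (ξ a) mS ≤ mΩ := (hξ.measurable a).comap_le
  have hcb : MeasurableSpace.comap (ξ b) mS ≤ mΩ := (hξ.measurable b).comap_le
  refine condExp_sup_eq_zero hpa hfb hVi fun A C hA hC => ?_
  have hA' := hpa _ hA
  have hC' := hfb _ hC
  set α := μ⟦A|MeasurableSpace.comap (ξ a) mS⟧ with hα
  -- the conditional probability of `C` given the past of `b` is a function of `ξ b`
  obtain ⟨γ, hγm, hγ1, hγ⟩ : ∃ γ : Ω → ℝ, StronglyMeasurable[MeasurableSpace.comap (ξ b) mS] γ ∧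
      (∀ᵐ ω ∂μ, |γ ω| ≤ 1) ∧ ∀ W : Ω → ℝ, StronglyMeasurable[past ξ b] W → Integrable W μ →
        ∫ ω in C, W ω ∂μ = ∫ ω, γ ω * W ω ∂μ := by
    refine ⟨μ⟦C|MeasurableSpace.comap (ξ b) mS⟧, stronglyMeasurable_condExp,
      condExp_indicator_abs_le _ _, fun W hW hWi => ?_⟩
    set γ := μ⟦C|MeasurableSpace.comap (ξ b) mS⟧ with hγ
    have hU : μ[C.indicator (fun _ => (1 : ℝ)) - γ|past ξ b] =ᵐ[μ] 0 := by
      refine condExp_eq_zero_of_setIntegral hpb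
        ((integrable_indicator_one hC').sub integrable_condExp) fun E hE => ?_
      have hE' := hpb _ hE
      have h1 := setIntegral_past_eq hξ hE (V := C.indicator (fun _ => (1 : ℝ)))
        (stronglyMeasurable_one.indicator hC) (integrable_indicator_one hC')
      have h2 := setIntegral_past_eq hξ hE (V := γ)
        (stronglyMeasurable_condExp.mono (comap_le_future le_rfl)) integrable_condExp
      have h3 : ∫ ω, (μ⟦E|MeasurableSpace.comap (ξ b) mS⟧) ω * C.indicator (fun _ => (1 : ℝ)) ω ∂μ
          = ∫ ω, (μ⟦E|MeasurableSpace.comap (ξ b) mS⟧) ω * γ ω ∂μ := by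
        rw [← setIntegral_eq_integral_condExp_mul hcb stronglyMeasurable_condExp integrable_condExp
          hC', ← integral_mul_indicator _ hC']
        simp_rw [mul_comm]
      have := integral_sub (μ := μ.restrict E) (integrable_indicator_one hC').integrableOn
        (integrable_condExp (m := MeasurableSpace.comap (ξ b) mS) (μ := μ)
          (f := C.indicator (fun _ => (1 : ℝ)))).integrableOn
      simp only [Pi.sub_apply]
      rw [this, h1, h3, ← h2, hγ, sub_self]
    have hi1 : Integrable (C.indicator (fun _ => (1 : ℝ)) * W) μ :=
      hWi.bdd_mul (c := 1) (integrable_indicator_one hC').aestronglyMeasurable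
        (Eventually.of_forall fun ω => by by_cases h : ω ∈ C <;> simp [h])
    have hi2 : Integrable (γ * W) μ :=
      hWi.bdd_mul (c := 1) integrable_condExp.aestronglyMeasurable (condExp_indicator_abs_le _ _)
    have e : W * (C.indicator (fun _ => (1 : ℝ)) - γ)
        = C.indicator (fun _ => (1 : ℝ)) * W - γ * W := by ring
    have h := integral_mul_eq_zero_of_condExp_eq_zero hpb
      ((integrable_indicator_one hC').sub integrable_condExp) hU hW
      (by rw [e]; exact hi1.sub hi2)
    rw [← integral_mul_indicator W hC']
    have h' : ∫ ω, (C.indicator (fun _ => (1 : ℝ)) * W) ω - (γ * W) ω ∂μ = 0 := by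
      rw [← h]; congr 1; ext ω; exact (congrFun e ω).symm
    rw [integral_sub hi1 hi2] at h'
    exact sub_eq_zero.mp h'
  have hVf : StronglyMeasurable[future ξ a] V := hV.mono (window_le_future le_rfl)
  have hγV : Integrable (γ * V) μ :=
    hVi.bdd_mul (c := 1) (hγm.mono hcb).aestronglyMeasurable hγ1
  -- The indicator of C is replaced by γ, then that of A by α. What remains is the integral of V
  -- against αγ, a function of (ξ a, ξ b), which vanishes by `h0`.
  rw [Set.inter_comm, ← setIntegral_indicator hA',
    hγ _ ((hV.mono (window_le_past le_rfl)).indicator (past_mono hab _ hA)) (hVi.indicator hA')]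
  have e1 : ∫ ω, γ ω * A.indicator V ω ∂μ = ∫ ω in A, (γ * V) ω ∂μ := by
    rw [← integral_indicator hA']
    congr 1; ext ω
    by_cases h : ω ∈ A <;> simp [h]
  rw [e1, setIntegral_past_eq hξ hA ((hγm.mono (comap_le_future hab)).mul hVf) hγV]
  have hαm : StronglyMeasurable[MeasurableSpace.comap (ξ a) mS] α := stronglyMeasurable_condExp
  have hαγ : StronglyMeasurable[MeasurableSpace.comap (ξ a) mS ⊔ MeasurableSpace.comap (ξ b) mS]
      (α * γ) := (hαm.mono le_sup_left).mul (hγm.mono le_sup_right)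
  have e2 : α * (γ * V) = (α * γ) * V := by ring
  have := integral_mul_eq_zero_of_condExp_eq_zero (sup_le hca hcb) hVi h0 hαγ (by
    rw [← e2]
    exact hγV.bdd_mul (c := 1) integrable_condExp.aestronglyMeasurable
      (condExp_indicator_abs_le _ _))
  rw [← this]
  exact integral_congr_ae (Eventually.of_forall fun ω => congrFun e2 ω)

end Markov

/-! ### Shift invariance of path functionals. -/

section Stationarity

variable {Ω S : Type*} {mΩ : MeasurableSpace Ω} [mS : MeasurableSpace S] {μ : Measure Ω}
  [IsProbabilityMeasure μ] {ξ : ℤ → Ω → S}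

/-- The path of the process seen from time `a`. -/
def path (ξ : ℤ → Ω → S) (a : ℤ) (ω : Ω) : ℤ → S := fun k => ξ (k + a) ω

lemma measurable_path (h : ∀ k, Measurable (ξ k)) (a : ℤ) : Measurable (path ξ a) :=
  measurable_pi_lambda _ fun k => h (k + a)

omit [IsProbabilityMeasure μ] in
lemma map_path (hξ : IsStationaryMarkovChain μ ξ) (a : ℤ) :
    μ.map (path ξ a) = μ.map (path ξ 0) := by
  have hstep : ∀ a, μ.map (path ξ (a + 1)) = μ.map (path ξ a) := by
    intro a
    have hs : Measurable fun (x : ℤ → S) (k : ℤ) => x (k + a) :=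
      measurable_pi_lambda _ fun k => measurable_pi_apply _
    have h := congrArg (Measure.map fun (x : ℤ → S) (k : ℤ) => x (k + a)) hξ.stationary
    rw [Measure.map_map hs (measurable_pi_lambda _ fun k => hξ.measurable _),
      Measure.map_map hs (measurable_pi_lambda _ fun k => hξ.measurable _)] at h
    have e : path ξ (a + 1) = (fun (x : ℤ → S) (k : ℤ) => x (k + a)) ∘ fun ω k => ξ (k + 1) ω := by
      funext ω k
      simp only [path, Function.comp]
      congr 1; ring
    rw [e, h]
    rfl
  induction a using Int.induction_on with
  | zero => rfl
  | succ i ih => rw [hstep, ih]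
  | pred i ih => rw [← hstep, sub_add_cancel, ih]

omit [IsProbabilityMeasure μ] in
lemma identDistrib_path (hξ : IsStationaryMarkovChain μ ξ) {E : Type*} [MeasurableSpace E]
    {F : (ℤ → S) → E} (hF : Measurable F) (a b : ℤ) :
    IdentDistrib (fun ω => F (path ξ a ω)) (fun ω => F (path ξ b ω)) μ μ where
  aemeasurable_fst := (hF.comp (measurable_path hξ.measurable a)).aemeasurable
  aemeasurable_snd := (hF.comp (measurable_path hξ.measurable b)).aemeasurable
  map_eq := by
    change μ.map (F ∘ path ξ a) = μ.map (F ∘ path ξ b)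
    rw [← Measure.map_map hF (measurable_path hξ.measurable a),
      ← Measure.map_map hF (measurable_path hξ.measurable b), map_path hξ a, map_path hξ b]

end Stationarity

/-! ### Absolute regularity as domination by a finite measure. -/

section Mixing

variable {Ω S : Type*} {mΩ : MeasurableSpace Ω} [mS : MeasurableSpace S] {μ : Measure Ω}
  [IsProbabilityMeasure μ] {ξ : ℤ → Ω → S} {ν : Measure Ω} [IsFiniteMeasure ν] {n : ℕ}

/-- The dependence between the past of `0` and the future of `n` is controlled by the finite
measure `ν`. -/
def MixesWith (μ : Measure Ω) (ξ : ℤ → Ω → S) (n : ℕ) (ν : Measure Ω) : Prop :=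
  ∀ A B, MeasurableSet[past ξ 0] A → MeasurableSet[future ξ n] B →
    |μ.real (A ∩ B) - μ.real A * μ.real B| ≤ ν.real A

/-- Take ν with density g, where g dominates all |P(B | past) - P(B)| and has integral below ε. One
g serves every B, so ν is additive in the past event; this additivity is what strong mixing would
not supply. -/
lemma exists_mixesWith (hξ : ∀ k, Measurable (ξ k)) (hβ : IsAbsolutelyRegular μ ξ) {ε : ℝ}
    (hε : 0 < ε) : ∃ (n : ℕ) (ν : Measure Ω), IsFiniteMeasure ν ∧ ν.real Set.univ ≤ ε ∧
      MixesWith μ ξ n ν := by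
  obtain ⟨n, hn⟩ := (hβ.eventually (gt_mem_nhds (ENNReal.ofReal_pos.mpr hε))).exists
  simp only [betaCoeff, iInf_lt_iff] at hn
  obtain ⟨g, hg, hdom, hlt⟩ := hn
  have hfin : IsFiniteMeasure (μ.withDensity g) := isFiniteMeasure_withDensity hlt.ne_top
  refine ⟨n, μ.withDensity g, hfin, ?_, fun A B hA hB => ?_⟩
  · rw [Measure.real, withDensity_apply _ MeasurableSet.univ, Measure.restrict_univ]
    exact ENNReal.toReal_le_of_le_ofReal hε.le hlt.le
  · have hp := past_le hξ 0
    have hA' := hp _ hA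
    have hB' := future_le hξ n _ hB
    have h1 : μ.real (A ∩ B) - μ.real A * μ.real B
        = ∫ ω in A, ((μ⟦B|past ξ 0⟧) ω - μ.real B) ∂μ := by
      rw [integral_sub integrable_condExp.integrableOn (integrable_const _),
        setIntegral_condExp hp (integrable_indicator_one hB') hA, setIntegral_indicator hB']
      simp [smul_eq_mul]
    have hi : Integrable (fun ω => |(μ⟦B|past ξ 0⟧) ω - μ.real B|) μ :=
      (integrable_condExp.sub (integrable_const _)).abs
    rw [h1]
    refine abs_integral_le_integral_abs.trans ?_
    rw [integral_eq_lintegral_of_nonneg_ae (Eventually.of_forall fun _ => abs_nonneg _)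
      hi.aestronglyMeasurable.restrict,
      measureReal_def (μ.withDensity g), withDensity_apply _ hA']
    refine ENNReal.toReal_mono ?_ (lintegral_mono_ae (ae_restrict_of_ae (hdom B hB)))
    exact ((setLIntegral_le_lintegral A g).trans_lt hlt).ne_top

lemma setIntegral_indicator_sub_measureReal {A B : Set Ω} (hA : MeasurableSet A) :
    ∫ ω in B, (A.indicator (fun _ => (1 : ℝ)) ω - μ.real A) ∂μ
      = μ.real (A ∩ B) - μ.real A * μ.real B := by
  rw [integral_sub (integrable_indicator_one hA).integrableOn (integrable_const _),
    setIntegral_indicator hA]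
  simp [smul_eq_mul, Set.inter_comm, mul_comm]

omit [IsProbabilityMeasure μ] in
lemma integral_mul_indicator_sub {ψ : Ω → ℝ} (hψ : Integrable ψ μ) {A : Set Ω}
    (hA : MeasurableSet A) : ∫ ω, ψ ω * (A.indicator (fun _ => (1 : ℝ)) ω - μ.real A) ∂μ
      = ∫ ω in A, ψ ω ∂μ - μ.real A * ∫ ω, ψ ω ∂μ := by
  have h1 : ∀ ω, ψ ω * (A.indicator (fun _ => (1 : ℝ)) ω - μ.real A)
      = A.indicator ψ ω - μ.real A * ψ ω := fun ω => by
    by_cases h : ω ∈ A <;> simp [h] <;> ring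
  simp_rw [h1]
  rw [integral_sub (hψ.indicator hA) (hψ.const_mul _), integral_indicator hA, integral_const_mul]

omit [IsFiniteMeasure ν] in
-- The bound keeps `ν.real A` instead of the total mass, so that it can be summed over disjoint past
-- events.
lemma MixesWith.abs_setIntegral_sub_le (hmix : MixesWith μ ξ n ν) (hξ : ∀ k, Measurable (ξ k))
    {A : Set Ω} (hA : MeasurableSet[past ξ 0] A) {ψ : Ω → ℝ} {K : ℝ} (hK : 0 ≤ K)
    (hψ : StronglyMeasurable[future ξ n] ψ) (hψK : ∀ ω, |ψ ω| ≤ K) :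
    |∫ ω in A, ψ ω ∂μ - μ.real A * ∫ ω, ψ ω ∂μ| ≤ 2 * K * ν.real A := by
  have hf := future_le hξ n
  have hA' := past_le hξ 0 _ hA
  have hψi : Integrable ψ μ := Integrable.of_bound (hψ.mono hf).aestronglyMeasurable K
    (Eventually.of_forall hψK)
  rw [← integral_mul_indicator_sub hψi hA']
  refine abs_integral_mul_le_of_setIntegral hf
    ((integrable_indicator_one hA').sub (integrable_const _)) hK (fun B hB => ?_) hψ hψK
  change |∫ ω in B, (A.indicator (fun _ => (1 : ℝ)) ω - μ.real A) ∂μ| ≤ _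
  rw [setIntegral_indicator_sub_measureReal hA']
  exact hmix A B hA hB

lemma MixesWith.abs_setIntegral_sub_le' (hmix : MixesWith μ ξ n ν) (hξ : ∀ k, Measurable (ξ k))
    {B : Set Ω} (hB : MeasurableSet[future ξ n] B) {φ : Ω → ℝ} {K : ℝ} (hK : 0 ≤ K)
    (hφ : StronglyMeasurable[past ξ 0] φ) (hφK : ∀ ω, |φ ω| ≤ K) :
    |∫ ω in B, φ ω ∂μ - μ.real B * ∫ ω, φ ω ∂μ| ≤ 2 * K * ν.real Set.univ := by
  have hp := past_le hξ 0
  have hB' := future_le hξ n _ hB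
  have hφi : Integrable φ μ := Integrable.of_bound (hφ.mono hp).aestronglyMeasurable K
    (Eventually.of_forall hφK)
  rw [← integral_mul_indicator_sub hφi hB']
  refine abs_integral_mul_le_of_setIntegral hp
    ((integrable_indicator_one hB').sub (integrable_const _)) hK (fun A hA => ?_) hφ hφK
  change |∫ ω in A, (B.indicator (fun _ => (1 : ℝ)) ω - μ.real B) ∂μ| ≤ _
  rw [setIntegral_indicator_sub_measureReal hB', Set.inter_comm, mul_comm]
  exact (hmix A B hA hB).trans (measureReal_mono (Set.subset_univ A))

lemma MixesWith.abs_integral_mul_sub_le (hmix : MixesWith μ ξ n ν) (hξ : ∀ k, Measurable (ξ k))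
    {φ ψ : Ω → ℝ} {K L : ℝ} (hL : 0 ≤ L) (hK : 0 ≤ K)
    (hφ : StronglyMeasurable[past ξ 0] φ) (hφL : ∀ ω, |φ ω| ≤ L)
    (hψ : StronglyMeasurable[future ξ n] ψ) (hψK : ∀ ω, |ψ ω| ≤ K) :
    |∫ ω, φ ω * ψ ω ∂μ - (∫ ω, φ ω ∂μ) * ∫ ω, ψ ω ∂μ| ≤ 2 * L * (2 * K * ν.real Set.univ) := by
  have hp := past_le hξ 0
  have hf := future_le hξ n
  have hψi : Integrable ψ μ := Integrable.of_bound (hψ.mono hf).aestronglyMeasurable K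
    (Eventually.of_forall hψK)
  have hφi : Integrable φ μ := Integrable.of_bound (hφ.mono hp).aestronglyMeasurable L
    (Eventually.of_forall hφL)
  have e : ∫ ω, φ ω * (ψ ω - ∫ ω, ψ ω ∂μ) ∂μ
      = ∫ ω, φ ω * ψ ω ∂μ - (∫ ω, φ ω ∂μ) * ∫ ω, ψ ω ∂μ := by
    simp_rw [mul_sub]
    rw [integral_sub (hψi.bdd_mul (hφ.mono hp).aestronglyMeasurable (Eventually.of_forall hφL))
      (hφi.mul_const _), integral_mul_const]
  rw [← e]
  refine abs_integral_mul_le_of_setIntegral hp (hψi.sub (integrable_const _)) hL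
    (fun A hA => ?_) hφ hφL
  have h := hmix.abs_setIntegral_sub_le hξ hA hK hψ hψK
  have e2 : ∫ ω in A, (ψ ω - ∫ ω, ψ ω ∂μ) ∂μ = ∫ ω in A, ψ ω ∂μ - μ.real A * ∫ ω, ψ ω ∂μ := by
    rw [integral_sub hψi.integrableOn (integrable_const _)]
    simp [smul_eq_mul]
  change |∫ ω in A, (ψ ω - ∫ ω, ψ ω ∂μ) ∂μ| ≤ _
  rw [e2]
  refine h.trans (mul_le_mul_of_nonneg_left (measureReal_mono (Set.subset_univ A)) (by positivity))

/-- Three-block mixing: a centred bounded functional of a window, far from `0` and from `N`, is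
almost uncorrelated with events determined by `(ξ 0, ξ N)`. -/
lemma MixesWith.abs_setIntegral_window_le (hmix : MixesWith μ ξ n ν)
    (hξ : IsStationaryMarkovChain μ ξ) {a b N : ℤ} (ha : n ≤ a) (hab : a ≤ b) (hb : b + n ≤ N)
    {w : (ℤ → S) → ℝ} (hw : Measurable w)
    (hwm : ∀ c, StronglyMeasurable[window ξ (a + c) (b + c)] fun ω => w (path ξ c ω)) {K : ℝ}
    (hK : ∀ x, |w x| ≤ K) (h0 : ∫ ω, w (path ξ 0 ω) ∂μ = 0) {E : Set Ω}
    (hE : MeasurableSet[MeasurableSpace.comap (ξ 0) mS ⊔ MeasurableSpace.comap (ξ N) mS] E) :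
    |∫ ω in E, w (path ξ 0 ω) ∂μ| ≤ 4 * K * ν.real Set.univ := by
  obtain ⟨ω₀⟩ : Nonempty Ω := μ.nonempty_of_neZero
  have hK0 : 0 ≤ K := (abs_nonneg _).trans (hK (path ξ 0 ω₀))
  have hWi : ∀ c, Integrable (fun ω => w (path ξ c ω)) μ := fun c =>
    Integrable.of_bound ((hwm c).mono (window_le hξ.measurable _ _)).aestronglyMeasurable K
      (Eventually.of_forall fun ω => hK _)
  set W : Ω → ℝ := fun ω => w (path ξ 0 ω) with hW
  set δ := ν.real Set.univ with hδ
  -- Shifting time by -b puts the window into the past of 0 and the endpoint at N - b ≥ n, so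
  -- two-block mixing applies.
  have hright : ∀ F, MeasurableSet[MeasurableSpace.comap (ξ N) mS] F →
      |∫ ω in F, W ω ∂μ| ≤ 2 * K * δ := by
    rintro _ ⟨C, hC, rfl⟩
    have hG : Measurable fun x : ℤ → S => C.indicator (fun _ => (1 : ℝ)) (x N) * w x :=
      ((measurable_const.indicator hC).comp (measurable_pi_apply N)).mul hw
    have e : ∀ c, ∫ ω in ξ (N + c) ⁻¹' C, w (path ξ c ω) ∂μ
        = ∫ ω, (fun x : ℤ → S => C.indicator (fun _ => (1 : ℝ)) (x N) * w x) (path ξ c ω) ∂μ := by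
      intro c
      rw [← integral_mul_indicator _ (hξ.measurable _ hC)]
      rfl
    have e1 : ∫ ω in ξ N ⁻¹' C, W ω ∂μ = ∫ ω in ξ (N + -b) ⁻¹' C, w (path ξ (-b) ω) ∂μ := by
      rw [e (-b), (identDistrib_path hξ hG (-b) 0).integral_eq, ← e 0, add_zero]
    have e2 : ∫ ω, w (path ξ (-b) ω) ∂μ = 0 := by
      rw [(identDistrib_path hξ hw (-b) 0).integral_eq, h0]
    have hsm : StronglyMeasurable[past ξ 0] fun ω => w (path ξ (-b) ω) :=
      (hwm (-b)).mono (window_le_past (by omega))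
    have := hmix.abs_setIntegral_sub_le' hξ.measurable (B := ξ (N + -b) ⁻¹' C)
      (comap_le_future (by omega) _ ⟨C, hC, rfl⟩) hK0 hsm (fun ω => hK _)
    rw [e2, mul_zero, sub_zero] at this
    rwa [e1]
  refine abs_setIntegral_le_of_isSliced (hξ.measurable 0).comap_le (hξ.measurable N).comap_le
    (hWi 0) (K := K) (fun ω => hK _) ?_ hE
  rintro _ ⟨ι, _, s, F, hs, hF, rfl⟩
  have hsΩ : ∀ i, MeasurableSet (s ⁻¹' {i}) := fun i => (hξ.measurable 0).comap_le _ (hs i)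
  have hFΩ : ∀ i, MeasurableSet (F i) := fun i => (hξ.measurable N).comap_le _ (hF i)
  have hdisj : Pairwise (Function.onFun Disjoint fun i => s ⁻¹' {i}) := fun i j hij =>
    Disjoint.preimage _ (by simpa using hij)
  have hcov : (⋃ i, s ⁻¹' {i}) = Set.univ := by ext ω; simp
  have hU : {ω | ω ∈ F (s ω)} = ⋃ i, s ⁻¹' {i} ∩ F i := by ext ω; simp
  have hsplit : ∫ ω in {ω | ω ∈ F (s ω)}, W ω ∂μ
      = ∑ i, ∫ ω in s ⁻¹' {i}, (F i).indicator W ω ∂μ := by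
    rw [hU, integral_iUnion_fintype (fun i => (hsΩ i).inter (hFΩ i))
      (fun i j hij => (hdisj hij).mono Set.inter_subset_left Set.inter_subset_left)
      (fun i => (hWi 0).integrableOn)]
    exact Finset.sum_congr rfl fun i _ => (setIntegral_indicator (hFΩ i)).symm
  -- Decoupling slice i from the future of n costs 2K ν(slice); what is left is μ(slice) times an
  -- integral bounded by `hright`. Summed over slices, both contributions are at most 2Kδ.
  have hterm : ∀ i, |∫ ω in s ⁻¹' {i}, (F i).indicator W ω ∂μ|
      ≤ 2 * K * ν.real (s ⁻¹' {i}) + μ.real (s ⁻¹' {i}) * (2 * K * δ) := by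
    intro i
    have hsm : StronglyMeasurable[future ξ n] ((F i).indicator W) := by
      refine StronglyMeasurable.indicator ?_ (comap_le_future (by omega) _ (hF i))
      exact (hwm 0).mono (window_le_future (by omega))
    have h1 := hmix.abs_setIntegral_sub_le hξ.measurable (comap_le_past le_rfl _ (hs i)) hK0 hsm
      (fun ω => by
        by_cases h : ω ∈ F i
        · simpa [h] using hK _
        · simpa [h] using hK0)
    rw [integral_indicator (μ := μ) (hFΩ i)] at h1
    have h2 : |μ.real (s ⁻¹' {i}) * ∫ ω in F i, W ω ∂μ| ≤ μ.real (s ⁻¹' {i}) * (2 * K * δ) := by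
      rw [abs_mul, abs_of_nonneg measureReal_nonneg]
      exact mul_le_mul_of_nonneg_left (hright _ (hF i)) measureReal_nonneg
    have h3 := abs_add_le (∫ ω in s ⁻¹' {i}, (F i).indicator W ω ∂μ
      - μ.real (s ⁻¹' {i}) * ∫ ω in F i, W ω ∂μ) (μ.real (s ⁻¹' {i}) * ∫ ω in F i, W ω ∂μ)
    rw [sub_add_cancel] at h3
    linarith
  have hsum : ∀ ρ : Measure Ω, IsFiniteMeasure ρ → ∑ i, ρ.real (s ⁻¹' {i}) = ρ.real Set.univ := by
    intro ρ _
    rw [← hcov, measureReal_iUnion_fintype hdisj hsΩ]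
  rw [hsplit]
  refine (Finset.abs_sum_le_sum_abs _ _).trans ((Finset.sum_le_sum fun i _ => hterm i).trans ?_)
  rw [Finset.sum_add_distrib, ← Finset.mul_sum, ← Finset.sum_mul, hsum ν inferInstance,
    hsum μ inferInstance, probReal_univ (μ := μ)]
  linarith

end Mixing

/-! ### Blocks centred given their endpoints. -/

section Centering

variable {Ω S : Type*} {mΩ : MeasurableSpace Ω} [mS : MeasurableSpace S] {μ : Measure Ω}
  [IsProbabilityMeasure μ] {ξ : ℤ → Ω → S} {m : ℕ}

/-- The functional `g (x 0, …, x m)` minus `h (x 0, x m)`. -/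
def blockDiff {m : ℕ} (g : (Fin (m + 1) → S) → ℝ) (h : S × S → ℝ) (x : ℤ → S) : ℝ :=
  g (fun j => x (j : ℕ)) - h (x 0, x m)

/-- `h (ξ 0, ξ m)` is the conditional expectation of `g (ξ 0, …, ξ m)` given `(ξ 0, ξ m)`. -/
structure IsCentering (μ : Measure Ω) (ξ : ℤ → Ω → S) {m : ℕ} (g : (Fin (m + 1) → S) → ℝ)
    (h : S × S → ℝ) : Prop where
  measurable_left : Measurable g
  measurable : Measurable h
  ae_eq : (fun ω => h (ξ 0 ω, ξ m ω)) =ᵐ[μ]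
    μ[fun ω => g (fun j => ξ (j : ℕ) ω)|MeasurableSpace.comap (ξ 0) mS ⊔
      MeasurableSpace.comap (ξ m) mS]

omit [IsProbabilityMeasure μ] in
-- Doob–Dynkin factorisation. Having h as a function on `S × S` lets the centred block be evaluated
-- along shifted paths.
lemma exists_isCentering {g : (Fin (m + 1) → S) → ℝ} (hg : Measurable g) :
    ∃ h, IsCentering μ ξ g h := by
  have hsm : StronglyMeasurable[MeasurableSpace.comap (fun ω => (ξ 0 ω, ξ m ω)) (mS.prod mS)]
      (μ[fun ω => g (fun j => ξ (j : ℕ) ω)|MeasurableSpace.comap (ξ 0) mS ⊔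
        MeasurableSpace.comap (ξ m) mS]) := by
    rw [MeasurableSpace.comap_prodMk]
    exact stronglyMeasurable_condExp
  obtain ⟨h, hh, he⟩ := hsm.measurable.exists_eq_measurable_comp
  exact ⟨h, hg, hh, Eventually.of_forall fun ω => (congrFun he ω).symm⟩

lemma exists_isCentering_of_bounded {g : (Fin (m + 1) → S) → ℝ} (hg : Measurable g) {K : ℝ}
    (hK : ∀ x, |g x| ≤ K) : ∃ h, IsCentering μ ξ g h ∧ ∀ y, |h y| ≤ K := by
  obtain ⟨ω₀⟩ : Nonempty Ω := μ.nonempty_of_neZero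
  have hK0 : 0 ≤ K := (abs_nonneg _).trans (hK fun j => ξ (j : ℕ) ω₀)
  obtain ⟨h, hh⟩ := exists_isCentering (μ := μ) (ξ := ξ) hg
  refine ⟨fun y => max (-K) (min (h y) K), ⟨hg, ?_, ?_⟩, fun y => ?_⟩
  · exact measurable_const.max (hh.measurable.min measurable_const)
  · have hb : ∀ᵐ ω ∂μ, |(μ[fun ω => g (fun j => ξ (j : ℕ) ω)|MeasurableSpace.comap (ξ 0) mS ⊔
        MeasurableSpace.comap (ξ m) mS]) ω| ≤ K :=
      ae_bdd_abs_condExp_of_ae_bdd_abs (Eventually.of_forall fun ω => hK _)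
    filter_upwards [hh.ae_eq, hb] with ω h1 h2
    rw [← h1] at h2 ⊢
    rw [min_eq_left (abs_le.mp h2).2, max_eq_right (abs_le.mp h2).1]
  · exact abs_le.mpr ⟨le_max_left _ _, max_le (by linarith) (min_le_right _ _)⟩

variable {g : (Fin (m + 1) → S) → ℝ} {h : S × S → ℝ}

omit [IsProbabilityMeasure μ] in
lemma IsCentering.measurable_blockDiff (hc : IsCentering μ ξ g h) :
    Measurable (blockDiff g h) :=
  (hc.measurable_left.comp (measurable_pi_lambda _ fun _ => measurable_pi_apply _)).sub
    (hc.measurable.comp ((measurable_pi_apply _).prodMk (measurable_pi_apply _)))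

omit [IsProbabilityMeasure μ] in
lemma IsCentering.stronglyMeasurable_blockDiff (hc : IsCentering μ ξ g h) (k : ℤ) :
    StronglyMeasurable[window ξ k (m + k)] fun ω => blockDiff g h (path ξ k ω) := by
  have hm : ∀ j : ℤ, 0 ≤ j → j ≤ m → Measurable[window ξ k (m + k)] (ξ (j + k)) := fun j h1 h2 =>
    Measurable.mono (comap_measurable _) (comap_le_window (by omega) (by omega)) le_rfl
  refine Measurable.stronglyMeasurable (Measurable.sub ?_ ?_)
  · refine hc.measurable_left.comp
      (@measurable_pi_lambda _ _ _ (window ξ k (m + k)) _ _ fun j => hm _ (by omega) ?_)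
    have := j.2
    omega
  · exact hc.measurable.comp (Measurable.prodMk (hm 0 le_rfl (by omega)) (hm m (by omega) le_rfl))

omit [IsProbabilityMeasure μ] in
lemma IsCentering.memLp_right (hc : IsCentering μ ξ g h)
    (hg : MemLp (fun ω => g (fun j => ξ (j : ℕ) ω)) 2 μ) :
    MemLp (fun ω => h (ξ 0 ω, ξ m ω)) 2 μ :=
  (memLp_congr_ae hc.ae_eq).mpr (hg.condExp (by norm_num))

omit [IsProbabilityMeasure μ] in
lemma IsCentering.memLp_blockDiff (hξ : IsStationaryMarkovChain μ ξ) (hc : IsCentering μ ξ g h)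
    (hg : MemLp (fun ω => g (fun j => ξ (j : ℕ) ω)) 2 μ) (k : ℤ) :
    MemLp (fun ω => blockDiff g h (path ξ k ω)) 2 μ := by
  rw [(identDistrib_path hξ hc.measurable_blockDiff k 0).memLp_iff]
  have := hg.sub (hc.memLp_right hg)
  convert this using 1
  ext ω; simp [blockDiff, path]

/-- The centred blocks are centred given the past and the future of the block. -/
lemma IsCentering.condExp_blockDiff (hξ : IsStationaryMarkovChain μ ξ) (hc : IsCentering μ ξ g h)
    (hg : MemLp (fun ω => g (fun j => ξ (j : ℕ) ω)) 2 μ) (k : ℤ) :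
    μ[fun ω => blockDiff g h (path ξ k ω)|past ξ k ⊔ future ξ (m + k)] =ᵐ[μ] 0 := by
  have hi : ∀ k, Integrable (fun ω => blockDiff g h (path ξ k ω)) μ := fun k =>
    (hc.memLp_blockDiff hξ hg k).integrable (by norm_num)
  have hle : ∀ k, MeasurableSpace.comap (ξ k) mS ≤ mΩ := fun k => (hξ.measurable k).comap_le
  refine condExp_past_sup_future_eq_zero hξ (by omega) (hc.stronglyMeasurable_blockDiff k) (hi k) ?_
  refine condExp_eq_zero_of_setIntegral (sup_le (hle _) (hle _)) (hi k) fun E hE => ?_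
  rw [← MeasurableSpace.comap_prodMk] at hE
  obtain ⟨C, hC, rfl⟩ := hE
  -- The relation between g and h is known only at time 0, so the integral is written as a
  -- functional of the path and shifted there.
  have hG : Measurable fun x : ℤ → S =>
      C.indicator (fun _ => (1 : ℝ)) (x 0, x m) * blockDiff g h x :=
    ((measurable_const.indicator hC).comp
      ((measurable_pi_apply 0).prodMk (measurable_pi_apply (m : ℤ)))).mul hc.measurable_blockDiff
  have hpm : ∀ k, MeasurableSet ((fun ω => (ξ (0 + k) ω, ξ (m + k) ω)) ⁻¹' C) := fun k =>
    ((hξ.measurable _).prodMk (hξ.measurable _)) hC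
  have e : ∀ k, ∫ ω in (fun ω => (ξ (0 + k) ω, ξ (m + k) ω)) ⁻¹' C, blockDiff g h (path ξ k ω) ∂μ
      = ∫ ω, (fun x : ℤ → S => C.indicator (fun _ => (1 : ℝ)) (x 0, x m) * blockDiff g h x)
          (path ξ k ω) ∂μ := by
    intro k
    rw [← integral_mul_indicator _ (hpm k)]
    rfl
  have e1 := e k
  rw [(identDistrib_path hξ hG k 0).integral_eq, ← e 0] at e1
  simp only [zero_add, add_zero] at e1
  rw [e1]
  have hE0 : MeasurableSet[MeasurableSpace.comap (ξ 0) mS ⊔ MeasurableSpace.comap (ξ m) mS]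
      ((fun ω => (ξ 0 ω, ξ m ω)) ⁻¹' C) := by
    rw [← MeasurableSpace.comap_prodMk]
    exact ⟨C, hC, rfl⟩
  have hgi : Integrable (fun ω => g (fun j => ξ (j : ℕ) ω)) μ := hg.integrable (by norm_num)
  have hhi : Integrable (fun ω => h (ξ 0 ω, ξ m ω)) μ :=
    (hc.memLp_right hg).integrable (by norm_num)
  have e2 : ∀ ω, blockDiff g h (path ξ 0 ω) = g (fun j => ξ (j : ℕ) ω) - h (ξ 0 ω, ξ m ω) := by
    intro ω; simp [blockDiff, path]
  simp_rw [e2]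
  rw [integral_sub hgi.integrableOn hhi.integrableOn,
    ← setIntegral_condExp (sup_le (hle 0) (hle m)) hgi hE0,
    setIntegral_congr_ae (g := fun ω => h (ξ 0 ω, ξ m ω)) (sup_le (hle 0) (hle m) _ hE0), sub_self]
  filter_upwards [hc.ae_eq] with ω hω _ using hω.symm

/-- The source of every orthogonality relation below: Y may depend on all times outside the interior
of the block, both endpoints included. -/
lemma IsCentering.integral_mul_blockDiff (hξ : IsStationaryMarkovChain μ ξ)
    (hc : IsCentering μ ξ g h) (hg : MemLp (fun ω => g (fun j => ξ (j : ℕ) ω)) 2 μ) (k : ℤ)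
    {Y : Ω → ℝ} (hY : StronglyMeasurable[past ξ k ⊔ future ξ (m + k)] Y) (hY2 : MemLp Y 2 μ) :
    ∫ ω, Y ω * blockDiff g h (path ξ k ω) ∂μ = 0 :=
  integral_mul_eq_zero_of_condExp_eq_zero
    (sup_le (past_le hξ.measurable _) (future_le hξ.measurable _))
    ((hc.memLp_blockDiff hξ hg k).integrable (by norm_num)) (hc.condExp_blockDiff hξ hg k) hY
    (hY2.integrable_mul (hc.memLp_blockDiff hξ hg k))

end Centering

/-! ### Truncation estimates. -/

section Clip

/-- Truncation of a real number to `[-K, K]`. -/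
def clip (K z : ℝ) : ℝ := max (-K) (min z K)

lemma continuous_clip (K : ℝ) : Continuous (clip K) :=
  continuous_const.max (continuous_id.min continuous_const)

lemma abs_clip_le {K : ℝ} (hK : 0 ≤ K) (z : ℝ) : |clip K z| ≤ K :=
  abs_le.mpr ⟨le_max_left _ _, max_le (by linarith) (min_le_right _ _)⟩

lemma clip_eq_self {K z : ℝ} (h : |z| ≤ K) : clip K z = z := by
  rw [clip, min_eq_left (abs_le.mp h).2, max_eq_right (abs_le.mp h).1]

lemma abs_sub_clip_le_abs {K : ℝ} (hK : 0 ≤ K) (z : ℝ) : |z - clip K z| ≤ |z| := by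
  unfold clip
  rcases le_total z K with h1 | h1
  · rw [min_eq_left h1]
    rcases le_total (-K) z with h2 | h2
    · rw [max_eq_right h2]; simp
    · rw [max_eq_left h2, abs_of_nonpos (by linarith), abs_of_nonpos (by linarith)]; linarith
  · rw [min_eq_right h1, max_eq_right (by linarith), abs_of_nonneg (by linarith),
      abs_of_nonneg (by linarith)]; linarith

/-- The excess is zero unless |z| ≥ K, and there |z| ≤ z² / K. Second moments thus control
truncation errors in mean. -/
lemma abs_sub_clip_le {K : ℝ} (hK : 0 < K) (z : ℝ) : |z - clip K z| ≤ z ^ 2 / K := by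
  rcases le_total |z| K with h | h
  · rw [clip_eq_self h, sub_self, abs_zero]; positivity
  · refine (abs_sub_clip_le_abs hK.le z).trans ?_
    rw [le_div_iff₀ hK, ← sq_abs]
    nlinarith [abs_nonneg z]

lemma sq_integral_abs_le {Ω : Type*} {mΩ : MeasurableSpace Ω} {μ : Measure Ω}
    [IsProbabilityMeasure μ] {X : Ω → ℝ} (hX : MemLp X 2 μ) :
    (∫ ω, |X ω| ∂μ) ^ 2 ≤ ∫ ω, X ω ^ 2 ∂μ := by
  have hi : Integrable (fun ω => |X ω|) μ := (hX.integrable (by norm_num)).abs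
  have h2 : Integrable (fun ω => X ω ^ 2) μ := hX.integrable_sq
  set c := ∫ ω, |X ω| ∂μ
  have h : 0 ≤ ∫ ω, (|X ω| - c) ^ 2 ∂μ := integral_nonneg fun _ => sq_nonneg _
  have e : ∀ ω, (|X ω| - c) ^ 2 = X ω ^ 2 - 2 * c * |X ω| + c ^ 2 := fun ω => by
    rw [sub_sq, sq_abs]; ring
  simp_rw [e] at h
  have h3 : Integrable (fun ω => X ω ^ 2 - 2 * c * |X ω|) μ := h2.sub (hi.const_mul _)
  rw [integral_add h3 (integrable_const _), integral_sub h2 (hi.const_mul _),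
    integral_const_mul, integral_const, probReal_univ, one_smul] at h
  nlinarith

end Clip

/-! ### The conditional mean given the endpoints is negligible. -/

section AdditiveFunctional

variable {Ω S : Type*} {mΩ : MeasurableSpace Ω} [mS : MeasurableSpace S] {μ : Measure Ω}
  [IsProbabilityMeasure μ] {ξ : ℤ → Ω → S} {f : S → ℝ}

/-- The sum `f (x 1) + ⋯ + f (x l)` along a path. -/
def segSum (f : S → ℝ) (l : ℕ) (x : ℤ → S) : ℝ := ∑ i ∈ Finset.range l, f (x (i + 1))

/-- The sum `f (x 1) + ⋯ + f (x m)` as a function of `(x 0, …, x m)`. -/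
def sumBlock (f : S → ℝ) (m : ℕ) (x : Fin (m + 1) → S) : ℝ := ∑ i : Fin m, f (x i.succ)

omit mΩ mS in
lemma partialSum_eq_segSum (n : ℕ) (ω : Ω) : partialSum ξ f n ω = segSum f n (path ξ 0 ω) := by
  unfold partialSum segSum path
  rw [Finset.range_eq_Ico, Finset.sum_Ico_add' (fun i : ℕ => f (ξ (i : ℤ) ω)) 0 n 1 |>.symm.trans
    (Finset.sum_congr rfl fun i _ => ?_) |>.symm]
  · rfl
  · simp

omit mS in
lemma sumBlock_eq_segSum (m : ℕ) (x : ℤ → S) :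
    sumBlock f m (fun j => x (j : ℕ)) = segSum f m x := by
  unfold sumBlock segSum
  rw [← Fin.sum_univ_eq_sum_range (fun i => f (x (i + 1)))]
  refine Finset.sum_congr rfl fun i _ => ?_
  simp

lemma measurable_segSum (hf : Measurable f) (l : ℕ) : Measurable (segSum f l) :=
  Finset.measurable_fun_sum _ fun _ _ => hf.comp (measurable_pi_apply _)

lemma measurable_sumBlock (hf : Measurable f) (m : ℕ) : Measurable (sumBlock f m) :=
  Finset.measurable_fun_sum _ fun _ _ => hf.comp (measurable_pi_apply _)

omit mΩ mS in
lemma segSum_add (p q : ℕ) (a : ℤ) (ω : Ω) :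
    segSum f (p + q) (path ξ a ω) = segSum f p (path ξ a ω) + segSum f q (path ξ (a + p) ω) := by
  unfold segSum path
  rw [Finset.sum_range_add]
  congr 1
  refine Finset.sum_congr rfl fun i _ => ?_
  congr 2; push_cast; ring

lemma stronglyMeasurable_segSum (hf : Measurable f) (l : ℕ) (a : ℤ) :
    StronglyMeasurable[window ξ a (a + l)] fun ω => segSum f l (path ξ a ω) := by
  refine Measurable.stronglyMeasurable (Finset.measurable_fun_sum _ fun i hi => hf.comp ?_)
  have := Finset.mem_range.mp hi
  exact Measurable.mono (comap_measurable _) (comap_le_window (by omega) (by omega)) le_rfl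

omit [IsProbabilityMeasure μ] in
lemma memLp_segSum (hξ : IsStationaryMarkovChain μ ξ) (hf : Measurable f)
    (hf2 : MemLp f 2 (μ.map (ξ 0))) (l : ℕ) (a : ℤ) :
    MemLp (fun ω => segSum f l (path ξ a ω)) 2 μ := by
  have h0 : MemLp (fun ω => f (path ξ 0 ω 0)) 2 μ := by
    have := hf2.comp_of_map (hξ.measurable 0).aemeasurable
    simp only [path, zero_add]
    exact this
  refine memLp_finsetSum _ fun i _ => ?_
  have hF : Measurable fun x : ℤ → S => f (x 0) := hf.comp (measurable_pi_apply 0)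
  have := (identDistrib_path hξ hF (i + 1 + a) 0).memLp_iff (p := 2) |>.mpr h0
  simpa [path] using this

lemma integral_segSum (hξ : IsStationaryMarkovChain μ ξ) (hf : Measurable f)
    (hf2 : MemLp f 2 (μ.map (ξ 0))) (hf0 : ∫ x, f x ∂(μ.map (ξ 0)) = 0) (l : ℕ) (a : ℤ) :
    ∫ ω, segSum f l (path ξ a ω) ∂μ = 0 := by
  have h0 : MemLp (fun ω => f (path ξ 0 ω 0)) 2 μ := by
    have := hf2.comp_of_map (hξ.measurable 0).aemeasurable
    simp only [path, zero_add]
    exact this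
  have hF : Measurable fun x : ℤ → S => f (x 0) := hf.comp (measurable_pi_apply 0)
  have e0 : ∫ ω, f (path ξ 0 ω 0) ∂μ = 0 := by
    rw [← hf0, integral_map (hξ.measurable 0).aemeasurable hf.aestronglyMeasurable]
    simp [path]
  unfold segSum
  rw [integral_finsetSum]
  · refine Finset.sum_eq_zero fun i _ => ?_
    have := (identDistrib_path hξ hF (i + 1 + a) 0).integral_eq
    rw [e0] at this
    simpa [path] using this
  · intro i _
    have := (identDistrib_path hξ hF (i + 1 + a) 0).memLp_iff (p := 2) |>.mpr h0
    refine MemLp.integrable (q := 2) (by norm_num) ?_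
    simpa [path] using this

/-- The second moment of a sum over a window far from `0` and `N` controls its integral over
events determined by `(ξ 0, ξ N)`. -/
lemma MixesWith.abs_setIntegral_segSum_le {ν : Measure Ω} [IsFiniteMeasure ν] {n : ℕ}
    (hmix : MixesWith μ ξ n ν) (hξ : IsStationaryMarkovChain μ ξ) (hf : Measurable f)
    (hf2 : MemLp f 2 (μ.map (ξ 0))) (hf0 : ∫ x, f x ∂(μ.map (ξ 0)) = 0) {l : ℕ} {a N : ℤ}
    (ha : n ≤ a) (hb : a + l + n ≤ N) {E : Set Ω}
    (hE : MeasurableSet[MeasurableSpace.comap (ξ 0) mS ⊔ MeasurableSpace.comap (ξ N) mS] E)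
    {K : ℝ} (hK : 0 < K) :
    |∫ ω in E, segSum f l (path ξ a ω) ∂μ|
      ≤ 8 * K * ν.real Set.univ + 2 * ((∫ ω, segSum f l (path ξ 0 ω) ^ 2 ∂μ) / K) := by
  set Z : ℤ → Ω → ℝ := fun c ω => segSum f l (path ξ c ω) with hZ
  have hZm : Measurable fun x : ℤ → S => segSum f l x := measurable_segSum hf l
  have hZi : Integrable (Z a) μ := (memLp_segSum hξ hf hf2 l a).integrable (by norm_num)
  have hZ2 : Integrable (fun ω => Z a ω ^ 2) μ := (memLp_segSum hξ hf hf2 l a).integrable_sq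
  have hV : ∫ ω, Z a ω ^ 2 ∂μ = ∫ ω, Z 0 ω ^ 2 ∂μ :=
    (identDistrib_path hξ (hZm.pow_const 2) a 0).integral_eq
  set V := ∫ ω, Z 0 ω ^ 2 ∂μ with hVdef
  have hci : Integrable (fun ω => clip K (Z a ω)) μ :=
    Integrable.of_bound ((continuous_clip K).comp_aestronglyMeasurable hZi.aestronglyMeasurable) K
      (Eventually.of_forall fun ω => abs_clip_le hK.le _)
  have hdi : Integrable (fun ω => |Z a ω - clip K (Z a ω)|) μ := (hZi.sub hci).abs
  have htail : ∫ ω, |Z a ω - clip K (Z a ω)| ∂μ ≤ V / K := by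
    rw [← hV, ← integral_div]
    exact integral_mono hdi (hZ2.div_const K) fun ω => abs_sub_clip_le hK _
  set e : ℝ := ∫ ω, clip K (Z a ω) ∂μ with he
  have he1 : |e| ≤ V / K := by
    have : e = -∫ ω, (Z a ω - clip K (Z a ω)) ∂μ := by
      rw [integral_sub hZi hci, integral_segSum hξ hf hf2 hf0]; ring
    rw [this, abs_neg]
    exact abs_integral_le_integral_abs.trans htail
  have he2 : |e| ≤ K := by
    rw [he, ← Real.norm_eq_abs]
    refine (norm_integral_le_of_norm_le_const (Eventually.of_forall fun ω =>
      abs_clip_le hK.le _)).trans (le_of_eq (by rw [probReal_univ, mul_one]))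
  have hshift : Measurable fun (x : ℤ → S) (k : ℤ) => x (k + a) :=
    measurable_pi_lambda _ fun k => measurable_pi_apply _
  -- The clipped sum is recentred because clipping spoils the zero mean. The result is bounded by
  -- 2K, which gives 8K; the tail and the mean e contribute V / K each.
  set w : (ℤ → S) → ℝ := fun x => clip K (segSum f l fun k => x (k + a)) - e with hw
  have hwp : ∀ c ω, w (path ξ c ω) = clip K (Z (a + c) ω) - e := by
    intro c ω
    simp only [hw, hZ]
    congr 3
    funext k
    simp only [path]
    congr 1; ring
  have hE' : MeasurableSet E :=
    sup_le (hξ.measurable 0).comap_le (hξ.measurable N).comap_le _ hE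
  have hmain := hmix.abs_setIntegral_window_le hξ (a := a) (b := a + l) (N := N) ha (by omega) hb
    (w := w) (((continuous_clip K).measurable.comp (hZm.comp hshift)).sub_const e) (fun c => by
      simp_rw [hwp]
      refine StronglyMeasurable.sub ?_ stronglyMeasurable_const
      refine (continuous_clip K).comp_stronglyMeasurable ?_
      have := stronglyMeasurable_segSum (ξ := ξ) hf l (a + c)
      rwa [show a + c + (l : ℤ) = a + l + c by ring] at this)
    (K := 2 * K) (fun x => by
      refine (abs_sub _ _).trans ?_
      linarith [abs_clip_le hK.le (segSum f l fun k => x (k + a))])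
    (by
      simp_rw [hwp, add_zero]
      rw [integral_sub hci (integrable_const _)]
      simp [he]) hE
  simp_rw [hwp, add_zero] at hmain
  have h1 : ∫ ω in E, Z a ω ∂μ = ∫ ω in E, (clip K (Z a ω) - e) ∂μ
      + ∫ ω in E, (Z a ω - clip K (Z a ω)) ∂μ + μ.real E * e := by
    rw [integral_sub hci.integrableOn (integrable_const _), integral_sub hZi.integrableOn
      hci.integrableOn]
    simp [smul_eq_mul]
  have h2 : |∫ ω in E, (Z a ω - clip K (Z a ω)) ∂μ| ≤ V / K :=
    abs_integral_le_integral_abs.trans ((setIntegral_le_integral hdi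
      (Eventually.of_forall fun _ => abs_nonneg _)).trans htail)
  have h3 : |μ.real E * e| ≤ V / K := by
    rw [abs_mul, abs_of_nonneg measureReal_nonneg]
    have : μ.real E ≤ 1 := measureReal_le_one
    nlinarith [abs_nonneg e, measureReal_nonneg (μ := μ) (s := E)]
  change |∫ ω in E, Z a ω ∂μ| ≤ _
  rw [h1]
  refine (abs_add_three _ _ _).trans ?_
  linarith

/-- Under absolute regularity the conditional expectation of the partial sum given the two
endpoints is negligible in mean at scale `√n`. -/
lemma eventually_integral_abs_endpoint_le (hξ : IsStationaryMarkovChain μ ξ)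
    (hβ : IsAbsolutelyRegular μ ξ) (hf : Measurable f)
    (hf2 : MemLp f 2 (μ.map (ξ 0))) (hf0 : ∫ x, f x ∂(μ.map (ξ 0)) = 0) {C : ℝ}
    (hC : ∀ n : ℕ, ∫ ω, segSum f n (path ξ 0 ω) ^ 2 ∂μ ≤ C * n) {ε : ℝ} (hε : 0 < ε) :
    ∀ᶠ N : ℕ in atTop, ∀ h, IsCentering μ ξ (sumBlock f N) h →
      ∫ ω, |h (ξ 0 ω, ξ N ω)| ∂μ ≤ ε * √(N : ℝ) := by
  have hC0 : 0 ≤ C := by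
    have := (integral_nonneg fun ω => sq_nonneg (segSum f 1 (path ξ 0 ω))).trans (hC 1)
    simpa using this
  -- The truncation level will be L √N: the truncation error is then at most (ε/12) √N, and a mass
  -- of ν up to ε / (48 L) keeps the mixing error below (ε/6) √N. Using C + 1 keeps L positive.
  set L : ℝ := 12 * (C + 1) / ε with hL
  have hL0 : 0 < L := by positivity
  obtain ⟨n, ν, _, hν, hmix⟩ := exists_mixesWith hξ.measurable hβ (ε := ε / (48 * L))
    (by positivity)
  set c := ∫ ω, |segSum f n (path ξ 0 ω)| ∂μ with hc
  have hlarge : ∀ᶠ N : ℕ in atTop, 12 * c / ε ≤ √(N : ℝ) :=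
    (Real.tendsto_sqrt_atTop.comp tendsto_natCast_atTop_atTop).eventually_ge_atTop _
  filter_upwards [hlarge, eventually_gt_atTop (2 * n)] with N hN1 hN2 h hh
  have hN0 : (0 : ℝ) < N := by exact_mod_cast (by omega : 0 < N)
  have hsq : √(N : ℝ) * √(N : ℝ) = N := Real.mul_self_sqrt hN0.le
  have hs0 : 0 < √(N : ℝ) := Real.sqrt_pos.mpr hN0
  have hle : MeasurableSpace.comap (ξ 0) mS ⊔ MeasurableSpace.comap (ξ N) mS ≤ mΩ :=
    sup_le (hξ.measurable 0).comap_le (hξ.measurable N).comap_le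
  set U : Ω → ℝ := fun ω => h (ξ 0 ω, ξ N ω) with hU
  have eS : ∀ ω, sumBlock f N (fun j => ξ (j : ℕ) ω) = segSum f N (path ξ 0 ω) := fun ω => by
    rw [← sumBlock_eq_segSum]; simp [path]
  have hSL := memLp_segSum hξ hf hf2 N 0
  have hSi : Integrable (fun ω => segSum f N (path ξ 0 ω)) μ := hSL.integrable (by norm_num)
  have hae := hh.ae_eq
  simp_rw [eS] at hae
  have hUi : Integrable U μ := integrable_condExp.congr hae.symm
  have hE : MeasurableSet[MeasurableSpace.comap (ξ 0) mS ⊔ MeasurableSpace.comap (ξ N) mS]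
      {ω | 0 < U ω} := by
    rw [← MeasurableSpace.comap_prodMk]
    exact ⟨{y | 0 < h y}, measurableSet_lt measurable_const hh.measurable, rfl⟩
  have hU0 : ∫ ω, U ω ∂μ = 0 := by
    rw [integral_congr_ae hae, integral_condExp hle, integral_segSum hξ hf hf2 hf0]
  have hUS : ∫ ω in {ω | 0 < U ω}, U ω ∂μ = ∫ ω in {ω | 0 < U ω}, segSum f N (path ξ 0 ω) ∂μ := by
    rw [← setIntegral_condExp hle hSi hE]
    exact setIntegral_congr_ae (hle _ hE) (hae.mono fun _ h _ => h)
  -- As U has mean zero, E|U| is twice the integral of U over {U > 0}. This event is determined by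
  -- the endpoints, so U may be replaced there by the partial sum.
  rw [integral_abs_eq_two_mul hUi hU0 (hle _ hE), hUS]
  -- Two edges of n terms separate the middle from both endpoints; each edge costs at most the
  -- constant c, negligible against √N.
  obtain ⟨l, rfl⟩ : ∃ l, N = n + l + n := ⟨N - 2 * n, by omega⟩
  have hi : ∀ l a, Integrable (fun ω => segSum f l (path ξ a ω)) μ := fun l a =>
    (memLp_segSum hξ hf hf2 l a).integrable (by norm_num)
  set E := {ω | 0 < U ω}
  have hsplit : ∫ ω in E, segSum f (n + l + n) (path ξ 0 ω) ∂μ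
      = ∫ ω in E, segSum f n (path ξ 0 ω) ∂μ + ∫ ω in E, segSum f l (path ξ n ω) ∂μ
        + ∫ ω in E, segSum f n (path ξ ((n + l : ℕ) : ℤ) ω) ∂μ := by
    have h2 : Integrable (fun ω => segSum f n (path ξ 0 ω) + segSum f l (path ξ n ω)) μ :=
      (hi _ _).add (hi _ _)
    rw [← integral_add (hi _ _).integrableOn (hi _ _).integrableOn,
      ← integral_add h2.integrableOn (hi _ _).integrableOn]
    refine integral_congr_ae (Eventually.of_forall fun ω => ?_)
    simp only [segSum_add, zero_add]
  have hedge : ∀ a, |∫ ω in E, segSum f n (path ξ a ω) ∂μ| ≤ c := fun a => by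
    refine abs_integral_le_integral_abs.trans ((setIntegral_le_integral (hi n a).abs
      (Eventually.of_forall fun _ => abs_nonneg _)).trans (le_of_eq ?_))
    exact (identDistrib_path hξ (measurable_segSum hf n).abs a 0).integral_eq
  have hmid := hmix.abs_setIntegral_segSum_le hξ hf hf2 hf0 (l := l) (a := n)
    (N := ((n + l + n : ℕ) : ℤ)) le_rfl (by push_cast; omega) hE
    (K := L * √((n + l + n : ℕ) : ℝ)) (by positivity)
  set r := √((n + l + n : ℕ) : ℝ) with hr
  have hV : (∫ ω, segSum f l (path ξ 0 ω) ^ 2 ∂μ) / (L * r) ≤ ε / 12 * r := by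
    rw [div_le_iff₀ (by positivity)]
    refine (hC l).trans ?_
    have e1 : ε / 12 * r * (L * r) = (C + 1) * (r * r) := by rw [hL]; field_simp
    have hl : (l : ℝ) ≤ ((n + l + n : ℕ) : ℝ) := by exact_mod_cast (by omega : l ≤ n + l + n)
    rw [e1, hsq]
    nlinarith
  have hK : 8 * (L * r) * ν.real Set.univ ≤ ε / 6 * r := by
    have := mul_le_mul_of_nonneg_left hν (by positivity : (0 : ℝ) ≤ 8 * (L * r))
    refine this.trans (le_of_eq ?_)
    field_simp; ring
  have hc' : c ≤ ε / 12 * r := by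
    rw [div_le_iff₀ hε] at hN1
    linarith
  have h1 := hedge 0
  have h2 := hedge ((n + l : ℕ) : ℤ)
  have h3 : ∫ ω in E, segSum f (n + l + n) (path ξ 0 ω) ∂μ ≤ ε / 2 * r := by
    rw [hsplit]
    have a1 := le_abs_self (∫ ω in E, segSum f n (path ξ 0 ω) ∂μ)
    have a2 := le_abs_self (∫ ω in E, segSum f n (path ξ ((n + l : ℕ) : ℤ) ω) ∂μ)
    have a3 := le_abs_self (∫ ω in E, segSum f l (path ξ n ω) ∂μ)
    linarith
  linarith

end AdditiveFunctional

/-! ### Orthogonal block decomposition and the asymptotic variance. -/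

section BlockApproximation

variable {Ω S : Type*} {mΩ : MeasurableSpace Ω} [mS : MeasurableSpace S] {μ : Measure Ω}
  [IsProbabilityMeasure μ] {ξ : ℤ → Ω → S} {f : S → ℝ} {m : ℕ} {g : (Fin (m + 1) → S) → ℝ}
  {h : S × S → ℝ}

lemma integral_blockDiff_mul_of_ne (hξ : IsStationaryMarkovChain μ ξ) (hc : IsCentering μ ξ g h)
    (hg : MemLp (fun ω => g (fun j => ξ (j : ℕ) ω)) 2 μ) {i j : ℕ} (hij : i ≠ j) :
    ∫ ω, blockDiff g h (path ξ ((i * m : ℕ) : ℤ) ω) * blockDiff g h (path ξ ((j * m : ℕ) : ℤ) ω) ∂μ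
      = 0 := by
  have key : ∀ {i j : ℕ}, i < j → ∫ ω, blockDiff g h (path ξ ((i * m : ℕ) : ℤ) ω) *
      blockDiff g h (path ξ ((j * m : ℕ) : ℤ) ω) ∂μ = 0 := by
    intro i j hij
    refine hc.integral_mul_blockDiff hξ hg _ ?_ (hc.memLp_blockDiff hξ hg _)
    refine (hc.stronglyMeasurable_blockDiff _).mono (le_trans (window_le_past ?_) le_sup_left)
    have : (i + 1) * m ≤ j * m := Nat.mul_le_mul_right m hij
    rw [add_mul, one_mul] at this
    push_cast
    exact_mod_cast (by omega : m + i * m ≤ j * m)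
  rcases lt_or_gt_of_ne hij with h1 | h1
  · exact key h1
  · simp_rw [mul_comm (blockDiff g h (path ξ ((i * m : ℕ) : ℤ) _))]
    exact key h1

/-- The terms of the partial sum before the block lie in its past and those after it in its future,
so only the block's own terms correlate with it. -/
lemma integral_segSum_mul_blockDiff (hξ : IsStationaryMarkovChain μ ξ) (hf : Measurable f)
    (hf2 : MemLp f 2 (μ.map (ξ 0))) (hc : IsCentering μ ξ g h)
    (hg : MemLp (fun ω => g (fun j => ξ (j : ℕ) ω)) 2 μ) {n j : ℕ} (hj : (j + 1) * m ≤ n) :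
    ∫ ω, segSum f n (path ξ 0 ω) * blockDiff g h (path ξ ((j * m : ℕ) : ℤ) ω) ∂μ
      = ∫ ω, segSum f m (path ξ 0 ω) * blockDiff g h (path ξ 0 ω) ∂μ := by
  obtain ⟨r, rfl⟩ := Nat.exists_eq_add_of_le hj
  rw [add_mul, one_mul] at hj ⊢
  have hS := fun l a => memLp_segSum hξ hf hf2 l a
  have hD := fun k => hc.memLp_blockDiff hξ hg k
  have hi := fun l a k => (hS l a).integrable_mul (hD k)
  set k : ℤ := ((j * m : ℕ) : ℤ) with hk
  have e : ∀ ω, segSum f (j * m + m + r) (path ξ 0 ω) * blockDiff g h (path ξ k ω)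
      = segSum f (j * m) (path ξ 0 ω) * blockDiff g h (path ξ k ω)
        + segSum f m (path ξ k ω) * blockDiff g h (path ξ k ω)
        + segSum f r (path ξ (m + k) ω) * blockDiff g h (path ξ k ω) := by
    intro ω
    rw [segSum_add, segSum_add, show (0 : ℤ) + ((j * m + m : ℕ) : ℤ) = m + k by
      rw [hk]; push_cast; ring, zero_add]
    ring
  simp_rw [e]
  have h12 : Integrable (fun ω => segSum f (j * m) (path ξ 0 ω) * blockDiff g h (path ξ k ω)
        + segSum f m (path ξ k ω) * blockDiff g h (path ξ k ω)) μ :=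
    (hi (j * m) 0 k).add (hi m k k)
  have e1 := integral_add (hi (j * m) 0 k) (hi m k k)
  have e2 := integral_add h12 (hi r (m + k) k)
  simp only [Pi.mul_apply] at e1 e2
  rw [e2, e1, hc.integral_mul_blockDiff hξ hg k ?_ (hS (j * m) 0),
    hc.integral_mul_blockDiff hξ hg k ?_ (hS r (m + k)), zero_add, add_zero]
  · exact (identDistrib_path hξ ((measurable_segSum hf m).mul hc.measurable_blockDiff) k 0).integral_eq
  · exact (stronglyMeasurable_segSum hf _ _).mono (le_trans (window_le_future le_rfl) le_sup_right)
  · exact (stronglyMeasurable_segSum hf _ _).mono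
      (le_trans (window_le_past (by omega)) le_sup_left)

omit mS in
lemma sumBlock_path (m : ℕ) (ω : Ω) :
    sumBlock f m (fun j => ξ (j : ℕ) ω) = segSum f m (path ξ 0 ω) := by
  rw [← sumBlock_eq_segSum]; simp [path]

omit [IsProbabilityMeasure μ] in
lemma memLp_sumBlock (hξ : IsStationaryMarkovChain μ ξ) (hf : Measurable f)
    (hf2 : MemLp f 2 (μ.map (ξ 0))) (m : ℕ) :
    MemLp (fun ω => sumBlock f m (fun j => ξ (j : ℕ) ω)) 2 μ := by
  simp_rw [sumBlock_path]
  exact memLp_segSum hξ hf hf2 m 0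

omit mS in
lemma blockDiff_sumBlock {H : S × S → ℝ} (n : ℕ) (ω : Ω) :
    blockDiff (sumBlock f n) H (path ξ 0 ω) = segSum f n (path ξ 0 ω) - H (ξ 0 ω, ξ n ω) := by
  simp only [blockDiff, sumBlock_eq_segSum]
  simp [path]

lemma integral_blockDiff_sumBlock_mul (hξ : IsStationaryMarkovChain μ ξ) (hf : Measurable f)
    (hf2 : MemLp f 2 (μ.map (ξ 0))) (hc : IsCentering μ ξ g h)
    (hg : MemLp (fun ω => g (fun j => ξ (j : ℕ) ω)) 2 μ) {n j : ℕ} (hj : (j + 1) * m ≤ n)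
    {H : S × S → ℝ} (hH : IsCentering μ ξ (sumBlock f n) H) :
    ∫ ω, blockDiff (sumBlock f n) H (path ξ 0 ω) * blockDiff g h (path ξ ((j * m : ℕ) : ℤ) ω) ∂μ
      = ∫ ω, segSum f m (path ξ 0 ω) * blockDiff g h (path ξ 0 ω) ∂μ := by
  have hS := memLp_segSum hξ hf hf2 n 0
  have hH2 := hH.memLp_right (memLp_sumBlock hξ hf hf2 n)
  have hD := hc.memLp_blockDiff hξ hg ((j * m : ℕ) : ℤ)
  simp_rw [blockDiff_sumBlock, sub_mul]
  have e := integral_sub (hS.integrable_mul hD) (hH2.integrable_mul hD)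
  simp only [Pi.mul_apply] at e
  rw [e, integral_segSum_mul_blockDiff hξ hf hf2 hc hg hj,
    hc.integral_mul_blockDiff hξ hg _ ?_ hH2, sub_zero]
  refine Measurable.stronglyMeasurable (hH.measurable.comp (Measurable.prodMk ?_ ?_))
  · exact Measurable.mono (comap_measurable _)
      ((comap_le_past (by omega)).trans le_sup_left) le_rfl
  · refine Measurable.mono (comap_measurable _)
      ((comap_le_future ?_).trans le_sup_right) le_rfl
    rw [add_mul, one_mul] at hj
    exact_mod_cast (by omega : m + j * m ≤ n)

/-- The orthogonal decomposition of the centred partial sum along blocks of length `m`. -/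
lemma integral_sq_blockDiff_sub_sum (hξ : IsStationaryMarkovChain μ ξ) (hf : Measurable f)
    (hf2 : MemLp f 2 (μ.map (ξ 0))) (hc : IsCentering μ ξ g h)
    (hg : MemLp (fun ω => g (fun j => ξ (j : ℕ) ω)) 2 μ) {n N : ℕ} (hN : N * m ≤ n)
    {H : S × S → ℝ} (hH : IsCentering μ ξ (sumBlock f n) H) :
    ∫ ω, (blockDiff (sumBlock f n) H (path ξ 0 ω)
        - ∑ j ∈ Finset.range N, blockDiff g h (path ξ ((j * m : ℕ) : ℤ) ω)) ^ 2 ∂μ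
      = ∫ ω, blockDiff (sumBlock f n) H (path ξ 0 ω) ^ 2 ∂μ
        - N * (2 * ∫ ω, segSum f m (path ξ 0 ω) * blockDiff g h (path ξ 0 ω) ∂μ
            - ∫ ω, blockDiff g h (path ξ 0 ω) ^ 2 ∂μ) := by
  set D : Ω → ℝ := fun ω => blockDiff (sumBlock f n) H (path ξ 0 ω) with hD
  set d : ℕ → Ω → ℝ := fun j ω => blockDiff g h (path ξ ((j * m : ℕ) : ℤ) ω) with hd
  have hD2 : MemLp D 2 μ := hH.memLp_blockDiff hξ (memLp_sumBlock hξ hf hf2 n) 0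
  have hd2 : ∀ j, MemLp (d j) 2 μ := fun j => hc.memLp_blockDiff hξ hg _
  have hDd : ∀ j, Integrable (fun ω => D ω * d j ω) μ := fun j => hD2.integrable_mul (hd2 j)
  have hdd : ∀ i j, Integrable (fun ω => d i ω * d j ω) μ := fun i j =>
    (hd2 i).integrable_mul (hd2 j)
  -- All products D d_j have the same integral and the products d_i d_j with i ≠ j have integral
  -- zero. For untruncated blocks this is Pythagoras, the bracket being the mean square of one
  -- block.
  have e : ∀ ω, (D ω - ∑ j ∈ Finset.range N, d j ω) ^ 2
      = D ω ^ 2 - 2 * ∑ j ∈ Finset.range N, D ω * d j ω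
        + ∑ i ∈ Finset.range N, ∑ j ∈ Finset.range N, d i ω * d j ω := by
    intro ω
    rw [← Finset.sum_mul_sum, ← Finset.mul_sum]; ring
  have h1 : Integrable (fun ω => 2 * ∑ j ∈ Finset.range N, D ω * d j ω) μ :=
    (integrable_finsetSum _ fun j _ => hDd j).const_mul 2
  have h2 : Integrable (fun ω => D ω ^ 2 - 2 * ∑ j ∈ Finset.range N, D ω * d j ω) μ :=
    hD2.integrable_sq.sub h1
  have h3 : Integrable (fun ω => ∑ i ∈ Finset.range N, ∑ j ∈ Finset.range N, d i ω * d j ω) μ :=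
    integrable_finsetSum _ fun i _ => integrable_finsetSum _ fun j _ => hdd i j
  have hs : ∀ j, ∫ ω, d j ω * d j ω ∂μ = ∫ ω, blockDiff g h (path ξ 0 ω) ^ 2 ∂μ := fun j => by
    rw [← (identDistrib_path hξ (hc.measurable_blockDiff.pow_const 2)
      ((j * m : ℕ) : ℤ) 0).integral_eq]
    exact integral_congr_ae (Eventually.of_forall fun ω => (pow_two _).symm)
  have hDj : ∀ j ∈ Finset.range N, ∫ ω, D ω * d j ω ∂μ
      = ∫ ω, segSum f m (path ξ 0 ω) * blockDiff g h (path ξ 0 ω) ∂μ := fun j hj =>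
    integral_blockDiff_sumBlock_mul hξ hf hf2 hc hg
      ((Nat.mul_le_mul_right m (Finset.mem_range.mp hj)).trans hN) hH
  refine (integral_congr_ae (Eventually.of_forall e)).trans ?_
  rw [integral_add h2 h3, integral_sub hD2.integrable_sq h1, integral_const_mul,
    integral_finsetSum _ fun j _ => hDd j, Finset.sum_congr rfl hDj,
    integral_finsetSum _ fun i _ => integrable_finsetSum _ fun j _ => hdd i j]
  have h4 : ∀ i ∈ Finset.range N, ∫ ω, ∑ j ∈ Finset.range N, d i ω * d j ω ∂μ
      = ∫ ω, blockDiff g h (path ξ 0 ω) ^ 2 ∂μ := by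
    intro i hi
    rw [integral_finsetSum _ fun j _ => hdd i j, Finset.sum_eq_single i, hs]
    · exact fun j _ hji => integral_blockDiff_mul_of_ne hξ hc hg (Ne.symm hji)
    · exact fun h => absurd hi h
  rw [Finset.sum_congr rfl h4]
  simp only [Finset.sum_const, Finset.card_range, nsmul_eq_mul]
  ring

omit [IsProbabilityMeasure μ] in
lemma tendsto_integral_sq_sub_clip {X : Ω → ℝ} (hX : MemLp X 2 μ) :
    Tendsto (fun K : ℕ => ∫ ω, (X ω - clip K (X ω)) ^ 2 ∂μ) atTop (𝓝 0) := by
  have : Tendsto (fun K : ℕ => ∫ ω, (X ω - clip K (X ω)) ^ 2 ∂μ) atTop (𝓝 (∫ _, (0 : ℝ) ∂μ)) := by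
    refine tendsto_integral_of_dominated_convergence (fun ω => X ω ^ 2) (fun K => ?_)
      hX.integrable_sq (fun K => Eventually.of_forall fun ω => ?_)
      (Eventually.of_forall fun ω => ?_)
    · exact (hX.aestronglyMeasurable.sub
        ((continuous_clip K).comp_aestronglyMeasurable hX.aestronglyMeasurable)).pow 2
    · rw [Real.norm_eq_abs, abs_pow, ← sq_abs (X ω)]
      exact pow_le_pow_left₀ (abs_nonneg _) (abs_sub_clip_le_abs (Nat.cast_nonneg K) _) 2
    · refine tendsto_const_nhds.congr' ?_
      filter_upwards [eventually_ge_atTop ⌈|X ω|⌉₊] with K hK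
      rw [clip_eq_self ((Nat.le_ceil _).trans (by exact_mod_cast hK))]
      simp
  simpa using this

/-- Bounded centred blocks approximate the centred block sums in mean square. -/
lemma exists_bounded_isCentering (hξ : IsStationaryMarkovChain μ ξ) (hf : Measurable f)
    (hf2 : MemLp f 2 (μ.map (ξ 0))) {H : S × S → ℝ} (hH : IsCentering μ ξ (sumBlock f m) H)
    {η : ℝ} (hη : 0 < η) :
    ∃ (K : ℝ) (g : (Fin (m + 1) → S) → ℝ) (h : S × S → ℝ), IsCentering μ ξ g h ∧
      (∀ x, |g x| ≤ K) ∧ (∀ y, |h y| ≤ K) ∧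
      |∫ ω, blockDiff g h (path ξ 0 ω) ^ 2 ∂μ
        - ∫ ω, blockDiff (sumBlock f m) H (path ξ 0 ω) ^ 2 ∂μ| ≤ η ∧
      ∫ ω, blockDiff (sumBlock f m) H (path ξ 0 ω) ^ 2 ∂μ - η
        ≤ 2 * ∫ ω, segSum f m (path ξ 0 ω) * blockDiff g h (path ξ 0 ω) ∂μ
            - ∫ ω, blockDiff g h (path ξ 0 ω) ^ 2 ∂μ := by
  set D : Ω → ℝ := fun ω => blockDiff (sumBlock f m) H (path ξ 0 ω) with hD
  have hS2 := memLp_segSum hξ hf hf2 m 0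
  have hD2 : MemLp D 2 μ := hH.memLp_blockDiff hξ (memLp_sumBlock hξ hf hf2 m) 0
  set A := ∫ ω, D ω ^ 2 ∂μ with hA
  have hA0 : 0 ≤ A := integral_nonneg fun _ => sq_nonneg _
  -- Chosen for |d² - D²| ≤ τ D² + (1 + 1/τ)(D - d)²: τ makes the first part integrate to at most
  -- η/2, and ρ bounds E(D - d)² so that the second does too.
  set τ : ℝ := η / (2 * (A + 1)) with hτ
  have hτ0 : 0 < τ := by positivity
  set ρ : ℝ := min η (η / 2 / (1 + 1 / τ)) with hρ
  have hρ0 : 0 < ρ := lt_min hη (by positivity)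
  obtain ⟨K, hK⟩ := ((tendsto_integral_sq_sub_clip hS2).eventually (gt_mem_nhds hρ0)).exists
  set g : (Fin (m + 1) → S) → ℝ := fun x => clip K (sumBlock f m x) with hgdef
  have hgm : Measurable g := (continuous_clip K).measurable.comp (measurable_sumBlock hf m)
  have hgK : ∀ x, |g x| ≤ K := fun x => abs_clip_le (Nat.cast_nonneg K) _
  obtain ⟨h, hc, hhK⟩ := exists_isCentering_of_bounded (μ := μ) (ξ := ξ) hgm hgK
  have hgS : ∀ ω, g (fun j => ξ (j : ℕ) ω) = clip K (segSum f m (path ξ 0 ω)) := fun ω => by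
    simp only [hgdef, sumBlock_path]
  have hg2 : MemLp (fun ω => g (fun j => ξ (j : ℕ) ω)) 2 μ := by
    refine MemLp.of_bound ?_ K (Eventually.of_forall fun ω => hgK _)
    simp_rw [hgS]
    exact (continuous_clip K).comp_aestronglyMeasurable hS2.aestronglyMeasurable
  set d : Ω → ℝ := fun ω => blockDiff g h (path ξ 0 ω) with hd
  have hd2 : MemLp d 2 μ := hc.memLp_blockDiff hξ hg2 0
  have hde : ∀ ω, d ω = clip K (segSum f m (path ξ 0 ω)) - h (ξ 0 ω, ξ m ω) := fun ω => by
    rw [← hgS]; simp [hd, blockDiff, path]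
  have hDe : ∀ ω, D ω = segSum f m (path ξ 0 ω) - H (ξ 0 ω, ξ m ω) := fun ω =>
    blockDiff_sumBlock m ω
  -- the error and its mean square
  set e : Ω → ℝ := fun ω => D ω - d ω with he
  have he2 : MemLp e 2 μ := hD2.sub hd2
  set u : Ω → ℝ := fun ω => H (ξ 0 ω, ξ m ω) - h (ξ 0 ω, ξ m ω) with hu
  have hu2 : MemLp u 2 μ :=
    (hH.memLp_right (memLp_sumBlock hξ hf hf2 m)).sub (hc.memLp_right hg2)
  have hum : StronglyMeasurable[past ξ 0 ⊔ future ξ (m + 0)] u := by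
    refine Measurable.stronglyMeasurable ((hH.measurable.sub hc.measurable).comp
      (Measurable.prodMk ?_ ?_))
    · exact Measurable.mono (comap_measurable _) ((comap_le_past le_rfl).trans le_sup_left) le_rfl
    · exact Measurable.mono (comap_measurable _)
        ((comap_le_future (by simp)).trans le_sup_right) le_rfl
  have hue : ∫ ω, u ω * e ω ∂μ = 0 := by
    have h1 := hH.integral_mul_blockDiff hξ (memLp_sumBlock hξ hf hf2 m) 0 hum hu2
    have h2 := hc.integral_mul_blockDiff hξ hg2 0 hum hu2
    have h3 := integral_sub (hu2.integrable_mul hD2) (hu2.integrable_mul hd2)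
    simp only [Pi.mul_apply] at h3
    simp_rw [he, mul_sub]
    rw [h3, h1, h2, sub_zero]
  set δ := ∫ ω, e ω ^ 2 ∂μ with hδ
  have hδ0 : 0 ≤ δ := integral_nonneg fun _ => sq_nonneg _
  have hδρ : δ ≤ ρ := by
    refine le_trans ?_ hK.le
    -- The truncation error is e + u with u a function of the endpoints, orthogonal to e. Centring
    -- therefore does not increase the mean square error.
    have h1 : ∀ ω, (segSum f m (path ξ 0 ω) - clip K (segSum f m (path ξ 0 ω))) ^ 2
        = e ω ^ 2 + 2 * (u ω * e ω) + u ω ^ 2 := fun ω => by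
      simp only [he, hu, hDe, hde]; ring
    have h2 : Integrable (fun ω => e ω ^ 2 + 2 * (u ω * e ω)) μ :=
      he2.integrable_sq.add ((hu2.integrable_mul he2).const_mul 2)
    have h3 : Integrable (fun ω => 2 * (u ω * e ω)) μ := (hu2.integrable_mul he2).const_mul 2
    simp_rw [h1]
    rw [integral_add h2 hu2.integrable_sq, integral_add he2.integrable_sq h3, integral_const_mul,
      hue]
    have : 0 ≤ ∫ ω, u ω ^ 2 ∂μ := integral_nonneg fun _ => sq_nonneg _
    linarith
  have hSd : ∫ ω, segSum f m (path ξ 0 ω) * d ω ∂μ = ∫ ω, D ω * d ω ∂μ := by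
    have := integral_blockDiff_sumBlock_mul hξ hf hf2 hc hg2 (n := m) (j := 0) (by simp) hH
    rw [← this]
    simp [hD, hd]
  refine ⟨K, g, h, hc, hgK, hhK, ?_, ?_⟩
  · have h1 : ∀ ω, |d ω ^ 2 - D ω ^ 2| ≤ τ * D ω ^ 2 + (1 + 1 / τ) * e ω ^ 2 := fun ω => by
      have h2 : d ω = D ω - e ω := by simp [he]
      have h3 : 0 ≤ (τ * D ω - e ω) ^ 2 / τ := by positivity
      have h4 : 0 ≤ (τ * D ω + e ω) ^ 2 / τ := by positivity
      have h5 : (τ * D ω - e ω) ^ 2 / τ = τ * D ω ^ 2 - 2 * D ω * e ω + 1 / τ * e ω ^ 2 := by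
        field_simp
        ring
      have h6 : (τ * D ω + e ω) ^ 2 / τ = τ * D ω ^ 2 + 2 * D ω * e ω + 1 / τ * e ω ^ 2 := by
        field_simp
        ring
      rw [h2, abs_le]
      constructor <;> nlinarith [sq_nonneg (e ω)]
    rw [← integral_sub hd2.integrable_sq hD2.integrable_sq]
    have hi : Integrable (fun ω => |d ω ^ 2 - D ω ^ 2|) μ :=
      (hd2.integrable_sq.sub hD2.integrable_sq).abs
    refine abs_integral_le_integral_abs.trans ((integral_mono hi
      ((hD2.integrable_sq.const_mul τ).add (he2.integrable_sq.const_mul _)) h1).trans ?_)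
    rw [integral_add' (hD2.integrable_sq.const_mul τ) (he2.integrable_sq.const_mul _),
      integral_const_mul, integral_const_mul]
    have h7 : τ * A ≤ η / 2 := by
      rw [hτ, div_mul_eq_mul_div, div_le_div_iff₀ (by positivity) (by norm_num)]
      nlinarith
    have h8 : (1 + 1 / τ) * δ ≤ η / 2 := by
      have := (hδρ.trans (min_le_right _ _))
      rw [le_div_iff₀ (by positivity)] at this
      linarith
    linarith
  · have h1 : ∀ ω, e ω ^ 2 = D ω ^ 2 - 2 * (D ω * d ω) + d ω ^ 2 := fun ω => by
      simp only [he]; ring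
    have h2 : Integrable (fun ω => 2 * (D ω * d ω)) μ := (hD2.integrable_mul hd2).const_mul 2
    have h3 : Integrable (fun ω => D ω ^ 2 - 2 * (D ω * d ω)) μ := hD2.integrable_sq.sub h2
    have h4 : δ = A - 2 * ∫ ω, D ω * d ω ∂μ + ∫ ω, d ω ^ 2 ∂μ := by
      rw [hδ]
      simp_rw [h1]
      rw [integral_add h3 hd2.integrable_sq, integral_sub hD2.integrable_sq h2, integral_const_mul]
    change A - η ≤ 2 * ∫ ω, segSum f m (path ξ 0 ω) * d ω ∂μ - ∫ ω, d ω ^ 2 ∂μ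
    rw [hSd]
    linarith [hδρ.trans (min_le_left _ _)]

/-- The partial sums are approximated, in mean at scale `√n`, by sums of bounded stationary blocks
that are martingale differences. -/
lemma exists_block_approximation (hξ : IsStationaryMarkovChain μ ξ)
    (hβ : IsAbsolutelyRegular μ ξ) (hf : Measurable f)
    (hf2 : MemLp f 2 (μ.map (ξ 0))) (hf0 : ∫ x, f x ∂(μ.map (ξ 0)) = 0) {C : ℝ}
    (hC : ∀ n : ℕ, ∫ ω, segSum f n (path ξ 0 ω) ^ 2 ∂μ ≤ C * n) :
    ∃ v : ℝ, 0 ≤ v ∧ ∀ ε : ℝ, 0 < ε → ∃ (m : ℕ) (K : ℝ) (g : (Fin (m + 1) → S) → ℝ)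
      (h : S × S → ℝ), 0 < m ∧ IsCentering μ ξ g h ∧ (∀ x, |g x| ≤ K) ∧ (∀ y, |h y| ≤ K) ∧
      |(∫ ω, blockDiff g h (path ξ 0 ω) ^ 2 ∂μ) / m - v| ≤ ε ∧
      ∀ᶠ n : ℕ in atTop, ∫ ω, |segSum f n (path ξ 0 ω)
        - ∑ j ∈ Finset.range (n / m), blockDiff g h (path ξ ((j * m : ℕ) : ℤ) ω)| ∂μ
          ≤ ε * √(n : ℝ) := by
  choose H hH using fun n => exists_isCentering (μ := μ) (ξ := ξ) (measurable_sumBlock hf n)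
  set a : ℕ → ℝ := fun n => ∫ ω, blockDiff (sumBlock f n) (H n) (path ξ 0 ω) ^ 2 ∂μ with ha
  have ha0 : ∀ n, 0 ≤ a n := fun n => integral_nonneg fun _ => sq_nonneg _
  have hS2 := fun n => memLp_segSum hξ hf hf2 n 0
  have hD2 : ∀ n, MemLp (fun ω => blockDiff (sumBlock f n) (H n) (path ξ 0 ω)) 2 μ := fun n =>
    (hH n).memLp_blockDiff hξ (memLp_sumBlock hξ hf hf2 n) 0
  have hH2 := fun n => (hH n).memLp_right (memLp_sumBlock hξ hf hf2 n)
  -- Subtracting the conditional expectation is an orthogonal projection and decreases the second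
  -- moment.
  have haC : ∀ n, a n ≤ C * n := by
    intro n
    refine le_trans ?_ (hC n)
    have hm : StronglyMeasurable[past ξ 0 ⊔ future ξ (n + 0)] fun ω => H n (ξ 0 ω, ξ n ω) := by
      refine Measurable.stronglyMeasurable ((hH n).measurable.comp (Measurable.prodMk ?_ ?_))
      · exact Measurable.mono (comap_measurable _) ((comap_le_past le_rfl).trans le_sup_left) le_rfl
      · exact Measurable.mono (comap_measurable _)
          ((comap_le_future (by simp)).trans le_sup_right) le_rfl
    have h0 := (hH n).integral_mul_blockDiff hξ (memLp_sumBlock hξ hf hf2 n) 0 hm (hH2 n)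
    have h1 : ∀ ω, segSum f n (path ξ 0 ω) ^ 2
        = blockDiff (sumBlock f n) (H n) (path ξ 0 ω) ^ 2
          + 2 * (H n (ξ 0 ω, ξ n ω) * blockDiff (sumBlock f n) (H n) (path ξ 0 ω))
          + H n (ξ 0 ω, ξ n ω) ^ 2 := fun ω => by
      rw [blockDiff_sumBlock]; ring
    have h3 : Integrable (fun ω => 2 * (H n (ξ 0 ω, ξ n ω) *
        blockDiff (sumBlock f n) (H n) (path ξ 0 ω))) μ :=
      ((hH2 n).integrable_mul (hD2 n)).const_mul 2
    have h2 : Integrable (fun ω => blockDiff (sumBlock f n) (H n) (path ξ 0 ω) ^ 2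
        + 2 * (H n (ξ 0 ω, ξ n ω) * blockDiff (sumBlock f n) (H n) (path ξ 0 ω))) μ :=
      (hD2 n).integrable_sq.add h3
    simp_rw [h1]
    rw [integral_add h2 (hH2 n).integrable_sq, integral_add (hD2 n).integrable_sq h3,
      integral_const_mul, h0]
    have : 0 ≤ ∫ ω, H n (ξ 0 ω, ξ n ω) ^ 2 ∂μ := integral_nonneg fun _ => sq_nonneg _
    linarith
  have hbdd : BddAbove (Set.range fun n : ℕ => a (n + 1) / ((n + 1 : ℕ) : ℝ)) := by
    refine ⟨C, ?_⟩
    rintro _ ⟨n, rfl⟩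
    change a (n + 1) / ((n + 1 : ℕ) : ℝ) ≤ C
    rw [div_le_iff₀ (by positivity)]
    exact haC _
  set v : ℝ := ⨆ n : ℕ, a (n + 1) / ((n + 1 : ℕ) : ℝ) with hv
  have hav : ∀ n : ℕ, 0 < n → a n ≤ v * n := by
    intro n hn
    obtain ⟨k, rfl⟩ := Nat.exists_eq_succ_of_ne_zero hn.ne'
    have := le_ciSup hbdd k
    rwa [div_le_iff₀ (by positivity)] at this
  have hv0 : 0 ≤ v := by
    have := (ha0 1).trans (hav 1 one_pos)
    simpa using this
  refine ⟨v, hv0, fun ε hε => ?_⟩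
  -- The first bound serves |s / m - v| ≤ 2ε' ≤ ε, where s is the mean square of a truncated block.
  -- The second serves the L² error: 2ε' n ≤ ε² n / 8 from near-extremality and truncation, plus v m
  -- ≤ ε² n / 8 for the incomplete last block.
  set ε' : ℝ := min (ε / 2) (ε ^ 2 / 16) with hε'
  have hε'0 : 0 < ε' := lt_min (by positivity) (by positivity)
  obtain ⟨k, hk⟩ := exists_lt_of_lt_ciSup (sub_lt_self v hε'0)
  set m := k + 1 with hm
  have hm0 : (0 : ℝ) < m := by positivity
  have hm1 : (1 : ℝ) ≤ m := by rw [hm]; push_cast; linarith [Nat.cast_nonneg (α := ℝ) k]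
  rw [lt_div_iff₀ hm0] at hk
  obtain ⟨K, g, h, hc, hgK, hhK, hs, hcs⟩ := exists_bounded_isCentering hξ hf hf2 (hH m) hε'0
  refine ⟨m, K, g, h, Nat.succ_pos k, hc, hgK, hhK, ?_, ?_⟩
  · rw [div_sub' hm0.ne', abs_div, abs_of_pos hm0, div_le_iff₀ hm0]
    have h1 := hav m (Nat.succ_pos k)
    have h2 := abs_le.mp hs
    have h3 := min_le_left (ε / 2) (ε ^ 2 / 16)
    rw [abs_le]
    constructor <;> nlinarith
  have hg2 : MemLp (fun ω => g (fun j => ξ (j : ℕ) ω)) 2 μ :=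
    MemLp.of_bound (hc.measurable_left.comp
      (measurable_pi_lambda _ fun _ => hξ.measurable _)).aestronglyMeasurable K
      (Eventually.of_forall fun ω => hgK _)
  have hlarge : ∀ᶠ n : ℕ in atTop, 8 * v * m / ε ^ 2 ≤ n :=
    tendsto_natCast_atTop_atTop.eventually_ge_atTop _
  filter_upwards [eventually_integral_abs_endpoint_le hξ hβ hf hf2 hf0 hC (half_pos hε), hlarge,
    eventually_gt_atTop 0] with n hn1 hn2 hn0
  have hn0' : (0 : ℝ) < n := by exact_mod_cast hn0
  set N := n / m with hN
  have hNm : N * m ≤ n := Nat.div_mul_le_self n m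
  have hNm' : (n : ℝ) ≤ N * m + m := by
    have := Nat.lt_div_mul_add (Nat.succ_pos k) (a := n)
    exact_mod_cast this.le
  have hNn : (N : ℝ) ≤ n := by exact_mod_cast Nat.div_le_self n m
  set Q : Ω → ℝ := fun ω => ∑ j ∈ Finset.range N, blockDiff g h (path ξ ((j * m : ℕ) : ℤ) ω) with hQ
  set D : Ω → ℝ := fun ω => blockDiff (sumBlock f n) (H n) (path ξ 0 ω) with hD
  have hQ2 : MemLp Q 2 μ := memLp_finsetSum _ fun j _ => hc.memLp_blockDiff hξ hg2 _
  have hDQ : MemLp (fun ω => D ω - Q ω) 2 μ := (hD2 n).sub hQ2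
  have hsq := integral_sq_blockDiff_sub_sum hξ hf hf2 hc hg2 hNm (hH n)
  have hb : ∫ ω, (D ω - Q ω) ^ 2 ∂μ ≤ (ε / 2 * √(n : ℝ)) ^ 2 := by
    rw [mul_pow, Real.sq_sqrt hn0'.le]
    refine hsq.le.trans ?_
    have h1 := hav n hn0
    have h2 : (N : ℝ) * (a m - ε') ≤ N * (2 * ∫ ω, segSum f m (path ξ 0 ω) *
        blockDiff g h (path ξ 0 ω) ∂μ - ∫ ω, blockDiff g h (path ξ 0 ω) ^ 2 ∂μ) :=
      mul_le_mul_of_nonneg_left hcs (Nat.cast_nonneg _)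
    have h3 : (N : ℝ) * ((v - ε') * m) ≤ N * a m :=
      mul_le_mul_of_nonneg_left hk.le (Nat.cast_nonneg _)
    have h4 : v * n ≤ v * (N * m + m) := mul_le_mul_of_nonneg_left hNm' hv0
    have h5 : ε' * (N * m) ≤ ε' * n :=
      mul_le_mul_of_nonneg_left (by exact_mod_cast hNm) hε'0.le
    have h6 : ε' * N ≤ ε' * n := mul_le_mul_of_nonneg_left hNn hε'0.le
    have h7 : ε' * n ≤ ε ^ 2 / 16 * n := mul_le_mul_of_nonneg_right (min_le_right _ _) hn0'.le
    rw [div_le_iff₀ (by positivity)] at hn2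
    have h8 : a n - N * (2 * ∫ ω, segSum f m (path ξ 0 ω) *
        blockDiff g h (path ξ 0 ω) ∂μ - ∫ ω, blockDiff g h (path ξ 0 ω) ^ 2 ∂μ)
        ≤ ε' * (N * m) + v * m + ε' * N := by nlinarith
    refine h8.trans ?_
    nlinarith
  have hb1 : ∫ ω, |D ω - Q ω| ∂μ ≤ ε / 2 * √(n : ℝ) :=
    abs_le_of_sq_le_sq' ((sq_integral_abs_le hDQ).trans hb) (by positivity) |>.2
  have hHi : Integrable (fun ω => |H n (ξ 0 ω, ξ n ω)|) μ :=
    ((hH2 n).integrable (by norm_num)).abs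
  have hDQi : Integrable (fun ω => |D ω - Q ω|) μ := (hDQ.integrable (by norm_num)).abs
  have hle : ∀ ω, |segSum f n (path ξ 0 ω) - Q ω| ≤ |H n (ξ 0 ω, ξ n ω)| + |D ω - Q ω| := by
    intro ω
    have : segSum f n (path ξ 0 ω) - Q ω = H n (ξ 0 ω, ξ n ω) + (D ω - Q ω) := by
      simp only [hD, blockDiff_sumBlock]; ring
    rw [this]
    exact abs_add_le _ _
  have hSQ : Integrable (fun ω => |segSum f n (path ξ 0 ω) - Q ω|) μ :=
    (((hS2 n).sub hQ2).integrable (by norm_num)).abs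
  have := integral_mono hSQ (hHi.add hDQi) hle
  simp only [Pi.add_apply] at this
  rw [integral_add hHi hDQi] at this
  linarith [hn1 (H n) (hH n)]

end BlockApproximation

/-! ### Mean law of large numbers from decaying covariances. -/

section LawOfLargeNumbers

variable {Ω : Type*} {mΩ : MeasurableSpace Ω} {μ : Measure Ω} [IsProbabilityMeasure μ]

/-- A mean law of large numbers for bounded variables whose covariances vanish uniformly as the
gap between the indices grows. -/
lemma tendsto_integral_abs_average {Z : ℕ → Ω → ℝ} (hZ : ∀ j, Measurable (Z j)) {B : ℝ}
    (hB : ∀ j ω, |Z j ω| ≤ B)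
    (hcov : ∀ ε : ℝ, 0 < ε → ∃ J : ℕ, ∀ i j, i + J ≤ j → |∫ ω, Z i ω * Z j ω ∂μ| ≤ ε) :
    Tendsto (fun N : ℕ => ∫ ω, |(∑ j ∈ Finset.range N, Z j ω) / N| ∂μ) atTop (𝓝 0) := by
  obtain ⟨ω₀⟩ : Nonempty Ω := μ.nonempty_of_neZero
  have hB0 : 0 ≤ B := (abs_nonneg _).trans (hB 0 ω₀)
  have hZZ : ∀ i j, Integrable (fun ω => Z i ω * Z j ω) μ := fun i j =>
    Integrable.of_bound ((hZ i).mul (hZ j)).aestronglyMeasurable (B * B)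
      (Eventually.of_forall fun ω => by
        rw [norm_mul]; exact mul_le_mul (hB i ω) (hB j ω) (norm_nonneg _) hB0)
  have hZZb : ∀ i j, |∫ ω, Z i ω * Z j ω ∂μ| ≤ B ^ 2 := fun i j => by
    rw [← Real.norm_eq_abs]
    refine (norm_integral_le_of_norm_le_const (C := B ^ 2) (Eventually.of_forall fun ω => ?_)).trans
      (le_of_eq (by rw [probReal_univ, mul_one]))
    rw [norm_mul, pow_two]
    exact mul_le_mul (hB i ω) (hB j ω) (norm_nonneg _) hB0
  rw [Metric.tendsto_atTop]
  intro η hη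
  obtain ⟨J, hJ⟩ := hcov (η ^ 2 / 4) (by positivity)
  obtain ⟨N₀, hN₀⟩ := exists_nat_gt (2 * J * B ^ 2 / (η ^ 2 / 4))
  refine ⟨N₀ + 1, fun N hN => ?_⟩
  have hN0 : (0 : ℝ) < N := by exact_mod_cast (by omega : 0 < N)
  have hNJ : 2 * J * B ^ 2 ≤ η ^ 2 / 4 * N := by
    rw [div_lt_iff₀ (by positivity)] at hN₀
    have : (N₀ : ℝ) ≤ N := by exact_mod_cast (by omega : N₀ ≤ N)
    nlinarith [sq_nonneg η]
  set X : Ω → ℝ := fun ω => (∑ j ∈ Finset.range N, Z j ω) / N with hX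
  have hX2 : MemLp X 2 μ := by
    have h1 : MemLp (fun ω => ∑ j ∈ Finset.range N, Z j ω) 2 μ := memLp_finsetSum _ fun j _ =>
      MemLp.of_bound (hZ j).aestronglyMeasurable B (Eventually.of_forall (hB j))
    simp only [hX, div_eq_mul_inv]
    exact h1.mul_const _
  -- Each row has at most 2J near-diagonal entries, bounded by B²; every other entry has a gap of at
  -- least J. The truncated subtraction i - J is harmless here.
  have hterm : ∀ i j, ∫ ω, Z i ω * Z j ω ∂μ
      ≤ η ^ 2 / 4 + if j ∈ Finset.Ico (i - J) (i + J) then B ^ 2 else 0 := by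
    intro i j
    split_ifs with h
    · have := (le_abs_self _).trans (hZZb i j)
      nlinarith [sq_nonneg η]
    · rw [add_zero]
      refine (le_abs_self _).trans ?_
      rw [Finset.mem_Ico] at h
      rcases lt_or_ge j (i + J) with h1 | h1
      · simp_rw [mul_comm (Z i _)]
        exact hJ j i (by omega)
      · exact hJ i j h1
  have hsum : ∫ ω, X ω ^ 2 ∂μ ≤ η ^ 2 / 2 := by
    have e : ∀ ω, X ω ^ 2
        = (∑ i ∈ Finset.range N, ∑ j ∈ Finset.range N, Z i ω * Z j ω) / (N : ℝ) ^ 2 := fun ω => by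
      rw [hX, div_pow, pow_two (∑ j ∈ Finset.range N, Z j ω), Finset.sum_mul_sum]
    refine (integral_congr_ae (Eventually.of_forall e)).trans_le ?_
    rw [integral_div, integral_finsetSum _ fun i _ => integrable_finsetSum _ fun j _ => hZZ i j,
      div_le_iff₀ (by positivity)]
    have h1 : ∀ i ∈ Finset.range N, ∫ ω, ∑ j ∈ Finset.range N, Z i ω * Z j ω ∂μ
        ≤ N * (η ^ 2 / 4) + 2 * J * B ^ 2 := by
      intro i _
      rw [integral_finsetSum _ fun j _ => hZZ i j]
      refine (Finset.sum_le_sum fun j _ => hterm i j).trans ?_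
      rw [Finset.sum_add_distrib, Finset.sum_const, Finset.card_range, nsmul_eq_mul,
        ← Finset.sum_filter, Finset.sum_const, nsmul_eq_mul]
      refine add_le_add le_rfl (mul_le_mul_of_nonneg_right ?_ (sq_nonneg B))
      have : (Finset.filter (fun j => j ∈ Finset.Ico (i - J) (i + J)) (Finset.range N)).card
          ≤ (Finset.Ico (i - J) (i + J)).card :=
        Finset.card_le_card fun j hj => (Finset.mem_filter.mp hj).2
      rw [Nat.card_Ico] at this
      have h2 : i + J - (i - J) ≤ 2 * J := by omega
      exact_mod_cast this.trans h2
    refine (Finset.sum_le_sum h1).trans ?_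
    rw [Finset.sum_const, Finset.card_range, nsmul_eq_mul]
    nlinarith
  rw [Real.dist_eq, sub_zero, abs_of_nonneg (integral_nonneg fun _ => abs_nonneg _)]
  refine lt_of_pow_lt_pow_left₀ 2 hη.le (((sq_integral_abs_le hX2).trans hsum).trans_lt ?_)
  linarith [pow_pos hη 2]

end LawOfLargeNumbers

/-! ### Central limit theorem for the bounded blocks. -/

section BlockCLT

variable {Ω S : Type*} {mΩ : MeasurableSpace Ω} [mS : MeasurableSpace S] {μ : Measure Ω}
  [IsProbabilityMeasure μ] {ξ : ℤ → Ω → S} {m : ℕ} {g : (Fin (m + 1) → S) → ℝ} {h : S × S → ℝ}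

lemma tendsto_average_sq_blockDiff (hξ : IsStationaryMarkovChain μ ξ)
    (hβ : IsAbsolutelyRegular μ ξ) (hm : 0 < m) (hc : IsCentering μ ξ g h) {K : ℝ}
    (hgK : ∀ x, |g x| ≤ K) (hhK : ∀ y, |h y| ≤ K) :
    Tendsto (fun N : ℕ => ∫ ω, |(∑ j ∈ Finset.range N,
        blockDiff g h (path ξ ((j * m : ℕ) : ℤ) ω) ^ 2) / N
          - ∫ ω, blockDiff g h (path ξ 0 ω) ^ 2 ∂μ| ∂μ) atTop (𝓝 0) := by
  set v := ∫ ω, blockDiff g h (path ξ 0 ω) ^ 2 ∂μ with hv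
  obtain ⟨ω₀⟩ : Nonempty Ω := μ.nonempty_of_neZero
  have hK0 : 0 ≤ K := (abs_nonneg _).trans (hhK (ξ 0 ω₀, ξ 0 ω₀))
  have hdK : ∀ x, |blockDiff g h x| ≤ 2 * K := fun x =>
    (abs_sub _ _).trans (by linarith [hgK fun j => x (j : ℕ), hhK (x 0, x m)])
  set z : (ℤ → S) → ℝ := fun x => blockDiff g h x ^ 2 - v with hz
  set B : ℝ := (2 * K) ^ 2 + |v| with hB
  have hB0 : 0 ≤ B := by positivity
  have hzm : Measurable z := (hc.measurable_blockDiff.pow_const 2).sub_const v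
  have hzB : ∀ x, |z x| ≤ B := fun x => by
    refine (abs_sub _ _).trans (add_le_add ?_ le_rfl)
    rw [abs_pow]
    exact pow_le_pow_left₀ (abs_nonneg _) (hdK x) 2
  have hzw : ∀ k, StronglyMeasurable[window ξ k (m + k)] fun ω => z (path ξ k ω) := fun k =>
    ((hc.stronglyMeasurable_blockDiff k).pow 2).sub stronglyMeasurable_const
  have hd2 : Integrable (fun ω => blockDiff g h (path ξ 0 ω) ^ 2) μ :=
    Integrable.of_bound ((hc.measurable_blockDiff.pow_const 2).comp
      (measurable_path hξ.measurable 0)).aestronglyMeasurable ((2 * K) ^ 2)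
      (Eventually.of_forall fun ω => by
        rw [norm_pow]; exact pow_le_pow_left₀ (norm_nonneg _) (hdK _) 2)
  have hz0 : ∀ k, ∫ ω, z (path ξ k ω) ∂μ = 0 := fun k => by
    rw [(identDistrib_path hξ hzm k 0).integral_eq]
    simp only [hz]
    rw [integral_sub hd2 (integrable_const _)]
    simp [hv]
  have := tendsto_integral_abs_average (μ := μ) (Z := fun j ω => z (path ξ ((j * m : ℕ) : ℤ) ω))
    (fun j => hzm.comp (measurable_path hξ.measurable _)) (fun j ω => hzB _) ?_
  · refine this.congr' ?_
    filter_upwards [eventually_gt_atTop 0] with N hN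
    refine integral_congr_ae (Eventually.of_forall fun ω => ?_)
    have hN0 : (N : ℝ) ≠ 0 := by exact_mod_cast hN.ne'
    simp only [hz, Finset.sum_sub_distrib, Finset.sum_const, Finset.card_range, nsmul_eq_mul]
    congr 1
    field_simp
  intro ε hε
  obtain ⟨n, ν, _, hν, hmix⟩ := exists_mixesWith hξ.measurable hβ (ε := ε / (4 * (B + 1) ^ 2))
    (by positivity)
  -- The extra block makes room for a shift that puts the first block on [-m, 0], in the past of 0;
  -- the second then starts at (n + l) m ≥ n.
  refine ⟨n + 1, fun i j hij => ?_⟩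
  obtain ⟨l, rfl⟩ := Nat.exists_eq_add_of_le hij
  have hF : Measurable fun x : ℤ → S => z x * z fun k => x (k + (((n + 1 + l) * m : ℕ) : ℤ)) :=
    hzm.mul (hzm.comp (measurable_pi_lambda _ fun k => measurable_pi_apply _))
  have e : ∀ a b : ℤ, b = a + (((n + 1 + l) * m : ℕ) : ℤ) →
      ∫ ω, z (path ξ a ω) * z (path ξ b ω) ∂μ
        = ∫ ω, (fun x : ℤ → S => z x * z fun k => x (k + (((n + 1 + l) * m : ℕ) : ℤ)))
          (path ξ a ω) ∂μ := by
    rintro a _ rfl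
    refine integral_congr_ae (Eventually.of_forall fun ω => ?_)
    have : path ξ (a + (((n + 1 + l) * m : ℕ) : ℤ)) ω
        = fun k => path ξ a ω (k + (((n + 1 + l) * m : ℕ) : ℤ)) := by
      funext k
      simp only [path]
      congr 1; ring
    simp only [this]
  rw [e _ _ (by push_cast; ring), (identDistrib_path hξ hF _ (-(m : ℤ))).integral_eq,
    ← e (-(m : ℤ)) (((n + l) * m : ℕ) : ℤ) (by push_cast; ring)]
  have h1 := hmix.abs_integral_mul_sub_le hξ.measurable hB0 hB0
    (φ := fun ω => z (path ξ (-(m : ℤ)) ω)) (ψ := fun ω => z (path ξ (((n + l) * m : ℕ) : ℤ) ω))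
    ((hzw _).mono (window_le_past (by omega))) (fun ω => hzB _)
    ((hzw _).mono (window_le_future (by
      have : n * 1 ≤ (n + l) * m := Nat.mul_le_mul (by omega) hm
      exact_mod_cast (by omega : n ≤ (n + l) * m)))) (fun ω => hzB _)
  rw [hz0, zero_mul, sub_zero] at h1
  refine h1.trans ?_
  rw [le_div_iff₀ (by positivity)] at hν
  nlinarith [measureReal_nonneg (μ := ν) (s := Set.univ)]

/-- The central limit theorem for sums of bounded centred blocks. -/
lemma tendsto_integral_exp_sum_blockDiff (hξ : IsStationaryMarkovChain μ ξ)
    (hβ : IsAbsolutelyRegular μ ξ) (hm : 0 < m) (hc : IsCentering μ ξ g h) {K : ℝ}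
    (hgK : ∀ x, |g x| ≤ K) (hhK : ∀ y, |h y| ≤ K) (t : ℝ) :
    Tendsto (fun N : ℕ => ∫ ω, Complex.exp ((t * ((∑ j ∈ Finset.range N,
        blockDiff g h (path ξ ((j * m : ℕ) : ℤ) ω)) / √N) : ℝ) * Complex.I) ∂μ) atTop
      (𝓝 (Complex.exp (-(t ^ 2 * (∫ ω, blockDiff g h (path ξ 0 ω) ^ 2 ∂μ) / 2 : ℝ)))) := by
  have hg2 : MemLp (fun ω => g (fun j => ξ (j : ℕ) ω)) 2 μ :=
    MemLp.of_bound (hc.measurable_left.comp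
      (measurable_pi_lambda _ fun _ => hξ.measurable _)).aestronglyMeasurable K
      (Eventually.of_forall fun ω => hgK _)
  -- The filtration is the past sampled at multiples of m: earlier blocks have ended by time j m,
  -- and centring given past and future implies centring given the past alone.
  refine tendsto_integral_exp_of_bounded_martingale_differences (K := 2 * K)
    (𝓕 := fun j => past ξ ((j * m : ℕ) : ℤ)) (fun j => past_le hξ.measurable _) (fun i j hij => ?_)
    (fun j => ?_) (fun j ω => ?_) (tendsto_average_sq_blockDiff hξ hβ hm hc hgK hhK) t
  · refine (hc.stronglyMeasurable_blockDiff _).mono (window_le_past ?_)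
    have : (i + 1) * m ≤ j * m := Nat.mul_le_mul_right m hij
    rw [add_mul, one_mul] at this
    exact_mod_cast (by omega : m + i * m ≤ j * m)
  · exact condExp_eq_zero_mono le_sup_left
      (sup_le (past_le hξ.measurable _) (future_le hξ.measurable _))
      ((hc.memLp_blockDiff hξ hg2 _).integrable (by norm_num)) (hc.condExp_blockDiff hξ hg2 _)
  · exact (abs_sub _ _).trans (by
      linarith [hgK fun i => path ξ ((j * m : ℕ) : ℤ) ω (i : ℕ),
        hhK (path ξ ((j * m : ℕ) : ℤ) ω 0, path ξ ((j * m : ℕ) : ℤ) ω m)])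

end BlockCLT

/-! ### Characteristic functions and first absolute moments. -/

section Limits

variable {Ω : Type*} {mΩ : MeasurableSpace Ω} {μ : Measure Ω} [IsProbabilityMeasure μ]

lemma norm_exp_mul_I_sub_le (x y : ℝ) :
    ‖Complex.exp (x * Complex.I) - Complex.exp (y * Complex.I)‖ ≤ |x - y| := by
  have e : Complex.exp (x * Complex.I) - Complex.exp (y * Complex.I)
      = Complex.exp (y * Complex.I) * (Complex.exp (Complex.I * ((x - y : ℝ) : ℂ)) - 1) := by
    rw [mul_sub, ← Complex.exp_add, mul_one]
    congr 2
    push_cast; ring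
  rw [e, norm_mul, Complex.norm_exp_ofReal_mul_I, one_mul]
  exact Real.norm_exp_I_mul_ofReal_sub_one_le

lemma norm_integral_exp_sub_le {X Y : Ω → ℝ} (hX : Integrable X μ) (hY : Integrable Y μ) (t : ℝ) :
    ‖∫ ω, Complex.exp ((t * X ω : ℝ) * Complex.I) ∂μ
      - ∫ ω, Complex.exp ((t * Y ω : ℝ) * Complex.I) ∂μ‖ ≤ |t| * ∫ ω, |X ω - Y ω| ∂μ := by
  have hi : ∀ {X : Ω → ℝ}, Integrable X μ →
      Integrable (fun ω => Complex.exp ((t * X ω : ℝ) * Complex.I)) μ := by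
    intro X hX
    refine Integrable.of_bound (C := 1) ?_ (Eventually.of_forall fun ω => by
      rw [Complex.norm_exp_ofReal_mul_I])
    have hc : Continuous fun x : ℝ => Complex.exp ((t * x : ℝ) * Complex.I) := by fun_prop
    exact hc.comp_aestronglyMeasurable hX.aestronglyMeasurable
  rw [← integral_sub (hi hX) (hi hY), ← integral_const_mul]
  refine norm_integral_le_of_norm_le ((hX.sub hY).abs.const_mul _)
    (Eventually.of_forall fun ω => ?_)
  refine (norm_exp_mul_I_sub_le _ _).trans (le_of_eq ?_)
  rw [← mul_sub, abs_mul]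

lemma abs_exp_neg_sub_le {x y : ℝ} (hx : 0 ≤ x) (hy : 0 ≤ y) :
    |Real.exp (-x) - Real.exp (-y)| ≤ |x - y| := by
  have key : ∀ {x y : ℝ}, 0 ≤ x → x ≤ y → |Real.exp (-x) - Real.exp (-y)| ≤ |x - y| := by
    intro x y hx hxy
    rw [abs_of_nonneg (sub_nonneg.mpr (Real.exp_le_exp.mpr (by linarith))),
      abs_of_nonpos (by linarith)]
    have h1 : Real.exp (-y) = Real.exp (-x) * Real.exp (x - y) := by
      rw [← Real.exp_add]; congr 1; ring
    have h2 := Real.add_one_le_exp (x - y)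
    have h3 : Real.exp (-x) ≤ 1 := Real.exp_le_one_iff.mpr (by linarith)
    have h4 := Real.exp_pos (-x)
    rw [h1]
    nlinarith
  rcases le_total x y with h | h
  · exact key hx h
  · rw [abs_sub_comm, abs_sub_comm x y]; exact key hy h

lemma integral_abs_sub_min_le {X : Ω → ℝ} (hX : MemLp X 2 μ) {V K : ℝ} (hK : 0 < K)
    (hV : ∫ ω, X ω ^ 2 ∂μ ≤ V) :
    |∫ ω, |X ω| ∂μ - ∫ ω, min |X ω| K ∂μ| ≤ V / K := by
  have hXi : Integrable (fun ω => |X ω|) μ := (hX.integrable (by norm_num)).abs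
  have hmi : Integrable (fun ω => min |X ω| K) μ := hXi.inf (integrable_const K)
  rw [← integral_sub hXi hmi]
  refine abs_integral_le_integral_abs.trans ?_
  have hle : ∀ ω, |(|X ω| - min |X ω| K)| ≤ X ω ^ 2 / K := fun ω => by
    rw [← sq_abs (X ω)]
    rcases le_total |X ω| K with h | h
    · rw [min_eq_left h, sub_self, abs_zero]; positivity
    · rw [min_eq_right h, abs_of_nonneg (by linarith), le_div_iff₀ hK]
      nlinarith [sq_nonneg (|X ω| - K)]
  refine (integral_mono (hXi.sub hmi).abs (hX.integrable_sq.div_const K) hle).trans ?_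
  rw [integral_div]
  gcongr

/-- Convergence in distribution with bounded second moments gives convergence of the first absolute
moments. -/
lemma tendsto_integral_abs_of_tendstoInDistribution {Ω' : Type*} {mΩ' : MeasurableSpace Ω'}
    {μ' : Measure Ω'} [IsProbabilityMeasure μ'] {X : ℕ → Ω → ℝ} {Z : Ω' → ℝ}
    (h : TendstoInDistribution X atTop Z (fun _ => μ) μ') (hX : ∀ n, MemLp (X n) 2 μ)
    (hZ : MemLp Z 2 μ') {V : ℝ} (hV : ∀ n, ∫ ω, X n ω ^ 2 ∂μ ≤ V) :
    Tendsto (fun n => ∫ ω, |X n ω| ∂μ) atTop (𝓝 (∫ ω, |Z ω| ∂μ')) := by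
  set W : ℝ := max V (∫ ω, Z ω ^ 2 ∂μ') with hW
  have hW0 : 0 ≤ W := (integral_nonneg fun _ => sq_nonneg _).trans (le_max_right _ _)
  rw [Metric.tendsto_atTop]
  intro ε hε
  set K : ℝ := 3 * (W + 1) / ε with hK
  have hK0 : 0 < K := by positivity
  have hWK : W / K < ε / 3 := by
    rw [div_lt_iff₀ hK0, hK]
    field_simp
    linarith
  -- Weak convergence is tested on min(|x|, K); bounded second moments make the replacement of |x|
  -- cost at most W / K < ε / 3 on either side.
  let φ : BoundedContinuousFunction ℝ ℝ := BoundedContinuousFunction.ofNormedAddCommGroup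
    (fun x : ℝ => min |x| K) (continuous_abs.min continuous_const) K (fun x => by
      rw [Real.norm_eq_abs, abs_of_nonneg (le_min (abs_nonneg _) hK0.le)]
      exact min_le_right _ _)
  have hφ := (ProbabilityMeasure.tendsto_iff_forall_integral_tendsto.mp h.tendsto) φ
  simp only [ProbabilityMeasure.coe_mk] at hφ
  rw [integral_map h.aemeasurable_limit φ.continuous.aestronglyMeasurable] at hφ
  have e : ∀ n, ∫ x, φ x ∂(μ.map (X n)) = ∫ ω, min |X n ω| K ∂μ := fun n => by
    rw [integral_map (h.forall_aemeasurable n) φ.continuous.aestronglyMeasurable]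
    rfl
  simp_rw [e] at hφ
  obtain ⟨N, hN⟩ := Metric.tendsto_atTop.mp hφ (ε / 3) (by positivity)
  refine ⟨N, fun n hn => ?_⟩
  have h1 := hN n hn
  have h2 := integral_abs_sub_min_le (hX n) hK0 ((hV n).trans (le_max_left _ _) : _ ≤ W)
  have h3 := integral_abs_sub_min_le hZ hK0 (le_max_right _ _ : _ ≤ W)
  rw [Real.dist_eq] at h1 ⊢
  change |_ - ∫ ω, min |Z ω| K ∂μ'| < _ at h1
  rw [abs_lt] at h1 ⊢
  rw [abs_le] at h2 h3
  constructor <;> linarith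

/-- The mean of |N(0, v)| is √(2v/π), which explains the constant π/2 in the theorem. The degenerate
law v = 0 is included. -/
lemma pi_mul_sq_integral_abs_gaussianReal (v : ℝ≥0) :
    Real.pi * (∫ x, |x| ∂(gaussianReal 0 v)) ^ 2 / 2 = v := by
  rcases eq_or_ne v 0 with rfl | hv
  · simp [gaussianReal_zero_var]
  have hv0 : (0 : ℝ) < v := by
    have := pos_iff_ne_zero.mpr hv
    exact_mod_cast this
  have h1 : ∫ x in Set.Ioi (0 : ℝ), x * Real.exp (-(1 / (2 * v)) * x ^ 2) = v := by
    have := integral_rpow_mul_exp_neg_mul_rpow (p := 2) (q := 1) (b := 1 / (2 * (v : ℝ)))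
      (by norm_num) (by norm_num) (by positivity)
    norm_num at this
    refine Eq.trans (setIntegral_congr_fun measurableSet_Ioi fun x _ => ?_) (this.trans ?_)
    · congr 2; field_simp
    · rw [Real.rpow_neg_one]; field_simp
  have h2 : ∫ x, |x| ∂(gaussianReal 0 v) = (√(2 * Real.pi * v))⁻¹ * (2 * v) := by
    rw [integral_gaussianReal_eq_integral_smul hv]
    have e : ∀ x : ℝ, gaussianPDFReal 0 v x • |x|
        = (√(2 * Real.pi * v))⁻¹ * (|x| * Real.exp (-(1 / (2 * v)) * |x| ^ 2)) := fun x => by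
      rw [gaussianPDFReal, smul_eq_mul, sq_abs, sub_zero]
      rw [show -x ^ 2 / (2 * (v : ℝ)) = -(1 / (2 * v)) * x ^ 2 by ring]
      ring
    simp_rw [e]
    rw [integral_const_mul, integral_comp_abs (f := fun x : ℝ =>
      x * Real.exp (-(1 / (2 * (v : ℝ))) * x ^ 2)), h1]
  rw [h2, mul_pow, inv_pow, Real.sq_sqrt (by positivity)]
  field_simp

end Limits

/-! ### From block sums to partial sums. -/

section CLT

variable {Ω S : Type*} {mΩ : MeasurableSpace Ω} [mS : MeasurableSpace S] {μ : Measure Ω}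
  [IsProbabilityMeasure μ] {ξ : ℤ → Ω → S} {f : S → ℝ}

/-- Replacing the normalisation `√n` by `√(N m)`, with `N = n / m`, is harmless. -/
lemma tendsto_sqrt_mul_div_sub_one {m : ℕ} (hm : 0 < m) :
    Tendsto (fun n : ℕ => √(n : ℝ) / √(((n / m : ℕ) : ℝ) * m)) atTop (𝓝 1) := by
  have hN : Tendsto (fun n : ℕ => n / m) atTop atTop := Nat.tendsto_div_const_atTop hm.ne'
  have h1 : Tendsto (fun n : ℕ => 1 + (((n / m : ℕ) : ℝ))⁻¹) atTop (𝓝 1) := by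
    have := (tendsto_inv_atTop_zero.comp (tendsto_natCast_atTop_atTop (R := ℝ) |>.comp hN)).const_add
      (1 : ℝ)
    simpa using this
  refine tendsto_of_tendsto_of_tendsto_of_le_of_le' tendsto_const_nhds h1 ?_ ?_
  · filter_upwards [hN.eventually_gt_atTop 0] with n hn
    have hpos : (0 : ℝ) < ((n / m : ℕ) : ℝ) * m := by positivity
    rw [le_div_iff₀ (Real.sqrt_pos.mpr hpos), one_mul]
    exact Real.sqrt_le_sqrt (by exact_mod_cast Nat.div_mul_le_self n m)
  · filter_upwards [hN.eventually_gt_atTop 0] with n hn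
    have hN0 : (0 : ℝ) < ((n / m : ℕ) : ℝ) := by exact_mod_cast hn
    have hpos : (0 : ℝ) < ((n / m : ℕ) : ℝ) * m := by positivity
    rw [← Real.sqrt_div (Nat.cast_nonneg n)]
    have hle : (n : ℝ) / (((n / m : ℕ) : ℝ) * m) ≤ 1 + (((n / m : ℕ) : ℝ))⁻¹ := by
      rw [div_le_iff₀ hpos]
      have h2 : (n : ℝ) ≤ ((n / m : ℕ) : ℝ) * m + m := by
        exact_mod_cast (Nat.lt_div_mul_add hm (a := n)).le
      refine h2.trans (le_of_eq ?_)
      field_simp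
    have h3 : (1 : ℝ) ≤ 1 + (((n / m : ℕ) : ℝ))⁻¹ := by linarith [inv_pos.mpr hN0]
    refine Real.sqrt_le_iff.mpr ⟨by linarith, hle.trans ?_⟩
    nlinarith

lemma exists_tendsto_integral_exp_segSum (hξ : IsStationaryMarkovChain μ ξ)
    (hβ : IsAbsolutelyRegular μ ξ) (hf : Measurable f)
    (hf2 : MemLp f 2 (μ.map (ξ 0))) (hf0 : ∫ x, f x ∂(μ.map (ξ 0)) = 0) {C : ℝ}
    (hC : ∀ n : ℕ, ∫ ω, segSum f n (path ξ 0 ω) ^ 2 ∂μ ≤ C * n) :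
    ∃ v : ℝ, 0 ≤ v ∧ ∀ t : ℝ, Tendsto (fun n : ℕ => ∫ ω, Complex.exp
      ((t * (segSum f n (path ξ 0 ω) / √(n : ℝ)) : ℝ) * Complex.I) ∂μ) atTop
      (𝓝 (Complex.exp (-(t ^ 2 * v / 2 : ℝ)))) := by
  obtain ⟨v, hv0, happ⟩ := exists_block_approximation hξ hβ hf hf2 hf0 hC
  have hC0 : 0 ≤ C := by
    have := (integral_nonneg fun ω => sq_nonneg (segSum f 1 (path ξ 0 ω))).trans (hC 1)
    simpa using this
  refine ⟨v, hv0, fun t => ?_⟩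
  rw [Metric.tendsto_atTop']
  intro η hη
  -- The L¹ approximation costs 3ε|t| and the variance mismatch ε t²/2, together at most η/4; the
  -- block limit theorem costs another η/4.
  set ε : ℝ := η / (4 * (3 * |t| + t ^ 2 + 1)) with hε
  have hε0 : 0 < ε := by positivity
  obtain ⟨m, K, g, h, hm, hc, hgK, hhK, hvm, hev⟩ := happ ε hε0
  have hm0 : (0 : ℝ) < m := by exact_mod_cast hm
  set s := ∫ ω, blockDiff g h (path ξ 0 ω) ^ 2 ∂μ with hs
  have hs0 : 0 ≤ s := integral_nonneg fun _ => sq_nonneg _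
  have hg2 : MemLp (fun ω => g (fun j => ξ (j : ℕ) ω)) 2 μ :=
    MemLp.of_bound (hc.measurable_left.comp
      (measurable_pi_lambda _ fun _ => hξ.measurable _)).aestronglyMeasurable K
      (Eventually.of_forall fun ω => hgK _)
  have hN : Tendsto (fun n : ℕ => n / m) atTop atTop := Nat.tendsto_div_const_atTop hm.ne'
  set Q : ℕ → Ω → ℝ := fun N ω => ∑ j ∈ Finset.range N,
    blockDiff g h (path ξ ((j * m : ℕ) : ℤ) ω) with hQ
  -- Frequency t / √m because the block sum has to be normalised by √(N m), not √N; the limiting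
  -- variance becomes s / m, within ε of v.
  have hclt := (tendsto_integral_exp_sum_blockDiff hξ hβ hm hc hgK hhK (t / √m)).comp hN
  have hclt' : ∀ᶠ n : ℕ in atTop, ‖∫ ω, Complex.exp ((t / √m * (Q (n / m) ω / √((n / m : ℕ) : ℝ)) : ℝ)
      * Complex.I) ∂μ - Complex.exp (-((t / √m) ^ 2 * s / 2 : ℝ))‖ < η / 4 := by
    have := Metric.tendsto_nhds.mp hclt (η / 4) (by positivity)
    simpa only [dist_eq_norm, Function.comp] using this
  -- The bound 1 keeps the ratio below 2; the other makes the change of normalisation cost at most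
  -- ε, as E|S_n| ≤ √C √n.
  have hratio : ∀ᶠ n : ℕ in atTop, |√(n : ℝ) / √(((n / m : ℕ) : ℝ) * m) - 1|
      < min 1 (ε / (√C + 1)) := by
    have := Metric.tendsto_nhds.mp (tendsto_sqrt_mul_div_sub_one hm) (min 1 (ε / (√C + 1)))
      (lt_min one_pos (by positivity))
    simpa only [Real.dist_eq] using this
  obtain ⟨n₀, hn₀⟩ := eventually_atTop.mp ((hclt'.and hratio).and
    (hev.and ((eventually_gt_atTop 0).and (hN.eventually_gt_atTop 0))))
  refine ⟨n₀, fun n hn => ?_⟩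
  obtain ⟨⟨hn1, hn2⟩, hn3, hn4, hn5⟩ := hn₀ n hn.le
  have hn0 : (0 : ℝ) < n := by exact_mod_cast hn4
  have hsn : 0 < √(n : ℝ) := Real.sqrt_pos.mpr hn0
  have hNN : (0 : ℝ) < ((n / m : ℕ) : ℝ) := by exact_mod_cast hn5
  set N := n / m with hNdef
  have hsN : 0 < √((N : ℝ) * m) := Real.sqrt_pos.mpr (by positivity)
  have hS2 := memLp_segSum hξ hf hf2 n 0
  have hSi : Integrable (fun ω => segSum f n (path ξ 0 ω)) μ := hS2.integrable (by norm_num)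
  have hQi : Integrable (Q N) μ := integrable_finsetSum _ fun j _ =>
    (hc.memLp_blockDiff hξ hg2 _).integrable (by norm_num)
  set r : ℝ := √(n : ℝ) / √((N : ℝ) * m) with hr
  -- the partial sums and the block sums are close in mean
  have hclose : ∫ ω, |segSum f n (path ξ 0 ω) / √(n : ℝ) - Q N ω / √((N : ℝ) * m)| ∂μ ≤ 3 * ε := by
    have h1 : ∀ ω, |segSum f n (path ξ 0 ω) / √(n : ℝ) - Q N ω / √((N : ℝ) * m)|
        ≤ |r - 1| / √(n : ℝ) * |segSum f n (path ξ 0 ω)|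
          + r / √(n : ℝ) * |segSum f n (path ξ 0 ω) - Q N ω| := fun ω => by
      have e : segSum f n (path ξ 0 ω) / √(n : ℝ) - Q N ω / √((N : ℝ) * m)
          = -((r - 1) / √(n : ℝ) * segSum f n (path ξ 0 ω))
            + r / √(n : ℝ) * (segSum f n (path ξ 0 ω) - Q N ω) := by
        rw [hr]; field_simp; ring
      rw [e]
      refine (abs_add_le _ _).trans (le_of_eq ?_)
      rw [abs_neg, abs_mul, abs_mul, abs_div, abs_of_pos hsn, abs_of_nonneg (by positivity : 0 ≤ r / √(n : ℝ))]
    have hi1 := (hSi.abs).const_mul (|r - 1| / √(n : ℝ))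
    have hi2 := ((hSi.sub hQi).abs).const_mul (r / √(n : ℝ))
    have hle : Integrable (fun ω => |segSum f n (path ξ 0 ω) / √(n : ℝ) - Q N ω / √((N : ℝ) * m)|) μ :=
      ((hSi.div_const _).sub (hQi.div_const _)).abs
    refine (integral_mono hle (hi1.add hi2) h1).trans ?_
    rw [integral_add' hi1 hi2, integral_const_mul, integral_const_mul]
    have h2 : ∫ ω, |segSum f n (path ξ 0 ω)| ∂μ ≤ √C * √(n : ℝ) := by
      refine abs_le_of_sq_le_sq' (((sq_integral_abs_le hS2).trans (hC n)).trans (le_of_eq ?_))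
        (by positivity) |>.2
      rw [mul_pow, Real.sq_sqrt hC0, Real.sq_sqrt hn0.le]
    have h3 : |r - 1| / √(n : ℝ) * ∫ ω, |segSum f n (path ξ 0 ω)| ∂μ ≤ ε := by
      calc |r - 1| / √(n : ℝ) * ∫ ω, |segSum f n (path ξ 0 ω)| ∂μ
          ≤ |r - 1| / √(n : ℝ) * (√C * √(n : ℝ)) := by gcongr
        _ = |r - 1| * √C := by field_simp
        _ ≤ ε / (√C + 1) * √C := by
            gcongr
            exact hn2.le.trans (min_le_right _ _)
        _ ≤ ε := by
            rw [div_mul_eq_mul_div, div_le_iff₀ (by positivity)]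
            nlinarith [Real.sqrt_nonneg C]
    have h4 : r ≤ 2 := by
      have := (abs_lt.mp (hn2.trans_le (min_le_left _ _))).2
      linarith
    have h5 : r / √(n : ℝ) * ∫ ω, |segSum f n (path ξ 0 ω) - Q N ω| ∂μ ≤ 2 * ε := by
      calc r / √(n : ℝ) * ∫ ω, |segSum f n (path ξ 0 ω) - Q N ω| ∂μ
          ≤ r / √(n : ℝ) * (ε * √(n : ℝ)) := by gcongr
        _ = r * ε := by field_simp
        _ ≤ 2 * ε := by gcongr
    have h6 := add_le_add h3 h5
    refine le_trans (le_of_eq ?_) (h6.trans (by linarith))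
    rfl
  have hA := norm_integral_exp_sub_le (hSi.div_const √(n : ℝ)) (hQi.div_const √((N : ℝ) * m)) t
  have hQe : ∀ ω, t * (Q N ω / √((N : ℝ) * m)) = t / √m * (Q N ω / √(N : ℝ)) := fun ω => by
    rw [Real.sqrt_mul hNN.le]
    have := Real.sqrt_pos.mpr hm0
    have := Real.sqrt_pos.mpr hNN
    field_simp
  simp_rw [hQe] at hA
  have hB : ‖Complex.exp (-((t / √m) ^ 2 * s / 2 : ℝ)) - Complex.exp (-(t ^ 2 * v / 2 : ℝ))‖
      ≤ t ^ 2 / 2 * ε := by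
    rw [← Complex.ofReal_neg, ← Complex.ofReal_neg, ← Complex.ofReal_exp, ← Complex.ofReal_exp,
      ← Complex.ofReal_sub, Complex.norm_real, Real.norm_eq_abs]
    refine (abs_exp_neg_sub_le (by positivity) (by positivity)).trans ?_
    have e : (t / √m) ^ 2 * s / 2 - t ^ 2 * v / 2 = t ^ 2 / 2 * (s / m - v) := by
      rw [div_pow, Real.sq_sqrt hm0.le]; field_simp
    rw [e, abs_mul, abs_of_nonneg (by positivity)]
    gcongr
  have hεη : |t| * (3 * ε) + t ^ 2 / 2 * ε ≤ η / 4 := by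
    have : ε * (3 * |t| + t ^ 2 + 1) = η / 4 := by rw [hε]; field_simp
    nlinarith [sq_nonneg t, abs_nonneg t]
  rw [dist_eq_norm]
  have htri := norm_add₃_le (a := ∫ ω, Complex.exp
      ((t * (segSum f n (path ξ 0 ω) / √(n : ℝ)) : ℝ) * Complex.I) ∂μ
      - ∫ ω, Complex.exp ((t / √m * (Q N ω / √(N : ℝ)) : ℝ) * Complex.I) ∂μ)
    (b := ∫ ω, Complex.exp ((t / √m * (Q N ω / √(N : ℝ)) : ℝ) * Complex.I) ∂μ
      - Complex.exp (-((t / √m) ^ 2 * s / 2 : ℝ)))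
    (c := Complex.exp (-((t / √m) ^ 2 * s / 2 : ℝ)) - Complex.exp (-(t ^ 2 * v / 2 : ℝ)))
  rw [sub_add_sub_cancel, sub_add_sub_cancel] at htri
  have hA' : |t| * ∫ ω, |segSum f n (path ξ 0 ω) / √(n : ℝ) - Q N ω / √((N : ℝ) * m)| ∂μ
      ≤ |t| * (3 * ε) := mul_le_mul_of_nonneg_left hclose (abs_nonneg t)
  linarith

end CLT

end MarkovCLT

/-! ### The central limit theorem and its variance formula. -/

theorem corollary7 {Ω S : Type*} [MeasurableSpace Ω] [MeasurableSpace S]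
    (μ : Measure Ω) [IsProbabilityMeasure μ] (ξ : ℤ → Ω → S)
    (hξ : MarkovCLT.IsStationaryMarkovChain μ ξ)
    (hβ : MarkovCLT.IsAbsolutelyRegular μ ξ)
    (f : S → ℝ) (hf_meas : Measurable f)
    (hf_sq : MemLp f 2 (μ.map (ξ 0))) (hf_mean : ∫ x, f x ∂(μ.map (ξ 0)) = 0)
    (hvar : ∃ C : ℝ, ∀ n : ℕ, 1 ≤ n →
      (∫ ω, (MarkovCLT.partialSum ξ f n ω) ^ 2 ∂μ) / n ≤ C) :
    ∃ σsq : ℝ≥0,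
      Tendsto (fun n : ℕ =>
        Real.pi * (∫ ω, |MarkovCLT.partialSum ξ f n ω| ∂μ) ^ 2 / (2 * n)) atTop (𝓝 (σsq : ℝ)) ∧
      TendstoInDistribution
        (fun (n : ℕ) (ω : Ω) => MarkovCLT.partialSum ξ f n ω / √(n : ℝ)) atTop
        (id : ℝ → ℝ) (fun _ => μ) (gaussianReal 0 σsq) := by
  obtain ⟨C, hC⟩ := hvar
  simp_rw [MarkovCLT.partialSum_eq_segSum] at hC ⊢
  have hC' : ∀ n : ℕ, ∫ ω, MarkovCLT.segSum f n (MarkovCLT.path ξ 0 ω) ^ 2 ∂μ ≤ C * n := by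
    intro n
    rcases Nat.eq_zero_or_pos n with rfl | hn
    · simp [MarkovCLT.segSum]
    · exact (div_le_iff₀ (by exact_mod_cast hn)).mp (hC n hn)
  obtain ⟨v, hv0, hv⟩ := MarkovCLT.exists_tendsto_integral_exp_segSum hξ hβ hf_meas hf_sq hf_mean hC'
  lift v to ℝ≥0 using hv0
  have hS2 := fun n => MarkovCLT.memLp_segSum hξ hf_meas hf_sq n 0
  have hX2 : ∀ n : ℕ, MemLp (fun ω => MarkovCLT.segSum f n (MarkovCLT.path ξ 0 ω) / √(n : ℝ)) 2 μ := fun n => by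
    simp only [div_eq_mul_inv]
    exact (hS2 n).mul_const _
  have hdist : TendstoInDistribution (fun (n : ℕ) (ω : Ω) => MarkovCLT.segSum f n (MarkovCLT.path ξ 0 ω) / √(n : ℝ))
      atTop (id : ℝ → ℝ) (fun _ => μ) (gaussianReal 0 v) := by
    refine ⟨fun n => (hX2 n).aestronglyMeasurable.aemeasurable, aemeasurable_id, ?_⟩
    -- Lévy's continuity theorem turns the limit of characteristic functions into convergence in
    -- distribution.
    refine ProbabilityMeasure.tendsto_iff_tendsto_charFun.2 fun t => ?_
    simp only [ProbabilityMeasure.coe_mk, Measure.map_id]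
    have e : ∀ n : ℕ, charFun (μ.map fun ω => MarkovCLT.segSum f n (MarkovCLT.path ξ 0 ω) / √(n : ℝ)) t
        = ∫ ω, Complex.exp ((t * (MarkovCLT.segSum f n (MarkovCLT.path ξ 0 ω) / √(n : ℝ)) : ℝ) * Complex.I) ∂μ := by
      intro n
      rw [charFun_apply_real, integral_map (hX2 n).aestronglyMeasurable.aemeasurable
        (by fun_prop)]
      push_cast; rfl
    simp_rw [e]
    convert hv t using 2
    rw [charFun_gaussianReal]
    congr 1
    push_cast
    ring
  refine ⟨v, ?_, hdist⟩
  -- The bound |C| also covers n = 0, where the normalised second moment is 0.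
  have habs := MarkovCLT.tendsto_integral_abs_of_tendstoInDistribution hdist hX2
    (memLp_id_gaussianReal' 2 (by norm_num)) (V := |C|) (fun n => by
      simp_rw [div_pow]
      rw [integral_div, Real.sq_sqrt (Nat.cast_nonneg n)]
      rcases Nat.eq_zero_or_pos n with rfl | hn
      · simp
      · exact (hC n hn).trans (le_abs_self C))
  have hlim := ((habs.pow 2).const_mul Real.pi).div_const 2
  simp only [id] at hlim
  rw [MarkovCLT.pi_mul_sq_integral_abs_gaussianReal] at hlim
  refine hlim.congr fun n => ?_
  simp_rw [abs_div, abs_of_nonneg (Real.sqrt_nonneg (n : ℝ))]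
  rw [integral_div, div_pow, Real.sq_sqrt (Nat.cast_nonneg n)]
  rw [← mul_div_assoc, div_div, mul_comm (n : ℝ) 2]
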